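/- Let $K$ be a field of characteristic zero and let $X$ be a topological space with a basepoint $x_0$. CDGAs over $K$ are graded-commutative, graded in degrees $\ge 0$, with differential of degree $+1$. Let $A_{PL}(X;K)$ be Sullivan's CDGA of piecewise polynomial forms on $X$, and let $H^*(X;K)=H^*(A_{PL}(X;K))$ be its cohomology algebra, regarded as a CDGA with zero differential; both are augmented by evaluation at $x_0$. The space $X$ is called $K$-formal if there is a zig-zag of quasi-isomorphisms of CDGAs (with no condition on augmentations) $A_{PL}(X;K)\xleftarrow{\simeq}\cdots\xrightarrow{\simeq}H^*(X;K)$. For an augmented CDGA $(\mathcal A,\epsilon)$, let $B(\mathcal A)$ be its normalized bar complex: in degree $k$ it is $\bigoplus_{q-p=k}B^{-p,q}(\mathcal A)$, where $B^{-p,q}(\mathcal A)$ is the degree $q$ part of $\mathcal A^{\otimes p}$, spanned by the elements $[a_1|\cdots|a_p]$, modulo those with some $a_i=1$. With $\varepsilon(i)=\sum_{j\le i}(|a_j|+1)$, its differential is $$[a_1|\cdots|a_p]\mapsto\sum_{i=1}^p(-1)^{\varepsilon(i-1)}[a_1|\cdots|da_i|\cdots|a_p]+\sum_{i=0}^p(-1)^{\varepsilon(i)}d_i[a_1|\cdots|a_p],$$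 where $d_0[a_1|\cdots|a_p]=\epsilon(a_1)[a_2|\cdots|a_p]$, $d_p[a_1|\cdots|a_p]=\epsilon(a_p)[a_1|\cdots|a_{p-1}]$, and $d_i$ multiplies $a_i$ and $a_{i+1}$ for $0<i<p$ (for $p=0$ the differential is zero). Its product is the shuffle product, in which a shuffle has the Koszul sign for letters $a_j$ of degree $|a_j|+1$, and its coproduct is deconcatenation. Theorem. If $X$ is $K$-formal, then there is a zig-zag of quasi-isomorphisms of augmented CDGAs $$A_{PL}(X;K)\xleftarrow{\simeq}\cdots\xrightarrow{\simeq}\mathcal A\xleftarrow{\simeq}\cdots\xrightarrow{\simeq}H^*(X;K),$$ and the bar construction carries every such zig-zag to a zig-zag of quasi-isomorphisms of graded-commutative differential graded Hopf algebras $$B(A_{PL}(X;K))\xleftarrow{\simeq}\cdots\xrightarrow{\simeq}B(\mathcal A)\xleftarrow{\simeq}\cdots\xrightarrow{\simeq}B(H^*(X;K)).$$ -/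

import Mathlib

open scoped TensorProduct

universe u v w

/-- A commutative differential graded algebra over `K`: a non-negatively graded cochain algebra,
graded-commutative, with a differential of degree `+1`.  The structure maps are indexed by
equations between degrees, so that no transport between degrees is needed. -/
structure CDGA (K : Type v) [Field K] where
  obj : ℕ → Type w
  [addCommGroup : ∀ n, AddCommGroup (obj n)]
  [module : ∀ n, Module K (obj n)]
  d : ∀ {i j : ℕ}, i + 1 = j → obj i →ₗ[K] obj j
  one : obj 0
  mul : ∀ {i j k : ℕ}, i + j = k → obj i →ₗ[K] obj j →ₗ[K] obj k
  d_d : ∀ {i j k : ℕ} (h : i + 1 = j) (h' : j + 1 = k) (a : obj i), d h' (d h a) = 0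
  one_mul : ∀ {i : ℕ} (h : 0 + i = i) (a : obj i), mul h one a = a
  mul_one : ∀ {i : ℕ} (h : i + 0 = i) (a : obj i), mul h a one = a
  mul_assoc : ∀ {i j k ij jk n : ℕ} (h₁ : i + j = ij) (h₂ : ij + k = n) (h₃ : j + k = jk)
    (h₄ : i + jk = n) (a : obj i) (b : obj j) (c : obj k),
    mul h₂ (mul h₁ a b) c = mul h₄ a (mul h₃ b c)
  mul_comm : ∀ {i j k : ℕ} (h : i + j = k) (h' : j + i = k) (a : obj i) (b : obj j),
    mul h a b = (-1 : K) ^ (i * j) • mul h' b a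
  leibniz : ∀ {i j k i' j' k' : ℕ} (h : i + j = k) (hk : k + 1 = k') (hi : i + 1 = i')
    (hj : j + 1 = j') (h₁ : i' + j = k') (h₂ : i + j' = k') (a : obj i) (b : obj j),
    d hk (mul h a b) = mul h₁ (d hi a) b + (-1 : K) ^ i • mul h₂ a (d hj b)

namespace CDGA

attribute [instance] CDGA.addCommGroup CDGA.module

variable {K : Type v} [Field K]

/-- Morphisms of CDGAs. -/
structure Hom (A B : CDGA.{v, w} K) where
  toFun : ∀ n, A.obj n →ₗ[K] B.obj n
  map_d : ∀ {i j : ℕ} (h : i + 1 = j) (a : A.obj i), toFun j (A.d h a) = B.d h (toFun i a)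
  map_one : toFun 0 A.one = B.one
  map_mul : ∀ {i j k : ℕ} (h : i + j = k) (a : A.obj i) (b : A.obj j),
    toFun k (A.mul h a b) = B.mul h (toFun i a) (toFun j b)

/-- The cocycles of degree `n`. -/
def cocycles (A : CDGA.{v, w} K) (n : ℕ) : Submodule K (A.obj n) :=
  LinearMap.ker (A.d (rfl : n + 1 = n + 1))

/-- The coboundaries of degree `n` (zero for `n = 0`). -/
def coboundaries (A : CDGA.{v, w} K) (n : ℕ) : Submodule K (A.obj n) where
  carrier := {x | ∃ (m : ℕ) (h : m + 1 = n) (y : A.obj m), A.d h y = x} ∪ {0}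
  zero_mem' := Or.inr rfl
  add_mem' := by
    rintro a b (⟨m, h, y, rfl⟩ | rfl) (⟨m', h', y', rfl⟩ | rfl)
    · obtain rfl : m = m' := by omega
      exact Or.inl ⟨m, h, y + y', by simp⟩
    · exact Or.inl ⟨m, h, y, by simp⟩
    · exact Or.inl ⟨m', h', y', by simp⟩
    · exact Or.inr (by simp)
  smul_mem' := by
    rintro c a (⟨m, h, y, rfl⟩ | rfl)
    · exact Or.inl ⟨m, h, c • y, by simp⟩
    · exact Or.inr (by simp)

/-- The cohomology `H^n(A)`, cocycles modulo coboundaries. -/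
abbrev Cohomology (A : CDGA.{v, w} K) (n : ℕ) : Type w :=
  A.cocycles n ⧸ (A.coboundaries n).comap (A.cocycles n).subtype

theorem d_eq_zero (A : CDGA.{v, w} K) {n m : ℕ} (h : n + 1 = m) (x : A.cocycles n) :
    A.d h (x : A.obj n) = 0 := by
  subst h; exact x.2

theorem d_one (A : CDGA.{v, w} K) {m : ℕ} (h : 0 + 1 = m) : A.d h A.one = 0 := by
  have := A.leibniz (rfl : 0 + 0 = 0) h h h (by omega) (by omega) A.one A.one
  subst h
  rw [A.one_mul, A.mul_one, A.one_mul (i := 1)] at this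
  simpa using this

namespace Hom

variable {A B C : CDGA.{v, w} K}

/-- The map induced on cohomology. -/
def cohomologyMap (f : Hom A B) (n : ℕ) : A.Cohomology n →ₗ[K] B.Cohomology n :=
  Submodule.mapQ _ _
    ((f.toFun n).restrict (p := A.cocycles n) (q := B.cocycles n) (by
      intro x hx
      have : A.d (rfl : n + 1 = n + 1) x = 0 := hx
      change B.d (rfl : n + 1 = n + 1) (f.toFun n x) = 0
      rw [← f.map_d, this, map_zero])) (by
    rintro ⟨x, hx⟩ (⟨m, h, y, hy⟩ | hy)
    · exact Or.inl ⟨m, h, f.toFun m y, by rw [← f.map_d, hy]; rfl⟩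
    · refine Or.inr ?_
      have : x = 0 := hy
      subst this
      simp)

/-- Quasi-isomorphisms: isomorphisms on cohomology in every degree. -/
def IsQuasiIso (f : Hom A B) : Prop := ∀ n, Function.Bijective (f.cohomologyMap n)

end Hom

theorem mul_mem_cocycles (A : CDGA.{v, w} K) {i j k : ℕ} (h : i + j = k) {a : A.obj i}
    {b : A.obj j} (ha : a ∈ A.cocycles i) (hb : b ∈ A.cocycles j) :
    A.mul h a b ∈ A.cocycles k := by
  change A.d (rfl : k + 1 = k + 1) _ = 0
  rw [A.leibniz h rfl rfl rfl (by omega) (by omega), A.d_eq_zero rfl ⟨a, ha⟩,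
    A.d_eq_zero rfl ⟨b, hb⟩]
  simp

theorem mul_mem_coboundaries_left (A : CDGA.{v, w} K) {i j k : ℕ} (h : i + j = k) {a : A.obj i}
    {b : A.obj j} (ha : a ∈ A.coboundaries i) (hb : b ∈ A.cocycles j) :
    A.mul h a b ∈ A.coboundaries k := by
  rcases ha with ⟨m, hm, y, rfl⟩ | ha
  · refine Or.inl ⟨m + j, by omega, A.mul rfl y b, ?_⟩
    rw [A.leibniz rfl (by omega) hm rfl h (by omega), A.d_eq_zero rfl ⟨b, hb⟩]
    simp
  · have : a = 0 := ha
    subst this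
    simp

theorem mul_mem_coboundaries_right (A : CDGA.{v, w} K) {i j k : ℕ} (h : i + j = k) {a : A.obj i}
    {b : A.obj j} (ha : a ∈ A.cocycles i) (hb : b ∈ A.coboundaries j) :
    A.mul h a b ∈ A.coboundaries k := by
  rw [A.mul_comm h (by omega)]
  exact Submodule.smul_mem _ _ (A.mul_mem_coboundaries_left _ hb ha)

/-- The product on cohomology. -/
def cohomologyMul (A : CDGA.{v, w} K) {i j k : ℕ} (h : i + j = k) :
    A.Cohomology i →ₗ[K] A.Cohomology j →ₗ[K] A.Cohomology k :=
  Submodule.liftQ _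
    (LinearMap.flip
      (Submodule.liftQ _
        (LinearMap.flip
          (LinearMap.mk₂ K
            (fun (a : A.cocycles i) (b : A.cocycles j) =>
              (Submodule.Quotient.mk ⟨A.mul h a b, A.mul_mem_cocycles h a.2 b.2⟩ :
                A.Cohomology k))
            (fun a a' b => by
              rw [← Submodule.Quotient.mk_add]; congr 1; ext; simp)
            (fun c a b => by
              rw [← Submodule.Quotient.mk_smul]; congr 1; ext; simp)
            (fun a b b' => by
              rw [← Submodule.Quotient.mk_add]; congr 1; ext; simp)
            (fun c a b => by
              rw [← Submodule.Quotient.mk_smul]; congr 1; ext; simp)))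
        (by
          intro b hb
          ext a
          exact (Submodule.Quotient.mk_eq_zero _).2 (A.mul_mem_coboundaries_right h a.2 hb))))
    (by
      intro a ha
      refine LinearMap.ext fun b => ?_
      obtain ⟨b, rfl⟩ := Submodule.Quotient.mk_surjective _ b
      exact (Submodule.Quotient.mk_eq_zero _).2 (A.mul_mem_coboundaries_left h ha b.2))

theorem cohomologyMul_mk (A : CDGA.{v, w} K) {i j k : ℕ} (h : i + j = k) (a : A.cocycles i)
    (b : A.cocycles j) :
    A.cohomologyMul h (Submodule.Quotient.mk a) (Submodule.Quotient.mk b) =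
      Submodule.Quotient.mk ⟨A.mul h a b, A.mul_mem_cocycles h a.2 b.2⟩ := rfl

/-- The cohomology algebra `H^*(A)`, a CDGA with zero differential. -/
def cohomology (A : CDGA.{v, w} K) : CDGA.{v, w} K where
  obj := A.Cohomology
  d _ := 0
  one := Submodule.Quotient.mk ⟨A.one, A.d_one rfl⟩
  mul := A.cohomologyMul
  d_d _ _ _ := rfl
  one_mul h a := by
    obtain ⟨a, rfl⟩ := Submodule.Quotient.mk_surjective _ a
    rw [cohomologyMul_mk]; congr 1; ext; exact A.one_mul h _
  mul_one h a := by
    obtain ⟨a, rfl⟩ := Submodule.Quotient.mk_surjective _ a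
    rw [cohomologyMul_mk]; congr 1; ext; exact A.mul_one h _
  mul_assoc h₁ h₂ h₃ h₄ a b c := by
    obtain ⟨a, rfl⟩ := Submodule.Quotient.mk_surjective _ a
    obtain ⟨b, rfl⟩ := Submodule.Quotient.mk_surjective _ b
    obtain ⟨c, rfl⟩ := Submodule.Quotient.mk_surjective _ c
    simp only [cohomologyMul_mk]; congr 1; ext; exact A.mul_assoc h₁ h₂ h₃ h₄ _ _ _
  mul_comm h h' a b := by
    obtain ⟨a, rfl⟩ := Submodule.Quotient.mk_surjective _ a
    obtain ⟨b, rfl⟩ := Submodule.Quotient.mk_surjective _ b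
    simp only [cohomologyMul_mk]
    rw [← Submodule.Quotient.mk_smul]; congr 1; ext; exact A.mul_comm h h' _ _
  leibniz _ _ _ _ _ _ _ _ := by simp

end CDGA

/-- An augmented CDGA: a CDGA with a morphism of CDGAs to `K` (concentrated in degree `0`), that
is, an algebra morphism from its degree `0` part to `K`, extended by zero. -/
structure AugCDGA (K : Type v) [Field K] extends CDGA.{v, w} K where
  aug : obj 0 →ₗ[K] K
  aug_one : aug one = 1
  aug_mul : ∀ (h : 0 + 0 = 0) (a b : obj 0), aug (mul h a b) = aug a * aug b

namespace AugCDGA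

variable {K : Type v} [Field K]

/-- Morphisms of augmented CDGAs: morphisms of CDGAs that commute with the augmentations. -/
structure Hom (A B : AugCDGA.{v, w} K) extends CDGA.Hom A.toCDGA B.toCDGA where
  aug_map : ∀ a : A.obj 0, B.aug (toFun 0 a) = A.aug a

/-- The cohomology of an augmented CDGA, with the induced augmentation on `H^0`. -/
def cohomology (A : AugCDGA.{v, w} K) : AugCDGA.{v, w} K where
  toCDGA := A.toCDGA.cohomology
  aug := Submodule.liftQ _ (A.aug ∘ₗ (A.cocycles 0).subtype) (by
    rintro ⟨x, hx⟩ (⟨m, h, y, hy⟩ | hy)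
    · omega
    · have : x = 0 := hy
      subst this
      simp)
  aug_one := A.aug_one
  aug_mul h a b := by
    obtain ⟨a, rfl⟩ := Submodule.Quotient.mk_surjective _ a
    obtain ⟨b, rfl⟩ := Submodule.Quotient.mk_surjective _ b
    exact A.aug_mul h _ _

end AugCDGA

/-- A (finite) zig-zag of arrows `A ⟵ · ⟶ ⋯ ⟶ B`, pointing in either direction. -/
inductive ZigZag {Ob : Type u} (Arr : Ob → Ob → Type v) : Ob → Ob → Type (max u v)
  | nil (A : Ob) : ZigZag Arr A A
  | fwd {A A' B : Ob} (f : Arr A A') (Z : ZigZag Arr A' B) : ZigZag Arr A B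
  | bwd {A A' B : Ob} (f : Arr A' A) (Z : ZigZag Arr A' B) : ZigZag Arr A B

/-- Quasi-isomorphisms of CDGAs. -/
abbrev CDGA.QuasiIso {K : Type v} [Field K] (A B : CDGA.{v, w} K) : Type w :=
  {f : CDGA.Hom A B // f.IsQuasiIso}

/-- Quasi-isomorphisms of augmented CDGAs. -/
abbrev AugCDGA.QuasiIso {K : Type v} [Field K] (A B : AugCDGA.{v, w} K) : Type w :=
  {f : AugCDGA.Hom A B // f.toHom.IsQuasiIso}


/-- The relations between the generators `t i` and `dt i`: graded commutativity, `∑ t i = 1` and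
`∑ dt i = 0`.  (In characteristic different from `2`, `dt i * dt i = 0` follows.) -/
inductive FormRel (K : Type v) [Field K] (ι : Type) [Fintype ι] :
    FreeAlgebra K (ι ⊕ ι) → FreeAlgebra K (ι ⊕ ι) → Prop
  | comm_tt (i j : ι) : FormRel K ι
      (FreeAlgebra.ι K (Sum.inl i) * FreeAlgebra.ι K (Sum.inl j))
      (FreeAlgebra.ι K (Sum.inl j) * FreeAlgebra.ι K (Sum.inl i))
  | comm_tdt (i j : ι) : FormRel K ι
      (FreeAlgebra.ι K (Sum.inl i) * FreeAlgebra.ι K (Sum.inr j))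
      (FreeAlgebra.ι K (Sum.inr j) * FreeAlgebra.ι K (Sum.inl i))
  | comm_dtdt (i j : ι) : FormRel K ι
      (FreeAlgebra.ι K (Sum.inr i) * FreeAlgebra.ι K (Sum.inr j))
      (-(FreeAlgebra.ι K (Sum.inr j) * FreeAlgebra.ι K (Sum.inr i)))
  | sum_t : FormRel K ι (∑ i, FreeAlgebra.ι K (Sum.inl i)) 1
  | sum_dt : FormRel K ι (∑ i, FreeAlgebra.ι K (Sum.inr i)) 0

/-- Polynomial differential forms (of all degrees) with coefficients in `K` on the simplex with
vertex set `ι`: the graded-commutative algebra generated by `t i` in degree `0` and `dt i` in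
degree `1`, subject to `∑ t i = 1` and `∑ dt i = 0`. -/
def PolyForm (K : Type v) [Field K] (ι : Type) [Fintype ι] : Type v :=
  RingQuot (FormRel K ι)

namespace PolyForm

noncomputable instance (K : Type v) [Field K] (ι : Type) [Fintype ι] : Ring (PolyForm K ι) :=
  inferInstanceAs (Ring (RingQuot (FormRel K ι)))

noncomputable instance (K : Type v) [Field K] (ι : Type) [Fintype ι] :
    Algebra K (PolyForm K ι) :=
  inferInstanceAs (Algebra K (RingQuot (FormRel K ι)))

/-- The quotient map from the free algebra. -/
noncomputable def mk (K : Type v) [Field K] (ι : Type) [Fintype ι] :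
    FreeAlgebra K (ι ⊕ ι) →ₐ[K] PolyForm K ι :=
  RingQuot.mkAlgHom K (FormRel K ι)

variable {K : Type v} [Field K] {ι κ : Type} [Fintype ι] [Fintype κ]

theorem mk_rel {a b : FreeAlgebra K (ι ⊕ ι)} (h : FormRel K ι a b) : mk K ι a = mk K ι b :=
  RingQuot.mkAlgHom_rel K h

/-- The generators `t i` and `dt i`. -/
noncomputable def gen (K : Type v) [Field K] {ι : Type} [Fintype ι] (s : ι ⊕ ι) : PolyForm K ι :=
  mk K ι (FreeAlgebra.ι K s)

noncomputable abbrev t (K : Type v) [Field K] {ι : Type} [Fintype ι] (i : ι) : PolyForm K ι :=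
  gen K (Sum.inl i)

noncomputable abbrev dt (K : Type v) [Field K] {ι : Type} [Fintype ι] (i : ι) : PolyForm K ι :=
  gen K (Sum.inr i)

theorem t_mul_t (i j : ι) : t K i * t K j = t K j * t K i := by
  simpa [gen] using mk_rel (FormRel.comm_tt (K := K) i j)

theorem t_mul_dt (i j : ι) : t K i * dt K j = dt K j * t K i := by
  simpa [gen] using mk_rel (FormRel.comm_tdt (K := K) i j)

theorem dt_mul_dt (i j : ι) : dt K i * dt K j = -(dt K j * dt K i) := by
  simpa [gen] using mk_rel (FormRel.comm_dtdt (K := K) i j)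

theorem sum_t : ∑ i : ι, t K i = 1 := by
  simpa [gen] using mk_rel (FormRel.sum_t (K := K) (ι := ι))

theorem sum_dt : ∑ i : ι, dt K i = 0 := by
  simpa [gen] using mk_rel (FormRel.sum_dt (K := K) (ι := ι))

/-- The algebra morphism out of polynomial forms with given values on the generators. -/
noncomputable def lift {R : Type w} [Ring R] [Algebra K R] (f : ι ⊕ ι → R)
    (h₁ : ∀ i j, f (Sum.inl i) * f (Sum.inl j) = f (Sum.inl j) * f (Sum.inl i))
    (h₂ : ∀ i j, f (Sum.inl i) * f (Sum.inr j) = f (Sum.inr j) * f (Sum.inl i))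
    (h₃ : ∀ i j, f (Sum.inr i) * f (Sum.inr j) = -(f (Sum.inr j) * f (Sum.inr i)))
    (h₄ : ∑ i, f (Sum.inl i) = 1) (h₅ : ∑ i, f (Sum.inr i) = 0) : PolyForm K ι →ₐ[K] R :=
  RingQuot.liftAlgHom K ⟨FreeAlgebra.lift K f, by
    rintro _ _ (⟨i, j⟩ | ⟨i, j⟩ | ⟨i, j⟩ | _ | _)
    · simpa using h₁ i j
    · simpa using h₂ i j
    · simpa using h₃ i j
    · simpa using h₄
    · simpa using h₅⟩

@[simp]
theorem lift_gen {R : Type w} [Ring R] [Algebra K R] (f : ι ⊕ ι → R) (h₁) (h₂) (h₃) (h₄) (h₅)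
    (s : ι ⊕ ι) : lift (K := K) f h₁ h₂ h₃ h₄ h₅ (gen K s) = f s := by
  change RingQuot.liftAlgHom K _ (RingQuot.mkAlgHom K (FormRel K ι) (FreeAlgebra.ι K s)) = _
  simp

/-- The monomial given by a list of generators. -/
noncomputable def mon (K : Type v) [Field K] {ι : Type} [Fintype ι] (l : List (ι ⊕ ι)) :
    PolyForm K ι := (l.map (gen K)).prod

@[simp] theorem mon_nil : mon K ([] : List (ι ⊕ ι)) = 1 := rfl

@[simp] theorem mon_cons (s : ι ⊕ ι) (l : List (ι ⊕ ι)) : mon K (s :: l) = gen K s * mon K l := by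
  simp [mon]

@[simp] theorem mon_append (l l' : List (ι ⊕ ι)) : mon K (l ++ l') = mon K l * mon K l' := by
  simp [mon]

/-- The number of factors `dt i` in a list of generators. -/
def formDeg {ι : Type} (l : List (ι ⊕ ι)) : ℕ := (l.filter Sum.isRight).length

@[simp] theorem formDeg_nil {ι : Type} : formDeg ([] : List (ι ⊕ ι)) = 0 := rfl

@[simp] theorem formDeg_inl {ι : Type} (i : ι) (l : List (ι ⊕ ι)) :
    formDeg (Sum.inl i :: l) = formDeg l := by simp [formDeg]

@[simp] theorem formDeg_inr {ι : Type} (i : ι) (l : List (ι ⊕ ι)) :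
    formDeg (Sum.inr i :: l) = formDeg l + 1 := rfl

@[simp] theorem formDeg_append {ι : Type} (l l' : List (ι ⊕ ι)) :
    formDeg (l ++ l') = formDeg l + formDeg l' := by simp [formDeg]

/-- Polynomial `q`-forms: the span of the monomials with exactly `q` factors `dt i`. -/
noncomputable def deg (K : Type v) [Field K] (ι : Type) [Fintype ι] (q : ℕ) : Submodule K (PolyForm K ι) :=
  Submodule.span K {a | ∃ l : List (ι ⊕ ι), formDeg l = q ∧ mon K l = a}

theorem mon_mem (l : List (ι ⊕ ι)) : mon K l ∈ deg K ι (formDeg l) :=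
  Submodule.subset_span ⟨l, rfl, rfl⟩

theorem one_mem : (1 : PolyForm K ι) ∈ deg K ι 0 := by
  simpa using mon_mem (K := K) ([] : List (ι ⊕ ι))

theorem mul_mem {p q : ℕ} {a b : PolyForm K ι} (ha : a ∈ deg K ι p) (hb : b ∈ deg K ι q) :
    a * b ∈ deg K ι (p + q) := by
  induction ha using Submodule.span_induction with
  | zero => simp
  | add x y _ _ hx hy => rw [add_mul]; exact add_mem hx hy
  | smul c x _ hx => rw [smul_mul_assoc]; exact Submodule.smul_mem _ _ hx
  | mem a ha =>
    obtain ⟨l, rfl, rfl⟩ := ha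
    induction hb using Submodule.span_induction with
    | zero => simp
    | add x y _ _ hx hy => rw [mul_add]; exact add_mem hx hy
    | smul c x _ hx => rw [mul_smul_comm]; exact Submodule.smul_mem _ _ hx
    | mem b hb =>
      obtain ⟨l', rfl, rfl⟩ := hb
      simpa using mon_mem (K := K) (l ++ l')

theorem gen_mul_mon (s : ι ⊕ ι) (l : List (ι ⊕ ι)) :
    gen K s * mon K l = (-1 : K) ^ (formDeg [s] * formDeg l) • (mon K l * gen K s) := by
  induction l with
  | nil => simp
  | cons r l ih =>
    rw [mon_cons, ← mul_assoc]
    have key : gen K s * gen K r =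
        (-1 : K) ^ (formDeg [s] * formDeg [r]) • (gen K r * gen K s) := by
      rcases s with i | i <;> rcases r with j | j
      · simpa using t_mul_t i j
      · simpa using t_mul_dt i j
      · simpa using (t_mul_dt j i).symm
      · simpa using dt_mul_dt i j
    have hd : formDeg (r :: l) = formDeg [r] + formDeg l := formDeg_append [r] l
    rw [key, smul_mul_assoc, mul_assoc, ih, mul_smul_comm, smul_smul, hd, mul_add, pow_add,
      mul_assoc]

theorem mon_mul_mon (l l' : List (ι ⊕ ι)) :
    mon K l * mon K l' = (-1 : K) ^ (formDeg l * formDeg l') • (mon K l' * mon K l) := by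
  induction l with
  | nil => simp
  | cons s l ih =>
    have hd : formDeg (s :: l) = formDeg [s] + formDeg l := formDeg_append [s] l
    rw [mon_cons, mul_assoc, ih, mul_smul_comm, ← mul_assoc, gen_mul_mon, smul_mul_assoc,
      smul_smul, hd, add_mul, pow_add, mul_assoc, mul_comm ((-1 : K) ^ (formDeg l * _))]

theorem mul_comm_of_mem {p q : ℕ} {a b : PolyForm K ι} (ha : a ∈ deg K ι p)
    (hb : b ∈ deg K ι q) : a * b = (-1 : K) ^ (p * q) • (b * a) := by
  induction ha using Submodule.span_induction with
  | zero => simp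
  | add x y _ _ hx hy => rw [add_mul, mul_add, hx, hy, smul_add]
  | smul c x _ hx => rw [smul_mul_assoc, mul_smul_comm, hx, smul_comm]
  | mem a ha =>
    obtain ⟨l, rfl, rfl⟩ := ha
    induction hb using Submodule.span_induction with
    | zero => simp
    | add x y _ _ hx hy => rw [add_mul, mul_add, hx, hy, smul_add]
    | smul c x _ hx => rw [smul_mul_assoc, mul_smul_comm, hx, smul_comm]
    | mem b hb =>
      obtain ⟨l', rfl, rfl⟩ := hb
      exact mon_mul_mon l l'

/-- The value of `a ↦ ((-1)^|a| a, da; 0, a)` on the generators. -/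
noncomputable def dGen (K : Type v) [Field K] {ι : Type} [Fintype ι] :
    ι ⊕ ι → Matrix (Fin 2) (Fin 2) (PolyForm K ι)
  | Sum.inl i => !![t K i, dt K i; 0, t K i]
  | Sum.inr i => !![-dt K i, 0; 0, dt K i]

/-- The algebra morphism `a ↦ ((-1)^|a| a, da; 0, a)`, which encodes the graded Leibniz rule. -/
noncomputable def dMat : PolyForm K ι →ₐ[K] Matrix (Fin 2) (Fin 2) (PolyForm K ι) :=
  lift (dGen K)
    (by
      intro i j
      have h := t_mul_dt (K := K) i j
      have h' := t_mul_dt (K := K) j i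
      simp [dGen, t_mul_t i j, h, h', add_comm])
    (by
      intro i j
      simp [dGen, t_mul_dt, dt_mul_dt i j])
    (by
      intro i j
      simp [dGen, dt_mul_dt i j])
    (by
      ext a b
      rw [Matrix.sum_apply]
      fin_cases a <;> fin_cases b <;> simp [dGen, sum_t, sum_dt])
    (by
      ext a b
      rw [Matrix.sum_apply]
      fin_cases a <;> fin_cases b <;> simp [dGen, sum_dt])

/-- The exterior derivative on polynomial forms: the graded derivation with `d (t i) = dt i` and
`d (dt i) = 0`. -/
noncomputable def d : PolyForm K ι →ₗ[K] PolyForm K ι :=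
  (Matrix.entryLinearMap K (PolyForm K ι) (0 : Fin 2) (1 : Fin 2)) ∘ₗ dMat.toLinearMap

theorem dMat_mon (l : List (ι ⊕ ι)) : dMat (mon K l) 1 0 = 0 ∧ dMat (mon K l) 1 1 = mon K l ∧
    dMat (mon K l) 0 0 = (-1 : K) ^ formDeg l • mon K l := by
  induction l with
  | nil => simp
  | cons s l ih =>
    obtain ⟨h₁, h₂, h₃⟩ := ih
    rcases s with i | i
    · simp [dMat, dGen, Matrix.mul_apply, Fin.sum_univ_two] at h₁ h₂ h₃ ⊢
      simp [h₁, h₂, h₃]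
    · simp [dMat, dGen, Matrix.mul_apply, Fin.sum_univ_two] at h₁ h₂ h₃ ⊢
      simp [h₁, h₂, h₃, pow_succ]

@[simp] theorem d_one : d (1 : PolyForm K ι) = 0 := by simp [d]

@[simp] theorem d_t (i : ι) : d (t K i) = dt K i := by simp [d, dMat, dGen]

@[simp] theorem d_dt (i : ι) : d (dt K i) = 0 := by simp [d, dMat, dGen]

theorem d_mon_mul (l : List (ι ⊕ ι)) (b : PolyForm K ι) (hb : dMat b 1 1 = b) :
    d (mon K l * b) = d (mon K l) * b + (-1 : K) ^ formDeg l • (mon K l * d b) := by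
  obtain ⟨-, -, h₃⟩ := dMat_mon (K := K) l
  simp [d, Matrix.mul_apply, Fin.sum_univ_two, h₃, hb, add_comm]

theorem leibniz {p q : ℕ} {a b : PolyForm K ι} (ha : a ∈ deg K ι p) (hb : b ∈ deg K ι q) :
    d (a * b) = d a * b + (-1 : K) ^ p • (a * d b) := by
  induction ha using Submodule.span_induction with
  | zero => simp
  | add x y _ _ hx hy => rw [add_mul, map_add, map_add, hx, hy, add_mul, add_mul, smul_add]; abel
  | smul c x _ hx =>
    rw [smul_mul_assoc, map_smul, map_smul, hx, smul_mul_assoc, smul_mul_assoc, smul_add,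
      smul_comm c]
  | mem a ha =>
    obtain ⟨l, rfl, rfl⟩ := ha
    refine d_mon_mul l b ?_
    induction hb using Submodule.span_induction with
    | zero => simp
    | add x y _ _ hx hy => simp [hx, hy]
    | smul c x _ hx => simp [hx]
    | mem b hb =>
      obtain ⟨l', rfl, rfl⟩ := hb
      exact (dMat_mon l').2.1

theorem d_gen_mul (s : ι ⊕ ι) (l : List (ι ⊕ ι)) :
    d (gen K s * mon K l) =
      d (gen K s) * mon K l + (-1 : K) ^ formDeg [s] • (gen K s * d (mon K l)) := by
  simpa using d_mon_mul (K := K) [s] (mon K l) (dMat_mon l).2.1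

theorem d_mem {q : ℕ} {a : PolyForm K ι} (ha : a ∈ deg K ι q) : d a ∈ deg K ι (q + 1) := by
  induction ha using Submodule.span_induction with
  | zero => simp
  | add x y _ _ hx hy => rw [map_add]; exact add_mem hx hy
  | smul c x _ hx => rw [map_smul]; exact Submodule.smul_mem _ _ hx
  | mem a ha =>
    obtain ⟨l, rfl, rfl⟩ := ha
    induction l with
    | nil => simp
    | cons s l ih =>
      rw [mon_cons, d_gen_mul]
      rcases s with i | i
      · refine add_mem ?_ (Submodule.smul_mem _ _ ?_)
        · simpa using mon_mem (K := K) (Sum.inr i :: l)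
        · have := mul_mem (mon_mem (K := K) [Sum.inl i]) ih
          simpa using this
      · refine add_mem (by simp) (Submodule.smul_mem _ _ ?_)
        have := mul_mem (mon_mem (K := K) [Sum.inr i]) ih
        rw [show formDeg (Sum.inr i :: l) + 1 = formDeg [Sum.inr i] + (formDeg l + 1) by
          simp; omega]
        simpa using this

theorem d_d {q : ℕ} {a : PolyForm K ι} (ha : a ∈ deg K ι q) : d (d a) = 0 := by
  induction ha using Submodule.span_induction with
  | zero => simp
  | add x y _ _ hx hy => rw [map_add, map_add, hx, hy, add_zero]
  | smul c x _ hx => rw [map_smul, map_smul, hx, smul_zero]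
  | mem a ha =>
    obtain ⟨l, rfl, rfl⟩ := ha
    induction l with
    | nil => simp
    | cons s l ih =>
      have hdl := d_mem (mon_mem (K := K) l)
      rcases s with i | i
      · have h₁ := leibniz (mon_mem (K := K) [Sum.inr i]) (mon_mem l)
        have h₂ := leibniz (mon_mem (K := K) [Sum.inl i]) hdl
        simp at h₁ h₂
        rw [mon_cons, d_gen_mul]
        simp [h₁, h₂, ih]
      · have h₂ := leibniz (mon_mem (K := K) [Sum.inr i]) hdl
        simp at h₂
        rw [mon_cons, d_gen_mul]
        simp [h₂, ih]

/-- Pullback of polynomial forms along the simplicial map given by a map `θ` on vertices: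
`t j ↦ ∑_{θ i = j} t i` and `dt j ↦ ∑_{θ i = j} dt i`. -/
noncomputable def pullback [DecidableEq κ] (θ : ι → κ) : PolyForm K κ →ₐ[K] PolyForm K ι :=
  lift
    (Sum.elim (fun j => ∑ i with θ i = j, t K i) (fun j => ∑ i with θ i = j, dt K i))
    (by
      intro i j
      simp only [Sum.elim_inl]
      exact Commute.sum_left _ _ _ fun _ _ => Commute.sum_right _ _ _ fun _ _ => t_mul_t _ _)
    (by
      intro i j
      simp only [Sum.elim_inl, Sum.elim_inr]
      exact Commute.sum_left _ _ _ fun _ _ => Commute.sum_right _ _ _ fun _ _ => t_mul_dt _ _)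
    (by
      intro i j
      simp only [Sum.elim_inr, Finset.sum_mul_sum]
      rw [Finset.sum_comm, ← Finset.sum_neg_distrib]
      refine Finset.sum_congr rfl fun a _ => ?_
      rw [← Finset.sum_neg_distrib]
      exact Finset.sum_congr rfl fun b _ => dt_mul_dt _ _)
    (by
      simp only [Sum.elim_inl]
      rw [Finset.sum_fiberwise, sum_t])
    (by
      simp only [Sum.elim_inr]
      rw [Finset.sum_fiberwise, sum_dt])

theorem pullback_gen_mem [DecidableEq κ] (θ : ι → κ) (s : κ ⊕ κ) :
    pullback θ (gen K s) ∈ deg K ι (formDeg [s]) := by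
  rcases s with j | j
  · simp only [pullback, lift_gen, Sum.elim_inl]
    refine sum_mem fun i _ => ?_
    simpa using mon_mem (K := K) [Sum.inl i]
  · simp only [pullback, lift_gen, Sum.elim_inr]
    refine sum_mem fun i _ => ?_
    simpa using mon_mem (K := K) [Sum.inr i]

theorem pullback_mem [DecidableEq κ] (θ : ι → κ) {q : ℕ} {a : PolyForm K κ}
    (ha : a ∈ deg K κ q) : pullback θ a ∈ deg K ι q := by
  induction ha using Submodule.span_induction with
  | zero => simp
  | add x y _ _ hx hy => rw [map_add]; exact add_mem hx hy
  | smul c x _ hx => rw [map_smul]; exact Submodule.smul_mem _ _ hx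
  | mem a ha =>
    obtain ⟨l, rfl, rfl⟩ := ha
    induction l with
    | nil => simpa using one_mem
    | cons s l ih =>
      have hd : formDeg (s :: l) = formDeg [s] + formDeg l := formDeg_append [s] l
      rw [mon_cons, map_mul, hd]
      exact mul_mem (pullback_gen_mem θ s) ih

theorem pullback_d [DecidableEq κ] (θ : ι → κ) {q : ℕ} {a : PolyForm K κ} (ha : a ∈ deg K κ q) :
    pullback θ (d a) = d (pullback θ a) := by
  induction ha using Submodule.span_induction with
  | zero => simp
  | add x y _ _ hx hy => simp only [map_add, hx, hy]
  | smul c x _ hx => simp only [map_smul, hx]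
  | mem a ha =>
    obtain ⟨l, rfl, rfl⟩ := ha
    induction l with
    | nil => simp
    | cons s l ih =>
      have h := leibniz (pullback_gen_mem (K := K) θ s) (pullback_mem θ (mon_mem l))
      have hs : pullback θ (d (gen K s)) = d (pullback θ (gen K s)) := by
        rcases s with j | j
        · rw [d_t]; simp [pullback, map_sum]
        · rw [d_dt]; simp [pullback, map_sum]
      rw [mon_cons, d_gen_mul, map_mul, h, map_add, map_smul, map_mul, map_mul, hs, ih]

/-- Evaluation of polynomial forms at the vertex `i` (zero on forms of positive degree). -/
noncomputable def evalVertex [DecidableEq ι] (i : ι) : PolyForm K ι →ₐ[K] K :=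
  lift (Sum.elim (fun j => if j = i then 1 else 0) (fun _ => 0))
    (by intros; exact mul_comm _ _) (by simp) (by simp) (by simp) (by simp)

end PolyForm

open CategoryTheory Simplicial in
/-- Sullivan's polynomial `q`-forms on a simplicial set: compatible families of polynomial
`q`-forms on its simplices. -/
def aplForms (K : Type v) [Field K] (S : SSet.{u}) (q : ℕ) :
    Submodule K (∀ n : SimplexCategory, S.obj (Opposite.op n) → PolyForm K (Fin (n.len + 1))) where
  carrier := {ω | (∀ n σ, ω n σ ∈ PolyForm.deg K (Fin (n.len + 1)) q) ∧
    ∀ (m n : SimplexCategory) (θ : m ⟶ n) (σ : S.obj (Opposite.op n)),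
      ω m (S.map θ.op σ) = PolyForm.pullback (fun i => θ.toOrderHom i) (ω n σ)}
  zero_mem' := ⟨fun _ _ => zero_mem _, fun _ _ _ _ => (map_zero _).symm⟩
  add_mem' {a b} ha hb := ⟨fun n σ => add_mem (ha.1 n σ) (hb.1 n σ), fun m n θ σ => by
    simp only [Pi.add_apply, map_add, ha.2, hb.2]⟩
  smul_mem' c a ha := ⟨fun n σ => Submodule.smul_mem _ _ (ha.1 n σ), fun m n θ σ => by
    simp only [Pi.smul_apply, map_smul, ha.2]⟩

/-- The CDGA `A_PL(S)` of polynomial forms on a simplicial set. -/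
noncomputable def aplSSet (K : Type v) [Field K] (S : SSet.{u}) : CDGA.{v, max u v} K where
  obj q := aplForms K S q
  d {i j} h :=
    { toFun := fun ω => ⟨fun n σ => PolyForm.d (ω.1 n σ),
        fun n σ => h ▸ PolyForm.d_mem (ω.2.1 n σ),
        fun m n θ σ => by
          beta_reduce; rw [ω.2.2 m n θ σ, PolyForm.pullback_d _ (ω.2.1 n σ)]⟩
      map_add' := fun _ _ => by ext; simp
      map_smul' := fun _ _ => by ext; simp }
  one := ⟨fun _ _ => 1, fun _ _ => PolyForm.one_mem, fun _ _ _ _ => (map_one _).symm⟩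
  mul {i j k} h := LinearMap.mk₂ K
    (fun a b => ⟨fun n σ => a.1 n σ * b.1 n σ,
      fun n σ => h ▸ PolyForm.mul_mem (a.2.1 n σ) (b.2.1 n σ),
      fun m n θ σ => by beta_reduce; rw [a.2.2 m n θ σ, b.2.2 m n θ σ, map_mul]⟩)
    (fun _ _ _ => by ext; simp [add_mul]) (fun _ _ _ => by ext; simp)
    (fun _ _ _ => by ext; simp [mul_add]) (fun _ _ _ => by ext; simp)
  d_d _ _ a := by ext n σ; exact PolyForm.d_d (a.2.1 n σ)
  one_mul _ a := by ext n σ; exact _root_.one_mul _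
  mul_one _ a := by ext n σ; exact _root_.mul_one _
  mul_assoc _ _ _ _ a b c := by ext n σ; exact _root_.mul_assoc _ _ _
  mul_comm _ _ a b := by ext n σ; exact PolyForm.mul_comm_of_mem (a.2.1 n σ) (b.2.1 n σ)
  leibniz _ _ _ _ _ _ a b := by ext n σ; exact PolyForm.leibniz (a.2.1 n σ) (b.2.1 n σ)

/-- The CDGA `A_PL(X; K)` of Sullivan's piecewise polynomial forms on a topological space:
polynomial forms on its singular simplicial set. -/
noncomputable def apl (K : Type v) [Field K] (X : Type u) [TopologicalSpace X] :
    CDGA.{v, max u v} K :=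
  aplSSet K (TopCat.toSSet.obj (TopCat.of X))

open CategoryTheory Simplicial in
/-- The CDGA `A_PL(X; K)` of a space with basepoint `x₀`, augmented by evaluation at the constant
singular `0`-simplex `x₀`. -/
noncomputable def aplPointed (K : Type v) [Field K] (X : Type u) [TopologicalSpace X] (x₀ : X) :
    AugCDGA.{v, max u v} K where
  toCDGA := apl K X
  aug :=
    { toFun := fun ω => PolyForm.evalVertex (0 : Fin 1) (ω.1 ⦋0⦌
        ((TopCat.toSSetObjEquiv (TopCat.of X) (Opposite.op ⦋0⦌)).symm (ContinuousMap.const _ x₀)))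
      map_add' := fun _ _ => map_add _ _ _
      map_smul' := fun c _ => map_smul (PolyForm.evalVertex (K := K) (0 : Fin 1)) c _ }
  aug_one := map_one (PolyForm.evalVertex (0 : Fin 1))
  aug_mul _ _ _ := map_mul (PolyForm.evalVertex (0 : Fin 1)) _ _

/-- A space `X` is `K`-formal if `A_PL(X; K)` is connected by a zig-zag of quasi-isomorphisms of
CDGAs to its cohomology algebra `H^*(X; K)`, regarded as a CDGA with zero differential. -/
def IsFormalSpace (K : Type v) [Field K] (X : Type u) [TopologicalSpace X] : Prop :=
  Nonempty (ZigZag CDGA.QuasiIso (apl K X) (apl K X).cohomology)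

/-! ### Differential graded Hopf algebras -/

/-- The data of a `ℤ`-graded vector space with a differential, a product, a unit, a coproduct and
a counit; the laws are in `DGHopfData.IsDGHopf`. -/
structure DGHopfData (K : Type v) [Field K] where
  carrier : Type w
  [addCommGroup : AddCommGroup carrier]
  [module : Module K carrier]
  gr : ℤ → Submodule K carrier
  d : carrier →ₗ[K] carrier
  mul : carrier →ₗ[K] carrier →ₗ[K] carrier
  one : carrier
  comul : carrier →ₗ[K] carrier ⊗[K] carrier
  counit : carrier →ₗ[K] K

namespace DGHopfData

attribute [instance] DGHopfData.addCommGroup DGHopfData.module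

variable {K : Type v} [Field K]

/-- `s` is the map `x ↦ (-1)^|x| x`. -/
def IsGradingSign (H : DGHopfData.{v, w} K) (s : H.carrier →ₗ[K] H.carrier) : Prop :=
  ∀ (i : ℤ), ∀ x ∈ H.gr i, s x = (-1 : K) ^ i • x

/-- `τ` is the Koszul braiding `x ⊗ y ↦ (-1)^(|x| |y|) y ⊗ x`. -/
def IsKoszulBraiding (H : DGHopfData.{v, w} K)
    (τ : H.carrier ⊗[K] H.carrier →ₗ[K] H.carrier ⊗[K] H.carrier) : Prop :=
  ∀ (i j : ℤ), ∀ x ∈ H.gr i, ∀ y ∈ H.gr j, τ (x ⊗ₜ[K] y) = (-1 : K) ^ (i * j) • (y ⊗ₜ[K] x)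

/-- The product on `H ⊗ H` with respect to a braiding `τ`: multiply
`(a ⊗ b) ⊗ (c ⊗ e) ↦ a ⊗ τ (b ⊗ c) ⊗ e ↦ (a * ·) ⊗ (· * e)`. -/
noncomputable def tensorMul (H : DGHopfData.{v, w} K)
    (τ : H.carrier ⊗[K] H.carrier →ₗ[K] H.carrier ⊗[K] H.carrier) :
    (H.carrier ⊗[K] H.carrier) ⊗[K] (H.carrier ⊗[K] H.carrier) →ₗ[K]
      H.carrier ⊗[K] H.carrier :=
  TensorProduct.map (TensorProduct.lift H.mul) (TensorProduct.lift H.mul) ∘ₗ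
    (TensorProduct.assoc K _ _ _).symm.toLinearMap ∘ₗ
      LinearMap.lTensor H.carrier
        ((TensorProduct.assoc K _ _ _).toLinearMap ∘ₗ
          LinearMap.rTensor H.carrier τ ∘ₗ
            (TensorProduct.assoc K _ _ _).symm.toLinearMap) ∘ₗ
        (TensorProduct.assoc K _ _ _).toLinearMap

/-- The laws of a graded-commutative differential graded Hopf algebra: `H` is a graded-commutative
differential graded algebra and a differential graded coalgebra, the coproduct and the counit are
morphisms of differential graded algebras, and there is an antipode. -/
structure IsDGHopf (H : DGHopfData.{v, w} K) : Prop where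
  isInternal : DirectSum.IsInternal H.gr
  -- cochain complex
  d_mem : ∀ (i : ℤ), ∀ x ∈ H.gr i, H.d x ∈ H.gr (i + 1)
  d_d : ∀ x, H.d (H.d x) = 0
  -- graded-commutative differential graded algebra
  one_mem : H.one ∈ H.gr 0
  mul_mem : ∀ (i j : ℤ), ∀ x ∈ H.gr i, ∀ y ∈ H.gr j, H.mul x y ∈ H.gr (i + j)
  one_mul : ∀ x, H.mul H.one x = x
  mul_one : ∀ x, H.mul x H.one = x
  mul_assoc : ∀ x y z, H.mul (H.mul x y) z = H.mul x (H.mul y z)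
  mul_comm : ∀ (i j : ℤ), ∀ x ∈ H.gr i, ∀ y ∈ H.gr j,
    H.mul x y = (-1 : K) ^ (i * j) • H.mul y x
  leibniz : ∀ (i : ℤ), ∀ x ∈ H.gr i, ∀ y,
    H.d (H.mul x y) = H.mul (H.d x) y + (-1 : K) ^ i • H.mul x (H.d y)
  -- differential graded coalgebra
  counit_eq_zero : ∀ (i : ℤ), i ≠ 0 → ∀ x ∈ H.gr i, H.counit x = 0
  comul_mem : ∀ (k : ℤ), ∀ x ∈ H.gr k,
    H.comul x ∈ ⨆ i : ℤ, LinearMap.range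
      (TensorProduct.map (H.gr i).subtype (H.gr (k - i)).subtype)
  coassoc : ∀ x, TensorProduct.assoc K _ _ _ (H.comul.rTensor H.carrier (H.comul x)) =
    H.comul.lTensor H.carrier (H.comul x)
  counit_comul : ∀ x, H.counit.rTensor H.carrier (H.comul x) = 1 ⊗ₜ[K] x
  comul_counit : ∀ x, H.counit.lTensor H.carrier (H.comul x) = x ⊗ₜ[K] 1
  counit_d : ∀ x, H.counit (H.d x) = 0
  comul_d : ∃ s, H.IsGradingSign s ∧
    ∀ x, H.comul (H.d x) = H.d.rTensor H.carrier (H.comul x) + TensorProduct.map s H.d (H.comul x)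
  -- the coproduct and the counit are multiplicative
  comul_one : H.comul H.one = H.one ⊗ₜ[K] H.one
  comul_mul : ∃ τ, H.IsKoszulBraiding τ ∧
    ∀ x y, H.comul (H.mul x y) = H.tensorMul τ (H.comul x ⊗ₜ[K] H.comul y)
  counit_one : H.counit H.one = 1
  counit_mul : ∀ x y, H.counit (H.mul x y) = H.counit x * H.counit y
  -- antipode
  antipode : ∃ S : H.carrier →ₗ[K] H.carrier,
    (∀ (i : ℤ), ∀ x ∈ H.gr i, S x ∈ H.gr i) ∧ (∀ x, S (H.d x) = H.d (S x)) ∧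
    (∀ x, TensorProduct.lift H.mul (S.rTensor H.carrier (H.comul x)) = H.counit x • H.one) ∧
    (∀ x, TensorProduct.lift H.mul (S.lTensor H.carrier (H.comul x)) = H.counit x • H.one)

/-- `φ` is a morphism of differential graded Hopf algebras. -/
structure IsHom (H H' : DGHopfData.{v, w} K) (φ : H.carrier →ₗ[K] H'.carrier) : Prop where
  map_gr : ∀ (i : ℤ), ∀ x ∈ H.gr i, φ x ∈ H'.gr i
  map_d : ∀ x, φ (H.d x) = H'.d (φ x)
  map_mul : ∀ x y, φ (H.mul x y) = H'.mul (φ x) (φ y)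
  map_one : φ H.one = H'.one
  map_comul : ∀ x, TensorProduct.map φ φ (H.comul x) = H'.comul (φ x)
  map_counit : ∀ x, H'.counit (φ x) = H.counit x

/-- The cocycles of degree `k`. -/
def cocycles (H : DGHopfData.{v, w} K) (k : ℤ) : Submodule K H.carrier :=
  H.gr k ⊓ LinearMap.ker H.d

/-- The coboundaries of degree `k`. -/
def coboundaries (H : DGHopfData.{v, w} K) (k : ℤ) : Submodule K H.carrier :=
  (H.gr (k - 1)).map H.d

/-- The cohomology in degree `k`, cocycles modulo coboundaries. -/
abbrev Cohomology (H : DGHopfData.{v, w} K) (k : ℤ) : Type w :=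
  H.cocycles k ⧸ (H.coboundaries k).comap (H.cocycles k).subtype

/-- The map induced on cohomology. -/
def IsHom.cohomologyMap {H H' : DGHopfData.{v, w} K} {φ : H.carrier →ₗ[K] H'.carrier}
    (hφ : IsHom H H' φ) (k : ℤ) : H.Cohomology k →ₗ[K] H'.Cohomology k :=
  Submodule.mapQ _ _
    (φ.restrict (p := H.cocycles k) (q := H'.cocycles k) (by
      rintro x ⟨hx, hd⟩
      refine ⟨hφ.map_gr k x hx, ?_⟩
      change H'.d (φ x) = 0
      rw [← hφ.map_d, show H.d x = 0 from hd, map_zero])) (by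
    rintro ⟨x, hx⟩ ⟨y, hy, hxy⟩
    refine ⟨φ y, hφ.map_gr _ y hy, ?_⟩
    rw [← hφ.map_d, hxy]
    rfl)

/-- `φ` is a quasi-isomorphism of differential graded Hopf algebras. -/
def IsQuasiIso (H H' : DGHopfData.{v, w} K) (φ : H.carrier →ₗ[K] H'.carrier) : Prop :=
  ∃ hφ : IsHom H H' φ, ∀ k, Function.Bijective (hφ.cohomologyMap k)

end DGHopfData

/-! ### The bar complex -/

namespace AugCDGA

variable {K : Type v} [Field K]

/-- Words `[a_1 | ⋯ | a_p]` in homogeneous elements of `A`, each with its degree. -/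
abbrev Word (A : AugCDGA.{v, w} K) : Type w := List (Σ n, A.obj n)

/-- The relations of the normalized bar complex: a word is linear in each of its letters, so that
words of length `p` span `A^{⊗ p}`, and a word with a letter `1`, that is, in the image of a
degeneracy, is zero. -/
inductive BarRel (A : AugCDGA.{v, w} K) : (Word A →₀ K) → Prop
  | add (u v : Word A) (n : ℕ) (x y : A.obj n) : BarRel A
      (Finsupp.single (u ++ ⟨n, x + y⟩ :: v) 1 - Finsupp.single (u ++ ⟨n, x⟩ :: v) 1
        - Finsupp.single (u ++ ⟨n, y⟩ :: v) 1)
  | smul (u v : Word A) (n : ℕ) (c : K) (x : A.obj n) : BarRel A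
      (Finsupp.single (u ++ ⟨n, c • x⟩ :: v) 1 - Finsupp.single (u ++ ⟨n, x⟩ :: v) c)
  | unit (u v : Word A) : BarRel A (Finsupp.single (u ++ ⟨0, A.one⟩ :: v) 1)

/-- The underlying vector space of the normalized bar complex of `A`: the direct sum over `p` of
`A^{⊗ p} = ⨁ A^{n_1} ⊗ ⋯ ⊗ A^{n_p}` modulo the images of the degeneracies, presented by
generators and relations. -/
def BarModule (A : AugCDGA.{v, w} K) : Type (max v w) :=
  (Word A →₀ K) ⧸ Submodule.span K {r | BarRel A r}

namespace BarModule

variable {A B : AugCDGA.{v, w} K}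

noncomputable instance : AddCommGroup (BarModule A) :=
  inferInstanceAs (AddCommGroup ((Word A →₀ K) ⧸ Submodule.span K {r | BarRel A r}))

noncomputable instance : Module K (BarModule A) :=
  inferInstanceAs (Module K ((Word A →₀ K) ⧸ Submodule.span K {r | BarRel A r}))

/-- The quotient map. -/
noncomputable def mk : (Word A →₀ K) →ₗ[K] BarModule A :=
  Submodule.mkQ (Submodule.span K {r | BarRel A r})

/-- The class of the word `[a_1 | ⋯ | a_p]`. -/
noncomputable def word (w : Word A) : BarModule A := mk (Finsupp.single w 1)

theorem mk_rel {r : Word A →₀ K} (h : BarRel A r) : mk r = 0 :=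
  (Submodule.Quotient.mk_eq_zero _).2 (Submodule.subset_span h)

theorem mk_single (w : Word A) (c : K) : mk (Finsupp.single w c) = c • word w := by
  rw [word, ← map_smul, Finsupp.smul_single, smul_eq_mul, mul_one]

theorem word_add (u v : Word A) (n : ℕ) (x y : A.obj n) :
    word (u ++ ⟨n, x + y⟩ :: v) = word (u ++ ⟨n, x⟩ :: v) + word (u ++ ⟨n, y⟩ :: v) := by
  have := mk_rel (BarRel.add u v n x y)
  rw [map_sub, map_sub, sub_sub, sub_eq_zero] at this
  exact this

theorem word_smul (u v : Word A) (n : ℕ) (c : K) (x : A.obj n) :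
    word (u ++ ⟨n, c • x⟩ :: v) = c • word (u ++ ⟨n, x⟩ :: v) := by
  have := mk_rel (BarRel.smul u v n c x)
  rw [map_sub, sub_eq_zero, mk_single (u ++ ⟨n, x⟩ :: v)] at this
  exact this

theorem word_unit (u v : Word A) : word (u ++ ⟨0, A.one⟩ :: v) = 0 :=
  mk_rel (BarRel.unit u v)

/-- A function on words is compatible with the relations of the bar complex. -/
structure Compatible {M : Type*} [AddCommGroup M] [Module K M] (φ : Word A → M) : Prop where
  linear : ∀ (u v : Word A) (n : ℕ), ∃ ℓ : A.obj n →ₗ[K] M, ∀ x, φ (u ++ ⟨n, x⟩ :: v) = ℓ x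
  unit : ∀ u v : Word A, φ (u ++ ⟨0, A.one⟩ :: v) = 0

/-- The linear map with given values on words. -/
noncomputable def lift {M : Type*} [AddCommGroup M] [Module K M] (φ : Word A → M)
    (hφ : Compatible φ) : BarModule A →ₗ[K] M :=
  Submodule.liftQ _ (Finsupp.linearCombination K φ) (by
    refine Submodule.span_le.2 ?_
    rintro _ (⟨u, v, n, x, y⟩ | ⟨u, v, n, c, x⟩ | ⟨u, v⟩)
    · obtain ⟨ℓ, hℓ⟩ := hφ.linear u v n
      simp [hℓ]
    · obtain ⟨ℓ, hℓ⟩ := hφ.linear u v n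
      simp [hℓ]
    · simpa using hφ.unit u v)

@[simp]
theorem lift_word {M : Type*} [AddCommGroup M] [Module K M] (φ : Word A → M)
    (hφ : Compatible φ) (w : Word A) : lift φ hφ (word w) = φ w := by
  change Submodule.liftQ _ (Finsupp.linearCombination K φ) _ (Submodule.Quotient.mk _) = _
  rw [Submodule.liftQ_apply, Finsupp.linearCombination_single, one_smul]

theorem hom_ext {M : Type*} [AddCommGroup M] [Module K M] {f g : BarModule A →ₗ[K] M}
    (h : ∀ w, f (word w) = g (word w)) : f = g := by
  have h' : f ∘ₗ mk = g ∘ₗ mk := by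
    refine Finsupp.lhom_ext fun w c => ?_
    simp only [LinearMap.comp_apply, mk_single, map_smul, h]
  refine LinearMap.ext fun x => ?_
  obtain ⟨y, rfl⟩ := Submodule.Quotient.mk_surjective _ x
  exact LinearMap.congr_fun h' y

theorem compatible_word : Compatible (word : Word A → BarModule A) where
  linear u v n := ⟨
    { toFun := fun x => word (u ++ ⟨n, x⟩ :: v)
      map_add' := word_add u v n
      map_smul' := word_smul u v n }, fun _ => rfl⟩
  unit := word_unit

/-- Putting a letter in front of a word. -/
noncomputable def cons (n : ℕ) : A.obj n →ₗ[K] BarModule A →ₗ[K] BarModule A :=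
  LinearMap.mk₂ K
    (fun a => lift (fun w => word (⟨n, a⟩ :: w))
      ⟨fun u v => compatible_word.linear (⟨n, a⟩ :: u) v,
        fun u v => word_unit (⟨n, a⟩ :: u) v⟩)
    (fun a b x => by
      rw [← LinearMap.add_apply]
      refine LinearMap.congr_fun (hom_ext fun w => ?_) x
      simpa using word_add [] w n a b)
    (fun c a x => by
      rw [← LinearMap.smul_apply]
      refine LinearMap.congr_fun (hom_ext fun w => ?_) x
      simpa using word_smul [] w n c a)
    (fun _ => map_add _) (fun _ _ => map_smul _ _)

@[simp] theorem cons_word (n : ℕ) (a : A.obj n) (w : Word A) :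
    cons n a (word w) = word (⟨n, a⟩ :: w) := by
  simp [cons]

theorem cons_one (x : BarModule A) : cons 0 A.one x = 0 := by
  refine LinearMap.congr_fun (g := (0 : BarModule A →ₗ[K] BarModule A)) (hom_ext fun w => ?_) x
  simpa using word_unit [] w

/-- The vertical differential
`[a_1 | ⋯ | a_p] ↦ ∑_{i=1}^p (-1)^{ε(i-1)} [a_1 | ⋯ | d a_i | ⋯ | a_p]`,
where `ε(i) = ∑_{j ≤ i} (|a_j| + 1)`. -/
noncomputable def vert : Word A → BarModule A
  | [] => 0
  | a :: w => word (⟨a.1 + 1, A.d rfl a.2⟩ :: w) + (-1 : K) ^ (a.1 + 1) • cons a.1 a.2 (vert w)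

theorem compatible_vert : Compatible (vert : Word A → BarModule A) where
  linear u v n := by
    induction u with
    | nil =>
      refine ⟨(cons (n + 1)).flip (word v) ∘ₗ A.d rfl +
        (-1 : K) ^ (n + 1) • (cons n).flip (vert v), fun x => ?_⟩
      simp [vert]
    | cons a u ih =>
      obtain ⟨ℓ, hℓ⟩ := ih
      obtain ⟨ℓ', hℓ'⟩ := compatible_word.linear (⟨a.1 + 1, A.d rfl a.2⟩ :: u) v n
      refine ⟨ℓ' + (-1 : K) ^ (a.1 + 1) • (cons a.1 a.2 ∘ₗ ℓ), fun x => ?_⟩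
      simp only [List.cons_append] at hℓ'
      simp [vert, hℓ, hℓ']
  unit u v := by
    induction u with
    | nil =>
      simp only [List.nil_append, vert, cons_one, smul_zero, add_zero]
      rw [← cons_word, A.d_one, map_zero, LinearMap.zero_apply]
    | cons a u ih =>
      simp only [List.cons_append, vert, ih, map_zero, smul_zero, add_zero]
      exact word_unit (⟨a.1 + 1, A.d rfl a.2⟩ :: u) v

/-- The augmentation of `A` in all degrees. -/
def augHom (A : AugCDGA.{v, w} K) : ∀ n, A.obj n →ₗ[K] K
  | 0 => A.aug
  | _ + 1 => 0

/-- The face `d_0 [a_1 | ⋯ | a_p] = ε(a_1) [a_2 | ⋯ | a_p]`, where `ε` is the augmentation. -/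
noncomputable def face₀ : Word A → BarModule A
  | [] => 0
  | a :: w => augHom A a.1 a.2 • word w

/-- The sum `∑_{i=1}^p (-1)^{ε(i)} d_i [a_1 | ⋯ | a_p]` over the other faces, where
`d_i [a_1 | ⋯ | a_p] = [a_1 | ⋯ | a_i a_{i+1} | ⋯ | a_p]` for `1 ≤ i < p`,
`d_p [a_1 | ⋯ | a_p] = ε(a_p) [a_1 | ⋯ | a_{p-1}]` and `ε(i) = ∑_{j ≤ i} (|a_j| + 1)`. -/
noncomputable def faces : Word A → BarModule A
  | [] => 0
  | [a] => (-1 : K) ^ (a.1 + 1) • augHom A a.1 a.2 • word []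
  | a :: b :: w => (-1 : K) ^ (a.1 + 1) •
      (word (⟨a.1 + b.1, A.mul rfl a.2 b.2⟩ :: w) + cons a.1 a.2 (faces (b :: w)))

/-- The horizontal differential `∑_{i=0}^p (-1)^{ε(i)} d_i`. -/
noncomputable def horiz (w : Word A) : BarModule A := face₀ w + faces w

theorem word_congr {n m : ℕ} (h : n = m) (x : A.obj n) (y : A.obj m) (hxy : HEq x y)
    (w : Word A) : word (⟨n, x⟩ :: w) = word (⟨m, y⟩ :: w) := by
  subst h; rw [eq_of_heq hxy]

theorem one_mul_heq {n m : ℕ} (h : 0 + n = m) (x : A.obj n) : HEq (A.mul h A.one x) x := by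
  obtain rfl : n = m := by omega
  exact heq_of_eq (A.one_mul h x)

theorem mul_one_heq {n m : ℕ} (h : n + 0 = m) (x : A.obj n) : HEq (A.mul h x A.one) x := by
  obtain rfl : n = m := by omega
  exact heq_of_eq (A.mul_one h x)

theorem faces_one (w : Word A) : faces (⟨0, A.one⟩ :: w) = -word w := by
  cases w with
  | nil => simp [faces, augHom, A.aug_one]
  | cons b w =>
    simp only [faces, cons_one, add_zero]
    rw [word_congr (by omega) _ b.2 (one_mul_heq _ _)]
    simp

theorem faces_cons_linear (n : ℕ) (w : Word A) :
    ∃ ℓ : A.obj n →ₗ[K] BarModule A, ∀ x, faces (⟨n, x⟩ :: w) = ℓ x := by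
  cases w with
  | nil => exact ⟨(-1 : K) ^ (n + 1) • (augHom A n).smulRight (word []), fun x => by simp [faces]⟩
  | cons b w =>
    refine ⟨(-1 : K) ^ (n + 1) • ((cons (n + b.1)).flip (word w) ∘ₗ (A.mul rfl).flip b.2 +
      (cons n).flip (faces (b :: w))), fun x => by simp [faces]⟩

theorem faces_linear (u v : Word A) (n : ℕ) :
    ∃ ℓ : A.obj n →ₗ[K] BarModule A, ∀ x, faces (u ++ ⟨n, x⟩ :: v) = ℓ x := by
  induction u with
  | nil => exact faces_cons_linear n v
  | cons a u ih =>
    obtain ⟨ℓ, hℓ⟩ := ih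
    cases u with
    | nil =>
      refine ⟨(-1 : K) ^ (a.1 + 1) • ((cons (a.1 + n)).flip (word v) ∘ₗ A.mul rfl a.2 +
        cons a.1 a.2 ∘ₗ ℓ), fun x => ?_⟩
      simp only [List.nil_append] at hℓ
      simp [faces, hℓ]
    | cons b u =>
      obtain ⟨ℓ', hℓ'⟩ := compatible_word.linear (⟨a.1 + b.1, A.mul rfl a.2 b.2⟩ :: u) v n
      refine ⟨(-1 : K) ^ (a.1 + 1) • (ℓ' + cons a.1 a.2 ∘ₗ ℓ), fun x => ?_⟩
      simp only [List.cons_append] at hℓ hℓ'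
      simp [faces, hℓ, hℓ']

theorem faces_unit (a : Σ n, A.obj n) (u v : Word A) :
    faces (a :: u ++ ⟨0, A.one⟩ :: v) = 0 := by
  induction u generalizing a with
  | nil =>
    simp only [List.cons_append, List.nil_append, faces, faces_one, map_neg, cons_word]
    rw [word_congr (by omega) _ a.2 (mul_one_heq _ _)]
    simp
  | cons b u ih =>
    have h := word_unit (⟨a.1 + b.1, A.mul rfl a.2 b.2⟩ :: u) v
    have ih := ih b
    simp only [List.cons_append] at h ih
    simp [faces, ih, h]

theorem compatible_horiz : Compatible (horiz : Word A → BarModule A) where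
  linear u v n := by
    obtain ⟨ℓ, hℓ⟩ := faces_linear u v n
    cases u with
    | nil =>
      simp only [List.nil_append] at hℓ
      exact ⟨(augHom A n).smulRight (word v) + ℓ, fun x => by simp [horiz, face₀, hℓ]⟩
    | cons a u =>
      obtain ⟨ℓ', hℓ'⟩ := compatible_word.linear u v n
      simp only [List.cons_append] at hℓ
      exact ⟨augHom A a.1 a.2 • ℓ' + ℓ, fun x => by simp [horiz, face₀, hℓ, hℓ']⟩
  unit u v := by
    cases u with
    | nil => simp [horiz, face₀, faces_one, augHom, A.aug_one]
    | cons a u => rw [horiz, faces_unit]; simp [face₀, word_unit]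

/-- Deconcatenation `[a_1 | ⋯ | a_p] ↦ ∑_{i=0}^p [a_1 | ⋯ | a_i] ⊗ [a_{i+1} | ⋯ | a_p]`. -/
noncomputable def deconcat : Word A → BarModule A ⊗[K] BarModule A
  | [] => word [] ⊗ₜ[K] word []
  | a :: w => word [] ⊗ₜ[K] word (a :: w) + (cons a.1 a.2).rTensor (BarModule A) (deconcat w)

theorem compatible_deconcat :
    Compatible (deconcat : Word A → BarModule A ⊗[K] BarModule A) where
  linear u v n := by
    induction u with
    | nil =>
      refine ⟨TensorProduct.mk K _ _ (word []) ∘ₗ (cons n).flip (word v) +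
        (LinearMap.rTensorHom (BarModule A) ∘ₗ cons n).flip (deconcat v), fun x => ?_⟩
      simp [deconcat]
    | cons a u ih =>
      obtain ⟨ℓ, hℓ⟩ := ih
      obtain ⟨ℓ', hℓ'⟩ := compatible_word.linear (a :: u) v n
      refine ⟨TensorProduct.mk K _ _ (word []) ∘ₗ ℓ' +
        (cons a.1 a.2).rTensor (BarModule A) ∘ₗ ℓ, fun x => ?_⟩
      simp only [List.cons_append] at hℓ'
      simp [deconcat, hℓ, hℓ']
  unit u v := by
    have h1 : cons 0 A.one = (0 : BarModule A →ₗ[K] BarModule A) := LinearMap.ext cons_one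
    induction u with
    | nil =>
      have := word_unit ([] : Word A) v
      simp only [List.nil_append] at this
      simp [deconcat, h1, this]
    | cons a u ih =>
      have := word_unit (a :: u) v
      simp only [List.cons_append] at this
      simp [deconcat, ih, this]

/-- The sum `∑_j (|a_j| + 1)` over the letters of a word. -/
def parity (w : Word A) : ℕ := (w.map fun a => a.1 + 1).sum

/-- The shuffle product of words: the sum over all shuffles of the two words, each with its Koszul
sign for letters `a` of degree `|a| + 1`.  It is defined by recursion on the first letter. -/
noncomputable def shuffle : Word A → Word A → BarModule A
  | [], v => word v
  | a :: u, [] => word (a :: u)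
  | a :: u, b :: v => cons a.1 a.2 (shuffle u (b :: v)) +
      (-1 : K) ^ (parity (a :: u) * (b.1 + 1)) • cons b.1 b.2 (shuffle (a :: u) v)
termination_by u v => u.length + v.length

theorem parity_eq (u v : Word A) (n : ℕ) (x : A.obj n) :
    parity (u ++ ⟨n, x⟩ :: v) = parity u + (n + 1 + parity v) := by
  simp [parity]

theorem shuffle_linear_left (u v w : Word A) (n : ℕ) :
    ∃ ℓ : A.obj n →ₗ[K] BarModule A, ∀ x, shuffle (u ++ ⟨n, x⟩ :: v) w = ℓ x := by
  induction w generalizing u with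
  | nil =>
    obtain ⟨ℓ, hℓ⟩ := compatible_word.linear u v n
    refine ⟨ℓ, fun x => ?_⟩
    rw [← hℓ]
    cases u <;> simp [shuffle]
  | cons b w ih =>
    induction u with
    | nil =>
      obtain ⟨ℓ, hℓ⟩ := ih []
      refine ⟨(cons n).flip (shuffle v (b :: w)) +
        (-1 : K) ^ ((n + 1 + parity v) * (b.1 + 1)) • (cons b.1 b.2 ∘ₗ ℓ), fun x => ?_⟩
      simp only [List.nil_append] at hℓ
      simp [shuffle, hℓ, parity]
    | cons a u ih' =>
      obtain ⟨ℓ, hℓ⟩ := ih (a :: u)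
      obtain ⟨ℓ', hℓ'⟩ := ih'
      refine ⟨cons a.1 a.2 ∘ₗ ℓ' +
        (-1 : K) ^ ((parity (a :: u) + (n + 1 + parity v)) * (b.1 + 1)) • (cons b.1 b.2 ∘ₗ ℓ),
        fun x => ?_⟩
      have h := parity_eq (a :: u) v n x
      simp only [List.cons_append] at hℓ h
      simp [shuffle, hℓ, hℓ', h]

theorem shuffle_linear_right (w u v : Word A) (n : ℕ) :
    ∃ ℓ : A.obj n →ₗ[K] BarModule A, ∀ x, shuffle w (u ++ ⟨n, x⟩ :: v) = ℓ x := by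
  induction w generalizing u with
  | nil =>
    obtain ⟨ℓ, hℓ⟩ := compatible_word.linear u v n
    exact ⟨ℓ, fun x => by simp [shuffle, hℓ]⟩
  | cons a w ih =>
    induction u with
    | nil =>
      obtain ⟨ℓ, hℓ⟩ := ih []
      refine ⟨cons a.1 a.2 ∘ₗ ℓ +
        (-1 : K) ^ (parity (a :: w) * (n + 1)) • (cons n).flip (shuffle (a :: w) v),
        fun x => ?_⟩
      simp only [List.nil_append] at hℓ
      simp [shuffle, hℓ]
    | cons b u ih' =>
      obtain ⟨ℓ, hℓ⟩ := ih (b :: u)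
      obtain ⟨ℓ', hℓ'⟩ := ih'
      refine ⟨cons a.1 a.2 ∘ₗ ℓ +
        (-1 : K) ^ (parity (a :: w) * (b.1 + 1)) • (cons b.1 b.2 ∘ₗ ℓ'), fun x => ?_⟩
      simp only [List.cons_append] at hℓ
      simp [shuffle, hℓ, hℓ']

theorem shuffle_unit_left (u v w : Word A) : shuffle (u ++ ⟨0, A.one⟩ :: v) w = 0 := by
  induction w generalizing u with
  | nil =>
    rw [← word_unit u v]
    cases u <;> simp [shuffle]
  | cons b w ih =>
    induction u with
    | nil =>
      have := ih []
      simp only [List.nil_append] at this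
      simp [shuffle, this, cons_one]
    | cons a u ih' =>
      have := ih (a :: u)
      simp only [List.cons_append] at this
      simp [shuffle, this, ih']

theorem shuffle_unit_right (w u v : Word A) : shuffle w (u ++ ⟨0, A.one⟩ :: v) = 0 := by
  induction w generalizing u with
  | nil => simp [shuffle, word_unit]
  | cons a w ih =>
    induction u with
    | nil =>
      have := ih []
      simp only [List.nil_append] at this
      simp [shuffle, this, cons_one]
    | cons b u ih' =>
      have := ih (b :: u)
      simp only [List.cons_append] at this
      simp [shuffle, this, ih']

/-- The shuffle product with a word. -/
noncomputable def shuffleRight (u : Word A) : BarModule A →ₗ[K] BarModule A :=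
  lift (shuffle u) ⟨shuffle_linear_right u, shuffle_unit_right u⟩

theorem compatible_shuffleRight :
    Compatible (shuffleRight : Word A → BarModule A →ₗ[K] BarModule A) where
  linear u v n := ⟨
    { toFun := fun x => shuffleRight (u ++ ⟨n, x⟩ :: v)
      map_add' := fun x y => hom_ext fun w => by
        obtain ⟨ℓ, hℓ⟩ := shuffle_linear_left u v w n
        simp [shuffleRight, hℓ]
      map_smul' := fun c x => hom_ext fun w => by
        obtain ⟨ℓ, hℓ⟩ := shuffle_linear_left u v w n
        simp [shuffleRight, hℓ] }, fun _ => rfl⟩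
  unit u v := hom_ext fun w => by simp [shuffleRight, shuffle_unit_left]

/-- The projection to words of length zero. -/
def counitWord : Word A → K
  | [] => 1
  | _ :: _ => 0

theorem compatible_counitWord : Compatible (counitWord : Word A → K) where
  linear u v n := ⟨0, fun x => by cases u <;> rfl⟩
  unit u v := by cases u <;> rfl

/-- The total degree `∑_j |a_j| - p` of a word `[a_1 | ⋯ | a_p]`. -/
def totalDegree (w : Word A) : ℤ := (w.map fun a => (a.1 : ℤ)).sum - w.length

end BarModule

open BarModule in
/-- The normalized bar complex `B(A)` of an augmented CDGA: the total complex of the double complex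
`B^{-p,q}(A)`, with the shuffle product and the deconcatenation coproduct. -/
noncomputable def bar (A : AugCDGA.{v, w} K) : DGHopfData.{v, max v w} K where
  carrier := BarModule A
  gr k := Submodule.span K {x | ∃ w : Word A, totalDegree w = k ∧ word w = x}
  d := lift vert compatible_vert + lift horiz compatible_horiz
  mul := lift shuffleRight compatible_shuffleRight
  one := word []
  comul := lift deconcat compatible_deconcat
  counit := lift counitWord compatible_counitWord

open BarModule in
/-- The map `B(f) : B(A) → B(A')`, `[a_1 | ⋯ | a_p] ↦ [f a_1 | ⋯ | f a_p]`. -/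
noncomputable def Hom.bar {A A' : AugCDGA.{v, w} K} (f : Hom A A') :
    A.bar.carrier →ₗ[K] A'.bar.carrier :=
  lift (fun w => (word (w.map fun a => ⟨a.1, f.toFun a.1 a.2⟩) : BarModule A'))
    { linear := fun u v n => by
        let g : (Σ n, A.obj n) → Σ n, A'.obj n := fun a => ⟨a.1, f.toFun a.1 a.2⟩
        obtain ⟨ℓ, hℓ⟩ := compatible_word.linear (u.map g) (v.map g) n
        refine ⟨ℓ ∘ₗ f.toFun n, fun x => ?_⟩
        change _ = ℓ (f.toFun n x)
        simpa [g] using hℓ (f.toFun n x)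
      unit := fun u v => by
        simp only [List.map_append, List.map_cons]
        rw [f.map_one]
        exact word_unit _ _ }

/-- The bar construction carries a zig-zag of augmented CDGAs to a zig-zag of quasi-isomorphisms of
graded-commutative differential graded Hopf algebras: the bar complex of each object in the zig-zag
is such a Hopf algebra, and each arrow `f` induces a quasi-isomorphism `B(f)` of Hopf algebras. -/
def BarIsHopfZigZag {A A' : AugCDGA.{v, w} K} : ZigZag AugCDGA.QuasiIso A A' → Prop
  | .nil A => A.bar.IsDGHopf
  | @ZigZag.fwd _ _ A A₁ _ f Z =>
      A.bar.IsDGHopf ∧ DGHopfData.IsQuasiIso A.bar A₁.bar f.1.bar ∧ BarIsHopfZigZag Z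
  | @ZigZag.bwd _ _ A A₁ _ f Z =>
      A.bar.IsDGHopf ∧ DGHopfData.IsQuasiIso A₁.bar A.bar f.1.bar ∧ BarIsHopfZigZag Z

end AugCDGA

/-! The two assertions are independent. The one about bar constructions holds for every zig-zag of
augmented CDGAs over any field; characteristic zero is needed only to produce an augmented zig-zag.

Bar construction. The bar complex is generated from the empty word by prefixing letters of the
augmentation ideal. For such a letter `a` the outer faces vanish and D[a|x] = [da|x] ± ([a|Dx] +
a·x), where a·x multiplies the first letter of x by a (`diff_cons`). The compatibility of D with the
product and the coproduct is then proved by induction on first letters; that D is a derivation for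
the shuffle product uses the graded commutativity of the algebra (`diff_shuffleMul`). A
quasi-isomorphism has a linear homotopy inverse over a field, and this inverse preserves the unit
because there are no coboundaries in degree 0. Applied letter by letter, it makes the cone of B(f)
acyclic for the vertical differential. The horizontal differential shortens words, so an induction
on word length gives acyclicity for the total differential (`exists_diff_eq`).

Augmented zig-zag. The algebras inside a zig-zag that witnesses formality carry no augmentations.
What can be transported is a point: a closed idempotent e of degree 0 that cuts a factor K out of
H^0. Since H^0 consists of the closed elements of degree 0, points move along quasi-isomorphisms in
both directions. A CDGA C with a point e contains a quasi-isomorphic subalgebra in which e x ∈ K e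
for all x of degree 0 (`IsPoint.exists_reduction`); there e x = ε(x) e defines an augmentation ε.
Two such reductions of C at e are joined through a reduction of their homotopy pullback, built from
the path object C ⊗ K[t, dt]; the Poincaré lemma for it requires characteristic zero. By induction
along the zig-zag, the reductions at its two ends are linked (`exists_point_of_zigZag`). The point
reached in H(A) need not be the class of e, but the two become equal in H(H(A)) under suitable
isomorphisms, which suffices (`AugCDGA.linked_cohomology`).

For A_PL(X; K), closed functions are constant on every simplex, so the simplices on which all of
them take their value at the basepoint have a compatible indicator function. This is a point of
augmentation 1 (`exists_isPoint_aplPointed`). -/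

namespace AugCDGA

variable {K : Type v} [Field K]

/-! ### Recursion on the first letter, the differential and the sign operator. -/

namespace BarModule

variable {A B : AugCDGA.{v, w} K} {M : Type*} [AddCommGroup M] [Module K M]

/-- The bar complex is generated from the empty word by putting letters of the augmentation ideal
in front. -/
theorem mem_of_cons_mem (S : Submodule K (BarModule A)) (h₁ : word [] ∈ S)
    (hc : ∀ n (a : A.obj n), augHom A n a = 0 → ∀ x ∈ S, cons n a x ∈ S) (x : BarModule A) :
    x ∈ S := by
  have key : ∀ n (a : A.obj n), ∀ x ∈ S, cons n a x ∈ S := by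
    intro n a x hx
    cases n with
    | zero =>
      -- Subtracting the scalar part of a letter changes nothing, since words with a letter 1
      -- vanish.
      have h := hc 0 (a - A.aug a • A.one) (by simp [augHom, A.aug_one]) x hx
      simpa [cons_one] using h
    | succ n => exact hc _ a rfl x hx
  have hw : ∀ w : Word A, word w ∈ S := by
    intro w
    induction w with
    | nil => exact h₁
    | cons a w ih => simpa using key a.1 a.2 _ ih
  have : S.mkQ = 0 := hom_ext fun w => by simpa using hw w
  simpa using LinearMap.congr_fun this x

/-- The induction principle behind most identities below. Restricting to letters of the augmentation
ideal removes the outer faces from the computations. -/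
theorem hom_ext_cons {f g : BarModule A →ₗ[K] M} (h₁ : f (word []) = g (word []))
    (hc : ∀ n (a : A.obj n), augHom A n a = 0 → ∀ x, f x = g x →
      f (cons n a x) = g (cons n a x)) : f = g :=
  LinearMap.ext fun x => mem_of_cons_mem (LinearMap.eqLocus f g) h₁ hc x

theorem induction_word {p : BarModule A → Prop} (hw : ∀ w, p (word w)) (h₀ : p 0)
    (ha : ∀ x y, p x → p y → p (x + y)) (hs : ∀ (c : K) x, p x → p (c • x)) (x : BarModule A) :
    p x := by
  let S : Submodule K (BarModule A) :=
    { carrier := {x | p x}, add_mem' := ha _ _, zero_mem' := h₀, smul_mem' := hs }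
  have : S.mkQ = 0 := hom_ext fun w => by
    rw [Submodule.mkQ_apply, LinearMap.zero_apply, Submodule.Quotient.mk_eq_zero]
    exact hw w
  have := LinearMap.congr_fun this x
  rwa [Submodule.mkQ_apply, LinearMap.zero_apply, Submodule.Quotient.mk_eq_zero] at this

theorem cons_congr {n m : ℕ} (h : n = m) (x : A.obj n) (y : A.obj m) (hxy : HEq x y) :
    cons n x = cons m y := by
  subst h; rw [eq_of_heq hxy]

theorem mul_heq {i j k l : ℕ} (h : i + j = k) (h' : i + j = l) (a : A.obj i) (b : A.obj j) :
    HEq (A.mul h a b) (A.mul h' a b) := by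
  subst h; subst h'; rfl

theorem cons_mul {i j k : ℕ} (h : i + j = k) (a : A.obj i) (b : A.obj j) :
    cons (i + j) (A.mul rfl a b) = cons k (A.mul h a b) :=
  cons_congr h _ _ (mul_heq _ _ _ _)

theorem augHom_mul {i j k : ℕ} (h : i + j = k) (a : A.obj i) (b : A.obj j) :
    augHom A k (A.mul h a b) = augHom A i a * augHom A j b := by
  subst h
  cases i with
  | zero =>
    cases j with
    | zero => exact A.aug_mul _ a b
    | succ j =>
      change augHom A (0 + j + 1) _ = _ * (0 : A.obj (j + 1) →ₗ[K] K) b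
      simp [augHom]
  | succ i =>
    -- The degree i + 1 + j does not reduce to a successor, so its positivity enters as an equation.
    have : ∀ m (hm : i + 1 + j = m + 1) (x : A.obj (i + 1 + j)), augHom A _ x = 0 := by
      intro m hm x
      revert x; rw [hm]; intro x; rfl
    rw [this (i + j) (by omega)]
    change 0 = (0 : A.obj (i + 1) →ₗ[K] K) a * _
    simp

theorem augHom_d {i j : ℕ} (h : i + 1 = j) (a : A.obj i) : augHom A j (A.d h a) = 0 := by
  subst h; rfl

/-- The vertical differential. -/
noncomputable def vertDiff : BarModule A →ₗ[K] BarModule A := lift vert compatible_vert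

/-- The horizontal differential. -/
noncomputable def horizDiff : BarModule A →ₗ[K] BarModule A := lift horiz compatible_horiz

/-- The differential of the bar complex. -/
noncomputable def diff : BarModule A →ₗ[K] BarModule A := vertDiff + horizDiff

/-- The shuffle product. -/
noncomputable def shuffleMul : BarModule A →ₗ[K] BarModule A →ₗ[K] BarModule A :=
  lift shuffleRight compatible_shuffleRight

/-- The deconcatenation coproduct. -/
noncomputable def deconcatMap : BarModule A →ₗ[K] BarModule A ⊗[K] BarModule A :=
  lift deconcat compatible_deconcat

/-- The counit. -/
noncomputable def counitMap : BarModule A →ₗ[K] K := lift counitWord compatible_counitWord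

/-- Multiplication of the first letter of `[b_1 | ⋯ | b_p]` by an element `a` of the augmentation
ideal; for the sake of normalization the letter `b_1` is first projected to the augmentation
ideal. -/
noncomputable def mulHead (n : ℕ) (a : A.obj n) : BarModule A →ₗ[K] BarModule A :=
  lift (fun w => match w with
    | [] => 0
    | b :: w => word (⟨n + b.1, A.mul rfl a b.2⟩ :: w) - augHom A b.1 b.2 • word (⟨n, a⟩ :: w))
    { linear := fun u v m => by
        cases u with
        | nil =>
          refine ⟨(cons (n + m)).flip (word v) ∘ₗ A.mul rfl a -
            (augHom A m).smulRight (word (⟨n, a⟩ :: v)), fun x => ?_⟩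
          simp
        | cons b u =>
          obtain ⟨ℓ, hℓ⟩ := compatible_word.linear (⟨n + b.1, A.mul rfl a b.2⟩ :: u) v m
          obtain ⟨ℓ', hℓ'⟩ := compatible_word.linear (⟨n, a⟩ :: u) v m
          refine ⟨ℓ - augHom A b.1 b.2 • ℓ', fun x => ?_⟩
          simp only [List.cons_append] at hℓ hℓ'
          simp [hℓ, hℓ']
      unit := fun u v => by
        cases u with
        | nil =>
          simp only [List.nil_append]
          -- For the letter 1 the two terms cancel, as a · 1 = a and ε(1) = 1; this is the purpose
          -- of the correction term.
          rw [word_congr (by omega) _ a (mul_one_heq _ _)]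
          simp [augHom, A.aug_one]
        | cons b u =>
          have h := word_unit (⟨n + b.1, A.mul rfl a b.2⟩ :: u) v
          have h' := word_unit (⟨n, a⟩ :: u) v
          simp only [List.cons_append] at h h'
          simp [h, h'] }

@[simp] theorem mulHead_nil (n : ℕ) (a : A.obj n) : mulHead n a (word []) = 0 := by
  simp [mulHead]

theorem mulHead_cons {n m k : ℕ} (h : n + m = k) (a : A.obj n) (b : A.obj m)
    (hb : augHom A m b = 0) (x : BarModule A) :
    mulHead n a (cons m b x) = cons k (A.mul h a b) x := by
  rw [← cons_mul h]
  refine LinearMap.congr_fun (f := mulHead n a ∘ₗ cons m b) (hom_ext fun w => ?_) x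
  simp [mulHead, hb]

@[simp] theorem diff_nil : diff (word ([] : Word A)) = 0 := by
  simp [diff, vertDiff, horizDiff, vert, horiz, face₀, faces]

@[simp] theorem vertDiff_nil : vertDiff (word ([] : Word A)) = 0 := by simp [vertDiff, vert]

theorem vertDiff_cons {n m : ℕ} (h : n + 1 = m) (a : A.obj n) (x : BarModule A) :
    vertDiff (cons n a x) = cons m (A.d h a) x + (-1 : K) ^ (n + 1) • cons n a (vertDiff x) := by
  subst h
  refine LinearMap.congr_fun (f := vertDiff ∘ₗ cons n a)
    (g := cons _ (A.d rfl a) + (-1 : K) ^ (n + 1) • cons n a ∘ₗ vertDiff) (hom_ext fun w => ?_) x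
  simp [vertDiff, vert]

/-- If x starts with b, the face d_0 of x contributes ε(b)[a|…] on the right, and the correction
term of `mulHead` cancels exactly this. -/
theorem horizDiff_cons {n : ℕ} (a : A.obj n) (ha : augHom A n a = 0) (x : BarModule A) :
    horizDiff (cons n a x) = (-1 : K) ^ (n + 1) • (cons n a (horizDiff x) + mulHead n a x) := by
  refine LinearMap.congr_fun (f := horizDiff ∘ₗ cons n a)
    (g := (-1 : K) ^ (n + 1) • (cons n a ∘ₗ horizDiff + mulHead n a)) (hom_ext fun w => ?_) x
  cases w with
  | nil => simp [horizDiff, horiz, face₀, faces, ha]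
  | cons b w =>
    simp only [LinearMap.comp_apply, cons_word, horizDiff, lift_word, horiz, face₀, faces, ha,
      LinearMap.smul_apply, LinearMap.add_apply, mulHead, map_add, map_smul]
    module

/-- Together with `diff_nil` this recursion determines the differential; later computations use it
instead of the sum over faces. -/
theorem diff_cons {n m : ℕ} (h : n + 1 = m) (a : A.obj n) (ha : augHom A n a = 0)
    (x : BarModule A) :
    diff (cons n a x) = cons m (A.d h a) x +
      (-1 : K) ^ (n + 1) • (cons n a (diff x) + mulHead n a x) := by
  simp only [diff, LinearMap.add_apply, vertDiff_cons h, horizDiff_cons a ha, map_add]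
  module

theorem cons_d_mul {i j k l i' j' : ℕ} (h : i + j = k) (hk : k + 1 = l) (hi : i + 1 = i')
    (hj : j + 1 = j') (h₁ : i' + j = l) (h₂ : i + j' = l) (a : A.obj i) (b : A.obj j)
    (x : BarModule A) :
    cons l (A.d hk (A.mul h a b)) x = cons l (A.mul h₁ (A.d hi a) b) x +
      (-1 : K) ^ i • cons l (A.mul h₂ a (A.d hj b)) x := by
  rw [A.leibniz h hk hi hj h₁ h₂]; simp

theorem mulHead_mulHead {n m k : ℕ} (h : n + m = k) (a : A.obj n) (b : A.obj m) (x : BarModule A) :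
    mulHead n a (mulHead m b x) = mulHead k (A.mul h a b) x := by
  refine LinearMap.congr_fun (f := mulHead n a ∘ₗ mulHead m b) (hom_ext_cons (by simp) ?_) x
  intro l c hc x _
  simp only [LinearMap.comp_apply]
  rw [mulHead_cons rfl b c hc, mulHead_cons (k := k + l) (by omega) a _ (by simp [augHom_mul, hc]),
    mulHead_cons rfl _ c hc, A.mul_assoc h rfl rfl (by omega)]

/-- The action a·x satisfies a Leibniz rule: it combines the Leibniz rule for products in A with
associativity, which handles the face merging the first two letters of x. -/
theorem diff_mulHead {n m : ℕ} (h : n + 1 = m) (a : A.obj n) (ha : augHom A n a = 0)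
    (x : BarModule A) :
    diff (mulHead n a x) = mulHead m (A.d h a) x + (-1 : K) ^ n • mulHead n a (diff x) := by
  refine LinearMap.congr_fun (f := diff ∘ₗ mulHead n a)
    (g := mulHead m (A.d h a) + (-1 : K) ^ n • mulHead n a ∘ₗ diff)
    (hom_ext_cons (by simp) ?_) x
  intro l b hb x _
  simp only [LinearMap.comp_apply, LinearMap.add_apply, LinearMap.smul_apply]
  rw [mulHead_cons rfl a b hb, diff_cons rfl _ (by simp [augHom_mul, ha]), diff_cons rfl b hb,
    map_add, map_smul, map_add, mulHead_cons rfl a b hb, mulHead_mulHead rfl a b,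
    mulHead_cons (k := n + l + 1) (by omega) _ b hb,
    mulHead_cons (k := n + l + 1) (by omega) a _ (augHom_d _ _),
    cons_d_mul rfl rfl h rfl (by omega) (by omega)]
  simp only [smul_add, smul_smul, ← pow_add, add_assoc]

/-- In D²[a|x] the term a·Dx arises from D[a|Dx] and from D(a·x) with opposite signs; likewise
[da|Dx] and da·x each occur twice and cancel. -/
theorem diff_diff (x : BarModule A) : diff (diff x) = 0 := by
  refine LinearMap.congr_fun (f := diff ∘ₗ diff) (g := 0) (hom_ext_cons (by simp) ?_) x
  intro n a ha x hx
  simp only [LinearMap.comp_apply, LinearMap.zero_apply] at hx ⊢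
  simp only [diff_cons rfl a ha, map_add, map_smul, diff_cons rfl _ (augHom_d (rfl : n + 1 = _) a),
    A.d_d, diff_mulHead rfl a ha, hx, LinearMap.zero_apply, map_zero]
  rcases n.even_or_odd with hn | hn <;> simp [pow_succ, hn.neg_one_pow] <;> abel

/-- The sign `[a_1 | ⋯ | a_p] ↦ (-1)^(∑ (|a_j| + 1)) [a_1 | ⋯ | a_p]`. -/
noncomputable def sgn : Module.End K (BarModule A) :=
  lift (fun w => (-1 : K) ^ parity w • word w)
    { linear := fun u v n => by
        obtain ⟨ℓ, hℓ⟩ := compatible_word.linear u v n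
        exact ⟨(-1 : K) ^ (parity u + (n + 1 + parity v)) • ℓ, fun x => by
          simp [hℓ, parity_eq]⟩
      unit := fun u v => by simp [word_unit] }

theorem sgn_word (w : Word A) : sgn (word w) = (-1 : K) ^ parity w • word w := by simp [sgn]

@[simp] theorem sgn_nil : sgn (word ([] : Word A)) = word [] := by simp [sgn_word, parity]

theorem sgn_cons (n : ℕ) (a : A.obj n) (x : BarModule A) :
    sgn (cons n a x) = (-1 : K) ^ (n + 1) • cons n a (sgn x) := by
  refine LinearMap.congr_fun (f := sgn ∘ₗ cons n a)
    (g := (-1 : K) ^ (n + 1) • cons n a ∘ₗ sgn) (hom_ext fun w => ?_) x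
  simp [sgn_word, parity, pow_add, smul_smul]

theorem sgn_sgn (x : BarModule A) : sgn (sgn x) = x := by
  refine LinearMap.congr_fun (f := sgn ∘ₗ sgn) (g := LinearMap.id) (hom_ext fun w => ?_) x
  simp [sgn_word, smul_smul, ← mul_pow]

theorem sgn_mulHead (n : ℕ) (a : A.obj n) (x : BarModule A) :
    sgn (mulHead n a x) = (-1 : K) ^ n • mulHead n a (sgn x) := by
  refine LinearMap.congr_fun (f := sgn ∘ₗ mulHead n a)
    (g := (-1 : K) ^ n • mulHead n a ∘ₗ sgn) (hom_ext_cons (by simp) ?_) x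
  intro m b hb x _
  simp [mulHead_cons rfl a b hb, sgn_cons, smul_smul, ← pow_add, add_assoc]

theorem sgn_diff (x : BarModule A) : sgn (diff x) = -diff (sgn x) := by
  refine LinearMap.congr_fun (f := sgn ∘ₗ diff) (g := - (diff ∘ₗ sgn)) (hom_ext_cons (by simp) ?_) x
  intro n a ha x hx
  simp only [LinearMap.comp_apply, LinearMap.neg_apply] at hx ⊢
  simp only [diff_cons rfl a ha, map_add, map_smul, sgn_cons, hx, sgn_mulHead, map_neg]
  rcases n.even_or_odd with hn | hn <;> simp [pow_succ, hn.neg_one_pow] <;> abel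

theorem sgn_pow_even {n : ℕ} (h : Even n) : (sgn : Module.End K (BarModule A)) ^ n = 1 := by
  obtain ⟨m, rfl⟩ := h
  have : (sgn : Module.End K (BarModule A)) * sgn = 1 := LinearMap.ext sgn_sgn
  rw [← two_mul, pow_mul, pow_two, this, one_pow]

theorem sgn_pow_odd {n : ℕ} (h : Odd n) : (sgn : Module.End K (BarModule A)) ^ n = sgn := by
  obtain ⟨m, rfl⟩ := h
  rw [pow_succ, sgn_pow_even (even_two_mul m), one_mul]

/-- The operator `sgn ^ n` is the Koszul sign for moving something of degree n past its argument. It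
is linear, so formulas with signs can be stated for inhomogeneous elements. -/
theorem sgn_pow_word (n : ℕ) (w : Word A) :
    (sgn ^ n) (word w) = (-1 : K) ^ (n * parity w) • word w := by
  rcases n.even_or_odd with hn | hn
  · simp [sgn_pow_even hn, (hn.mul_right _).neg_one_pow]
  · rw [sgn_pow_odd hn, sgn_word, pow_mul, hn.neg_one_pow]

@[simp] theorem shuffleMul_nil_left (x : BarModule A) : shuffleMul (word []) x = x := by
  refine LinearMap.congr_fun (g := LinearMap.id) (hom_ext fun w => ?_) x
  simp [shuffleMul, shuffleRight, shuffle]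

@[simp] theorem shuffleMul_nil_right (x : BarModule A) : shuffleMul x (word []) = x := by
  refine LinearMap.congr_fun (f := shuffleMul.flip (word [])) (g := LinearMap.id)
    (hom_ext fun w => ?_) x
  cases w <;> simp [shuffleMul, shuffleRight, shuffle]

/-- The recursion for the shuffle product. -/
theorem shuffleMul_cons_cons (n m : ℕ) (a : A.obj n) (b : A.obj m) (x y : BarModule A) :
    shuffleMul (cons n a x) (cons m b y) = cons n a (shuffleMul x (cons m b y)) +
      cons m b (shuffleMul ((sgn ^ (m + 1)) (cons n a x)) y) := by
  refine LinearMap.congr_fun₂ (f := (shuffleMul.compr₂ LinearMap.id).compl₁₂ (cons n a) (cons m b))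
    (g := (shuffleMul.compr₂ (cons n a)).compl₂ (cons m b) +
      (shuffleMul.compr₂ (cons m b)) ∘ₗ (sgn ^ (m + 1) : Module.End K (BarModule A)) ∘ₗ cons n a)
      (hom_ext fun u => hom_ext fun v => ?_) x y
  simp [sgn_pow_word, shuffleMul, shuffleRight, shuffle, mul_comm]

end BarModule
end AugCDGA

/-! ### The shuffle product: associativity, commutativity and the Leibniz rule. -/

namespace AugCDGA

variable {K : Type v} [Field K]

namespace BarModule

variable {A B : AugCDGA.{v, w} K} {M : Type*} [AddCommGroup M] [Module K M]

/-- The induction follows the shuffle recursion: removing the first letter of the left factor keeps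
the right factor fixed, whereas removing that of the right factor changes the left one by a sign, so
the second inductive hypothesis is needed for all x. -/
theorem hom_ext₂_cons {f g : BarModule A →ₗ[K] BarModule A →ₗ[K] M}
    (h₁ : ∀ y, f (word []) y = g (word []) y) (h₂ : ∀ x, f x (word []) = g x (word []))
    (hc : ∀ n (a : A.obj n) m (b : A.obj m), augHom A n a = 0 → augHom A m b = 0 → ∀ x y,
      f x (cons m b y) = g x (cons m b y) → (∀ x, f x y = g x y) →
        f (cons n a x) (cons m b y) = g (cons n a x) (cons m b y)) (x y : BarModule A) :
    f x y = g x y := by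
  refine LinearMap.congr_fun (f := f.flip y) (g := g.flip y) ?_ x
  refine LinearMap.congr_fun (f := f.flip) (g := g.flip)
    (hom_ext_cons (LinearMap.ext h₂) ?_) y
  intro m b hb y hy
  refine hom_ext_cons (h₁ _) fun n a ha x hx => ?_
  exact hc n a m b ha hb x y hx (LinearMap.congr_fun hy)

theorem sgn_shuffleMul (x y : BarModule A) :
    sgn (shuffleMul x y) = shuffleMul (sgn x) (sgn y) := by
  refine hom_ext₂_cons (f := shuffleMul.compr₂ sgn) (g := shuffleMul.compl₁₂ sgn sgn)
    (by simp) (by simp) ?_ x y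
  intro n a m b _ _ x y h₁ h₂
  simp only [LinearMap.compr₂_apply, LinearMap.compl₁₂_apply] at h₁ h₂ ⊢
  rcases n.even_or_odd with hn | hn <;> rcases m.even_or_odd with hm | hm <;>
    simp [shuffleMul_cons_cons, sgn_cons, h₁, h₂, pow_succ, hn.neg_one_pow, hm.neg_one_pow,
      sgn_pow_even, sgn_pow_odd, hm, sgn_sgn] <;> abel

theorem sgn_pow_shuffleMul (n : ℕ) (x y : BarModule A) :
    (sgn ^ n) (shuffleMul x y) = shuffleMul ((sgn ^ n) x) ((sgn ^ n) y) := by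
  rcases n.even_or_odd with hn | hn
  · simp [sgn_pow_even hn]
  · simp [sgn_pow_odd hn, sgn_shuffleMul]

theorem sgn_pow_cons (n m : ℕ) (a : A.obj n) (x : BarModule A) :
    (sgn ^ m) (cons n a x) = (-1 : K) ^ ((n + 1) * m) • cons n a ((sgn ^ m) x) := by
  rcases m.even_or_odd with hn | hn
  · simp [sgn_pow_even hn, (hn.mul_left _).neg_one_pow]
  · simp only [sgn_pow_odd hn, sgn_cons]
    rw [mul_comm, pow_mul, hn.neg_one_pow]

@[elab_as_elim]
theorem induction_cons {p : BarModule A → Prop} (nil : p (word [])) (zero : p 0)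
    (add : ∀ x y, p x → p y → p (x + y)) (smul : ∀ (c : K) x, p x → p (c • x))
    (cons : ∀ n (a : A.obj n), augHom A n a = 0 → ∀ x, p x → p (cons n a x)) (x : BarModule A) :
    p x :=
  mem_of_cons_mem
    { carrier := {x | p x}
      add_mem' := add _ _
      zero_mem' := zero
      smul_mem' := smul } nil cons x

theorem neg_one_pow_mul_self (n : ℕ) : (-1 : K) ^ n * (-1) ^ n = 1 := by
  rw [← mul_pow]; simp

/-- The first letter of a shuffle of three words comes from one of the three, and both bracketings
split accordingly into the same three terms. -/
theorem shuffleMul_assoc (x y z : BarModule A) :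
    shuffleMul (shuffleMul x y) z = shuffleMul x (shuffleMul y z) := by
  induction z using induction_cons generalizing x y with
  | nil => simp
  | zero => simp
  | add z z' h h' => simp [h, h']
  | smul c z h => simp [h]
  | cons l c _ z hz =>
  induction y using induction_cons generalizing x with
  | nil => simp
  | zero => simp
  | add z z' h h' => simp [h, h']
  | smul c z h => simp [h]
  | cons m b _ y hy =>
  induction x using induction_cons with
  | nil => simp
  | zero => simp
  | add z z' h h' => simp [h, h']
  | smul c z h => simp [h]
  | cons n a _ x hx =>
  -- Both summands of the inner product yield a term starting with c; these recombine into the last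
  -- summand.
  have key : shuffleMul (shuffleMul (cons n a x) (cons m b y)) (cons l c z) =
      cons n a (shuffleMul (shuffleMul x (cons m b y)) (cons l c z)) +
      cons m b (shuffleMul (shuffleMul ((sgn ^ (m + 1)) (cons n a x)) y) (cons l c z)) +
      cons l c (shuffleMul ((sgn ^ (l + 1)) (shuffleMul (cons n a x) (cons m b y))) z) := by
    rw [shuffleMul_cons_cons n m]
    simp only [map_add, LinearMap.add_apply, shuffleMul_cons_cons]
    abel
  rw [key, hx, hy, sgn_pow_shuffleMul, hz, shuffleMul_cons_cons m l]
  simp only [map_add, shuffleMul_cons_cons]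
  abel

theorem parity_cons (a : Σ n, A.obj n) (w : Word A) : parity (a :: w) = a.1 + 1 + parity w := by
  simp [parity]

/-- Graded commutativity without homogeneity of x. Swapping the factors interchanges the two terms
of the shuffle recursion, and the sign acquired twice is 1. -/
theorem shuffleMul_word (w : Word A) (x : BarModule A) :
    shuffleMul x (word w) = shuffleMul (word w) ((sgn ^ parity w) x) := by
  induction w generalizing x with
  | nil => simp [parity]
  | cons b v ih =>
    rw [← cons_word]
    refine LinearMap.congr_fun (f := shuffleMul.flip (cons b.1 b.2 (word v)))
      (g := shuffleMul (cons b.1 b.2 (word v)) ∘ₗ (sgn ^ parity (b :: v) : Module.End K _))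
      (hom_ext_cons ?_ ?_) x
    · simp [sgn_pow_word, parity]
    intro n a _ x hx
    simp only [LinearMap.flip_apply, LinearMap.comp_apply] at hx ⊢
    have e : (sgn ^ parity v) ((sgn ^ (b.1 + 1)) (cons n a x)) =
        (sgn ^ parity (b :: v)) (cons n a x) := by
      rw [parity_cons, add_comm _ (parity v), pow_add sgn (parity v), Module.End.mul_apply]
    rw [shuffleMul_cons_cons, hx, ih, e, sgn_pow_cons, map_smul, map_smul, map_smul,
      shuffleMul_cons_cons, cons_word, sgn_pow_word, map_smul, LinearMap.smul_apply, map_smul,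
      smul_add, smul_smul, mul_comm (n + 1), neg_one_pow_mul_self, one_smul, add_comm]

/-- In a·(x ⧢ [b|y]) the shuffles that place b first acquire the first letter ab, while in (a·x) ⧢
[b|y] they still start with b. The last two terms exchange the former for the latter. -/
theorem mulHead_shuffleMul_left {n m k : ℕ} (h : n + m = k) (a : A.obj n) (b : A.obj m)
    (hb : augHom A m b = 0) (x y : BarModule A) :
    shuffleMul (mulHead n a x) (cons m b y) = mulHead n a (shuffleMul x (cons m b y)) -
      cons k (A.mul h a b) (shuffleMul ((sgn ^ (m + 1)) x) y) +
      cons m b (shuffleMul ((sgn ^ (m + 1)) (mulHead n a x)) y) := by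
  induction x using induction_cons with
  | nil => simp [mulHead_cons h a b hb, sgn_pow_word, parity]
  | zero => simp
  | add x x' hx hx' =>
    simp only [map_add, LinearMap.add_apply, hx, hx']
    abel
  | smul c x hx =>
    simp only [map_smul, LinearMap.smul_apply, hx]
    module
  | cons l c hc x hx =>
    simp only [mulHead_cons rfl a c hc, shuffleMul_cons_cons, map_add, mulHead_cons h a b hb]
    abel

/-- The mirror image of `mulHead_shuffleMul_left`; the extra signs come from moving b past the left
factor. -/
theorem mulHead_shuffleMul_right {n m k : ℕ} (h : m + n = k) (a : A.obj n) (b : A.obj m)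
    (ha : augHom A n a = 0) (x y : BarModule A) :
    shuffleMul (cons n a x) (mulHead m b y) = cons n a (shuffleMul x (mulHead m b y)) +
      mulHead m b (shuffleMul ((sgn ^ m) (cons n a x)) y) -
      (-1 : K) ^ ((n + 1) * m) • cons k (A.mul h b a) (shuffleMul ((sgn ^ m) x) y) := by
  induction y using induction_cons with
  | nil => simp [mulHead_cons h b a ha, sgn_pow_cons]
  | zero => simp
  | add x x' hx hx' =>
    simp only [map_add, hx, hx']
    module
  | smul c x hx =>
    simp only [map_smul, hx]
    module
  | cons l c hc y hy =>
    have e : (sgn ^ (l + 1)) (cons n a ((sgn ^ m) x)) =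
        (-1 : K) ^ ((n + 1) * m) • (sgn ^ (m + l + 1)) (cons n a x) := by
      rw [add_assoc m, add_comm m, pow_add sgn (l + 1), Module.End.mul_apply, sgn_pow_cons n m, map_smul,
        smul_smul, neg_one_pow_mul_self, one_smul]
    simp only [mulHead_cons rfl b c hc, shuffleMul_cons_cons, sgn_pow_cons n m, map_smul, map_add,
      LinearMap.smul_apply, mulHead_cons h b a ha, e, smul_add, smul_smul, neg_one_pow_mul_self,
      one_smul]
    abel

/-- The only terms that do not match directly multiply a letter a of x with a letter b of y. They
occur as ab and as ba, according to which letter precedes the other in the shuffle, and cancel by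
graded commutativity of A. -/
theorem diff_shuffleMul (x y : BarModule A) :
    diff (shuffleMul x y) = shuffleMul (diff x) y + shuffleMul (sgn x) (diff y) := by
  refine hom_ext₂_cons (f := shuffleMul.compr₂ diff)
    (g := shuffleMul.compl₁₂ diff LinearMap.id + shuffleMul.compl₁₂ sgn diff)
    (by simp) (by simp) ?_ x y
  intro n a m b ha hb x y h₁ h₂
  simp only [LinearMap.compr₂_apply, LinearMap.compl₁₂_apply, LinearMap.add_apply,
    LinearMap.id_apply] at h₁ h₂ ⊢
  have hcomm := A.mul_comm (add_comm m n) rfl b a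
  simp only [shuffleMul_cons_cons n m, map_add, diff_cons rfl _ ha, diff_cons rfl _ hb, h₁, h₂,
    LinearMap.add_apply, LinearMap.smul_apply, map_smul, mulHead_shuffleMul_left rfl a b hb,
    sgn_cons, mulHead_shuffleMul_right (add_comm m n) a b ha, shuffleMul_cons_cons n (m + 1),
    shuffleMul_cons_cons (n + 1) m, hcomm]
  -- Once the parities are fixed, all signs and powers of `sgn` become explicit, and an identity in
  -- an abelian group remains.
  rcases n.even_or_odd with hn | hn <;> rcases m.even_or_odd with hm | hm <;>
  · simp only [sgn_cons, sgn_mulHead, sgn_diff, sgn_pow_even, sgn_pow_odd, hm, pow_succ,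
      hn.neg_one_pow, hm.neg_one_pow, pow_mul, sgn_sgn, Module.End.one_apply,
      Module.End.mul_apply, one_smul, neg_smul, map_neg, LinearMap.neg_apply, one_mul,
      mul_neg, mul_one, neg_neg, diff_cons rfl _ ha, map_add, LinearMap.add_apply, smul_add,
      one_pow]
    abel

end BarModule
end AugCDGA

/-! ### The coproduct and its compatibility with the differential and the product. -/

namespace AugCDGA

variable {K : Type v} [Field K]

namespace BarModule

variable {A B : AugCDGA.{v, w} K} {M : Type*} [AddCommGroup M] [Module K M]

@[simp] theorem deconcatMap_nil :
    deconcatMap (word ([] : Word A)) = word [] ⊗ₜ[K] word [] := by simp [deconcatMap, deconcat]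

theorem deconcatMap_cons (n : ℕ) (a : A.obj n) (x : BarModule A) :
    deconcatMap (cons n a x) =
      word [] ⊗ₜ[K] cons n a x + (cons n a).rTensor (BarModule A) (deconcatMap x) := by
  refine LinearMap.congr_fun (f := deconcatMap ∘ₗ cons n a)
    (g := TensorProduct.mk K _ _ (word []) ∘ₗ cons n a +
      (cons n a).rTensor (BarModule A) ∘ₗ deconcatMap) (hom_ext fun w => ?_) x
  simp [deconcatMap, deconcat]

/-- Only the first letter changes, and it lies in the left factor of every cut but the one in front.
That cut is absent from the last term because `mulHead` kills the empty word. -/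
theorem deconcatMap_mulHead (n : ℕ) (a : A.obj n) (x : BarModule A) :
    deconcatMap (mulHead n a x) =
      word [] ⊗ₜ[K] mulHead n a x + (mulHead n a).rTensor (BarModule A) (deconcatMap x) := by
  refine LinearMap.congr_fun (f := deconcatMap ∘ₗ mulHead n a)
    (g := TensorProduct.mk K _ _ (word []) ∘ₗ mulHead n a +
      (mulHead n a).rTensor (BarModule A) ∘ₗ deconcatMap) (hom_ext_cons (by simp) ?_) x
  intro m b hb x _
  have : mulHead n a ∘ₗ cons m b = cons (n + m) (A.mul rfl a b) :=
    LinearMap.ext fun x => mulHead_cons rfl a b hb x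
  have e (t : BarModule A ⊗[K] BarModule A) :
      (mulHead n a).rTensor (BarModule A) ((cons m b).rTensor (BarModule A) t) =
        (cons (n + m) (A.mul rfl a b)).rTensor (BarModule A) t := by
    rw [← this, LinearMap.rTensor_comp_apply]
  simp [deconcatMap_cons, mulHead_cons rfl a b hb, e]

theorem deconcatMap_coassoc (x : BarModule A) :
    TensorProduct.assoc K _ _ _ (deconcatMap.rTensor (BarModule A) (deconcatMap x)) =
      deconcatMap.lTensor (BarModule A) (deconcatMap x) := by
  refine LinearMap.congr_fun
    (f := (TensorProduct.assoc K (BarModule A) (BarModule A) (BarModule A)).toLinearMap ∘ₗ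
      deconcatMap.rTensor (BarModule A) ∘ₗ deconcatMap)
    (g := deconcatMap.lTensor (BarModule A) ∘ₗ deconcatMap) (hom_ext_cons (by simp) ?_) x
  intro n a _ x hx
  have key (y : BarModule A) (s : BarModule A ⊗[K] BarModule A) :
      TensorProduct.assoc K _ _ _ ((cons n a).rTensor (BarModule A) s ⊗ₜ[K] y) =
        (cons n a).rTensor _ (TensorProduct.assoc K _ _ _ (s ⊗ₜ[K] y)) := by
    induction s with
    | zero => simp
    | add s t hs ht => simp only [map_add, TensorProduct.add_tmul, hs, ht]
    | tmul p q => simp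
  have key' (t : BarModule A ⊗[K] BarModule A) :
      TensorProduct.assoc K _ _ _ (deconcatMap.rTensor (BarModule A)
        ((cons n a).rTensor (BarModule A) t)) = word [] ⊗ₜ[K] (cons n a).rTensor (BarModule A) t +
        (cons n a).rTensor _ (TensorProduct.assoc K _ _ _
          (deconcatMap.rTensor (BarModule A) t)) := by
    induction t with
    | zero => simp
    | add s t hs ht => simp only [map_add, TensorProduct.tmul_add, hs, ht]; abel
    | tmul p q => simp [deconcatMap_cons, TensorProduct.add_tmul, key]
  have key'' (t : BarModule A ⊗[K] BarModule A) :
      deconcatMap.lTensor (BarModule A) ((cons n a).rTensor (BarModule A) t) =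
        (cons n a).rTensor _ (deconcatMap.lTensor (BarModule A) t) := by
    induction t with
    | zero => simp
    | add s t hs ht => simp only [map_add, hs, ht]
    | tmul p q => simp
  simp only [LinearMap.comp_apply, LinearEquiv.coe_coe] at hx ⊢
  simp [deconcatMap_cons, key', hx, key'', TensorProduct.tmul_add, add_assoc]

@[simp] theorem counitMap_nil : counitMap (word ([] : Word A)) = 1 := by
  simp [counitMap, counitWord]

@[simp] theorem counitMap_cons (n : ℕ) (a : A.obj n) (x : BarModule A) :
    counitMap (cons n a x) = 0 := by
  refine LinearMap.congr_fun (f := counitMap ∘ₗ cons n a) (g := 0) (hom_ext fun w => ?_) x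
  simp [counitMap, counitWord]

@[simp] theorem counitMap_mulHead (n : ℕ) (a : A.obj n) (x : BarModule A) :
    counitMap (mulHead n a x) = 0 := by
  refine LinearMap.congr_fun (f := counitMap ∘ₗ mulHead n a) (g := 0)
    (hom_ext_cons (by simp) ?_) x
  intro m b hb x _
  simp [mulHead_cons rfl a b hb]

theorem counitMap_diff (x : BarModule A) : counitMap (diff x) = 0 := by
  refine LinearMap.congr_fun (f := counitMap ∘ₗ diff) (g := 0) (hom_ext_cons (by simp) ?_) x
  intro n a ha x _
  simp [diff_cons rfl a ha]

theorem counitMap_shuffleMul (x y : BarModule A) :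
    counitMap (shuffleMul x y) = counitMap x * counitMap y := by
  refine hom_ext₂_cons (f := shuffleMul.compr₂ counitMap)
    (g := (LinearMap.mul K K).compl₁₂ counitMap counitMap) (by simp) (by simp) ?_ x y
  intro n a m b _ _ x y _ _
  simp [shuffleMul_cons_cons]

theorem rTensor_counitMap_deconcatMap (x : BarModule A) :
    counitMap.rTensor (BarModule A) (deconcatMap x) = 1 ⊗ₜ[K] x := by
  refine LinearMap.congr_fun (f := counitMap.rTensor (BarModule A) ∘ₗ deconcatMap)
    (g := TensorProduct.mk K K _ 1) (hom_ext_cons (by simp) ?_) x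
  intro n a _ x _
  have : counitMap ∘ₗ cons n a = 0 := LinearMap.ext fun x => counitMap_cons n a x
  have e (t : BarModule A ⊗[K] BarModule A) :
      counitMap.rTensor (BarModule A) ((cons n a).rTensor (BarModule A) t) = 0 := by
    rw [← LinearMap.rTensor_comp_apply, this, LinearMap.rTensor_zero, LinearMap.zero_apply]
  simp [deconcatMap_cons, e]

theorem lTensor_counitMap_deconcatMap (x : BarModule A) :
    counitMap.lTensor (BarModule A) (deconcatMap x) = x ⊗ₜ[K] 1 := by
  refine LinearMap.congr_fun (f := counitMap.lTensor (BarModule A) ∘ₗ deconcatMap)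
    (g := (TensorProduct.mk K _ K).flip 1) (hom_ext_cons (by simp) ?_) x
  intro n a _ x hx
  simp only [LinearMap.comp_apply, LinearMap.flip_apply, TensorProduct.mk_apply] at hx ⊢
  rw [deconcatMap_cons, map_add, ← LinearMap.comp_apply (LinearMap.lTensor _ _),
    LinearMap.lTensor_comp_rTensor, ← LinearMap.rTensor_comp_lTensor, LinearMap.comp_apply, hx]
  simp

/-- The differential of the tensor square of the bar complex. -/
noncomputable def tensorDiff :
    BarModule A ⊗[K] BarModule A →ₗ[K] BarModule A ⊗[K] BarModule A :=
  diff.rTensor (BarModule A) + TensorProduct.map sgn diff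

/-- Prefixing a letter to the left tensor factor transforms the differential of the tensor square by
the same rule as `diff_cons`; the cut in front of the letter contributes [] ⊗ D[a|x]. -/
theorem deconcatMap_diff (x : BarModule A) : deconcatMap (diff x) = tensorDiff (deconcatMap x) := by
  refine LinearMap.congr_fun (f := deconcatMap ∘ₗ diff) (g := tensorDiff ∘ₗ deconcatMap)
    (hom_ext_cons (by simp [tensorDiff]) ?_) x
  intro n a ha x hx
  simp only [LinearMap.comp_apply] at hx ⊢
  have key (t : BarModule A ⊗[K] BarModule A) :
      tensorDiff ((cons n a).rTensor (BarModule A) t) =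
        (cons (n + 1) (A.d rfl a)).rTensor (BarModule A) t + (-1 : K) ^ (n + 1) •
          ((cons n a).rTensor (BarModule A) (tensorDiff t) +
            (mulHead n a).rTensor (BarModule A) t) := by
    induction t with
    | zero => simp
    | add s t hs ht => simp only [map_add, hs, ht]; module
    | tmul p q =>
      simp only [tensorDiff, LinearMap.add_apply, LinearMap.rTensor_tmul, TensorProduct.map_tmul,
        diff_cons rfl a ha, sgn_cons, TensorProduct.add_tmul, ← TensorProduct.smul_tmul',
        map_add]
      module
  have key' (y : BarModule A) : tensorDiff (word [] ⊗ₜ[K] y) = word [] ⊗ₜ[K] diff y := by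
    simp [tensorDiff]
  rw [deconcatMap_cons, map_add, key, key', diff_cons rfl a ha]
  simp only [map_add, map_smul, deconcatMap_cons, deconcatMap_mulHead, hx, TensorProduct.tmul_add,
    TensorProduct.tmul_smul]
  module

/-- The Koszul braiding of the bar complex. -/
noncomputable def braiding :
    BarModule A ⊗[K] BarModule A →ₗ[K] BarModule A ⊗[K] BarModule A :=
  -- The sign (-1)^(|x| |v|) is realised by applying `sgn ^ parity v` to x, so only v has to be a
  -- word.
  TensorProduct.lift (LinearMap.flip (lift
    (fun v => TensorProduct.mk K _ _ (word v) ∘ₗ (sgn ^ parity v : Module.End K (BarModule A)))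
    { linear := fun u v n => by
        obtain ⟨ℓ, hℓ⟩ := compatible_word.linear u v n
        refine ⟨LinearMap.lcomp K _ (sgn ^ (parity u + (n + 1 + parity v)) :
          Module.End K (BarModule A)) ∘ₗ TensorProduct.mk K _ _ ∘ₗ ℓ, fun x => ?_⟩
        ext y
        simp [hℓ, parity_eq]
      unit := fun u v => by simp [word_unit] }))

theorem braiding_tmul_word (x : BarModule A) (v : Word A) :
    braiding (x ⊗ₜ[K] word v) = word v ⊗ₜ[K] (sgn ^ parity v) x := by simp [braiding]

@[simp] theorem braiding_tmul_nil (x : BarModule A) :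
    braiding (x ⊗ₜ[K] word []) = word [] ⊗ₜ[K] x := by simp [braiding_tmul_word, parity]

theorem braiding_tmul_cons (x : BarModule A) (m : ℕ) (b : A.obj m) (y : BarModule A) :
    braiding (x ⊗ₜ[K] cons m b y) =
      (cons m b).rTensor (BarModule A) (braiding ((sgn ^ (m + 1)) x ⊗ₜ[K] y)) := by
  refine LinearMap.congr_fun (f := braiding ∘ₗ TensorProduct.mk K _ _ x ∘ₗ cons m b)
    (g := (cons m b).rTensor (BarModule A) ∘ₗ braiding ∘ₗ
      TensorProduct.mk K _ _ ((sgn ^ (m + 1)) x)) (hom_ext fun w => ?_) y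
  simp only [LinearMap.comp_apply, TensorProduct.mk_apply, cons_word, braiding_tmul_word,
    parity_cons, LinearMap.rTensor_tmul]
  rw [add_comm, pow_add, Module.End.mul_apply]

/-- The product on the tensor square of the bar complex. -/
noncomputable def tensorShuffle :
    (BarModule A ⊗[K] BarModule A) ⊗[K] (BarModule A ⊗[K] BarModule A) →ₗ[K]
      BarModule A ⊗[K] BarModule A :=
  TensorProduct.map (TensorProduct.lift shuffleMul) (TensorProduct.lift shuffleMul) ∘ₗ
    (TensorProduct.assoc K _ _ _).symm.toLinearMap ∘ₗ
      LinearMap.lTensor (BarModule A)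
        ((TensorProduct.assoc K _ _ _).toLinearMap ∘ₗ
          LinearMap.rTensor (BarModule A) braiding ∘ₗ
            (TensorProduct.assoc K _ _ _).symm.toLinearMap) ∘ₗ
        (TensorProduct.assoc K _ _ _).toLinearMap

theorem tensorShuffle_tmul (x x' y y' : BarModule A) :
    tensorShuffle ((x ⊗ₜ[K] x') ⊗ₜ[K] (y ⊗ₜ[K] y')) =
      TensorProduct.map (shuffleMul x) (shuffleMul.flip y') (braiding (x' ⊗ₜ[K] y)) := by
  simp only [tensorShuffle, LinearMap.comp_apply, LinearEquiv.coe_coe, TensorProduct.assoc_tmul,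
    LinearMap.lTensor_tmul, TensorProduct.assoc_symm_tmul, LinearMap.rTensor_tmul]
  induction braiding (x' ⊗ₜ[K] y) with
  | zero => simp
  | add s t hs ht => simp only [map_add, TensorProduct.add_tmul, TensorProduct.tmul_add, hs, ht]
  | tmul p q => simp

/-- This and the next three lemmas cover the cases in which each left tensor factor is empty or
begins with a letter. Together they are the shuffle recursion on the tensor square. -/
theorem tensorShuffle_nil_nil (x y : BarModule A) :
    tensorShuffle ((word [] ⊗ₜ[K] x) ⊗ₜ[K] (word [] ⊗ₜ[K] y)) =
      word [] ⊗ₜ[K] shuffleMul x y := by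
  simp [tensorShuffle_tmul]

theorem tensorShuffle_cons_nil (n : ℕ) (a : A.obj n) (t : BarModule A ⊗[K] BarModule A)
    (y : BarModule A) :
    tensorShuffle ((cons n a).rTensor (BarModule A) t ⊗ₜ[K] (word [] ⊗ₜ[K] y)) =
      (cons n a).rTensor (BarModule A) (tensorShuffle (t ⊗ₜ[K] (word [] ⊗ₜ[K] y))) := by
  induction t with
  | zero => simp
  | add s t hs ht => simp only [map_add, TensorProduct.add_tmul, hs, ht]
  | tmul p q => simp [tensorShuffle_tmul]

theorem tensorShuffle_nil_cons (m : ℕ) (b : A.obj m) (x : BarModule A)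
    (t : BarModule A ⊗[K] BarModule A) :
    tensorShuffle ((word [] ⊗ₜ[K] x) ⊗ₜ[K] (cons m b).rTensor (BarModule A) t) =
      (cons m b).rTensor (BarModule A)
        (tensorShuffle ((word [] ⊗ₜ[K] (sgn ^ (m + 1)) x) ⊗ₜ[K] t)) := by
  induction t with
  | zero => simp
  | add s t hs ht => simp only [map_add, TensorProduct.tmul_add, hs, ht]
  | tmul p q =>
    simp only [LinearMap.rTensor_tmul, tensorShuffle_tmul, braiding_tmul_cons]
    induction braiding ((sgn ^ (m + 1)) x ⊗ₜ[K] p) with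
    | zero => simp
    | add s t hs ht => simp only [map_add, hs, ht]
    | tmul p q => simp

theorem tensorShuffle_cons_cons (n m : ℕ) (a : A.obj n) (b : A.obj m)
    (s t : BarModule A ⊗[K] BarModule A) :
    tensorShuffle ((cons n a).rTensor (BarModule A) s ⊗ₜ[K] (cons m b).rTensor (BarModule A) t) =
      (cons n a).rTensor (BarModule A)
        (tensorShuffle (s ⊗ₜ[K] (cons m b).rTensor (BarModule A) t)) +
      (cons m b).rTensor (BarModule A)
        (tensorShuffle (TensorProduct.map (sgn ^ (m + 1)) (sgn ^ (m + 1))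
          ((cons n a).rTensor (BarModule A) s) ⊗ₜ[K] t)) := by
  induction s with
  | zero => simp
  | add s s' hs hs' => simp only [map_add, TensorProduct.add_tmul, hs, hs']; abel
  | tmul x x' =>
  induction t with
  | zero => simp
  | add t t' ht ht' => simp only [map_add, TensorProduct.tmul_add, ht, ht']; abel
  | tmul y y' =>
    simp only [LinearMap.rTensor_tmul, tensorShuffle_tmul, braiding_tmul_cons,
      TensorProduct.map_tmul]
    induction braiding ((sgn ^ (m + 1)) x' ⊗ₜ[K] y) with
    | zero => simp
    | add s t hs ht => simp only [map_add, hs, ht]; abel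
    | tmul p q => simp [shuffleMul_cons_cons, TensorProduct.add_tmul]

theorem deconcatMap_sgn (x : BarModule A) :
    deconcatMap (sgn x) = TensorProduct.map sgn sgn (deconcatMap x) := by
  refine LinearMap.congr_fun (f := deconcatMap ∘ₗ sgn)
    (g := TensorProduct.map sgn sgn ∘ₗ deconcatMap) (hom_ext_cons (by simp) ?_) x
  intro n a _ x hx
  simp only [LinearMap.comp_apply] at hx ⊢
  have key (t : BarModule A ⊗[K] BarModule A) :
      TensorProduct.map sgn sgn ((cons n a).rTensor (BarModule A) t) =
        (-1 : K) ^ (n + 1) • (cons n a).rTensor (BarModule A) (TensorProduct.map sgn sgn t) := by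
    induction t with
    | zero => simp
    | add s t hs ht => simp only [map_add, hs, ht, smul_add]
    | tmul p q => simp [sgn_cons, ← TensorProduct.smul_tmul']
  rw [sgn_cons, map_smul, deconcatMap_cons, deconcatMap_cons, map_add, hx, key]
  simp [sgn_cons, TensorProduct.tmul_smul]

theorem sgn_pow_nil (n : ℕ) : (sgn ^ n) (word ([] : Word A)) = word [] := by
  simp [sgn_pow_word, parity]

theorem deconcatMap_sgn_pow (n : ℕ) (x : BarModule A) :
    deconcatMap ((sgn ^ n) x) = TensorProduct.map (sgn ^ n) (sgn ^ n) (deconcatMap x) := by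
  rcases n.even_or_odd with hn | hn
  · simp [sgn_pow_even hn, Module.End.one_eq_id]
  · simp [sgn_pow_odd hn, deconcatMap_sgn]

theorem braiding_nil_tmul (x : BarModule A) :
    braiding (word [] ⊗ₜ[K] x) = x ⊗ₜ[K] word [] := by
  refine LinearMap.congr_fun (f := braiding ∘ₗ TensorProduct.mk K _ _ (word []))
    (g := (TensorProduct.mk K _ _).flip (word [])) (hom_ext fun w => ?_) x
  simp [braiding_tmul_word, sgn_pow_word, parity]

theorem tensorShuffle_one_left (t : BarModule A ⊗[K] BarModule A) :
    tensorShuffle ((word [] ⊗ₜ[K] word []) ⊗ₜ[K] t) = t := by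
  induction t with
  | zero => simp
  | add s t hs ht => simp only [TensorProduct.tmul_add, map_add, hs, ht]
  | tmul p q => simp [tensorShuffle_tmul, braiding_nil_tmul]

theorem tensorShuffle_one_right (t : BarModule A ⊗[K] BarModule A) :
    tensorShuffle (t ⊗ₜ[K] (word [] ⊗ₜ[K] word [])) = t := by
  induction t with
  | zero => simp
  | add s t hs ht => simp only [TensorProduct.add_tmul, map_add, hs, ht]
  | tmul p q => simp [tensorShuffle_tmul]

/-- Writing Δ[a|x] = [] ⊗ [a|x] + [a|·]Δx for both arguments gives four products, and the recursion
in the tensor square turns them into the coproduct of the shuffle recursion. -/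
theorem deconcatMap_shuffleMul (x y : BarModule A) :
    deconcatMap (shuffleMul x y) = tensorShuffle (deconcatMap x ⊗ₜ[K] deconcatMap y) := by
  refine hom_ext₂_cons (f := shuffleMul.compr₂ deconcatMap)
    (g := ((TensorProduct.mk K _ _).compl₁₂ deconcatMap deconcatMap).compr₂ tensorShuffle)
    (by simp [tensorShuffle_one_left]) (by simp [tensorShuffle_one_right]) ?_ x y
  intro n a m b _ _ x y h₁ h₂
  simp only [LinearMap.compr₂_apply, LinearMap.compl₁₂_apply, TensorProduct.mk_apply] at h₁ h₂ ⊢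
  rw [shuffleMul_cons_cons, map_add, deconcatMap_cons, deconcatMap_cons m, h₁, h₂,
    deconcatMap_sgn_pow, deconcatMap_cons n, deconcatMap_cons m]
  simp only [map_add, TensorProduct.add_tmul, TensorProduct.tmul_add, tensorShuffle_nil_nil,
    tensorShuffle_cons_nil, tensorShuffle_nil_cons, tensorShuffle_cons_cons,
    shuffleMul_cons_cons n m, TensorProduct.map_tmul, sgn_pow_nil]
  abel

end BarModule
end AugCDGA

namespace AugCDGA

variable {K : Type v} [Field K]

namespace BarModule

variable {A B : AugCDGA.{v, w} K} {M : Type*} [AddCommGroup M] [Module K M]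

/-! ### The antipode -/

/-- The sign of the antipode on words whose letters have the given degrees. -/
def antipodeSign (K : Type v) [Field K] : List ℕ → K
  | [] => 1
  | n :: l => -((-1) ^ ((n + 1) * (l.map (· + 1)).sum) * antipodeSign K l)

/-- The sign is -1 for each letter times the Koszul sign of each pair of letters, so it can equally
be unfolded from the end. This is needed because reversed words start with the last letter. -/
theorem antipodeSign_append (l : List ℕ) (n : ℕ) :
    antipodeSign K (l ++ [n]) =
      -((-1) ^ ((l.map (· + 1)).sum * (n + 1)) * antipodeSign K l) := by
  induction l with
  | nil => simp [antipodeSign]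
  | cons m l ih =>
    simp only [List.cons_append, antipodeSign, ih, List.map_append, List.sum_append, List.map_cons,
      List.sum_cons, List.map_nil, List.sum_nil, add_zero, mul_add, add_mul, pow_add]
    ring

theorem parity_eq_sum (w : Word A) : parity w = ((w.map Sigma.fst).map (· + 1)).sum := by
  simp [parity, Function.comp_def]

/-- The antipode `[a_1 | ⋯ | a_p] ↦ ± [a_p | ⋯ | a_1]`. -/
noncomputable def antipode : BarModule A →ₗ[K] BarModule A :=
  lift (fun w => antipodeSign K (w.map Sigma.fst) • word w.reverse)
    { linear := fun u v n => by
        obtain ⟨ℓ, hℓ⟩ := compatible_word.linear v.reverse u.reverse n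
        exact ⟨antipodeSign K ((u.map Sigma.fst) ++ n :: v.map Sigma.fst) • ℓ,
          fun x => by simp [← hℓ]⟩
      unit := fun u v => by
        have := word_unit v.reverse u.reverse
        simp [this] }

theorem antipode_word (w : Word A) :
    antipode (word w) = antipodeSign K (w.map Sigma.fst) • word w.reverse := by simp [antipode]

@[simp] theorem antipode_nil : antipode (word ([] : Word A)) = word [] := by
  simp [antipode_word, antipodeSign]

/-- Putting a word in front. -/
noncomputable def consWord (u : Word A) : BarModule A →ₗ[K] BarModule A :=
  u.foldr (fun a φ => cons a.1 a.2 ∘ₗ φ) LinearMap.id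

theorem consWord_word (u w : Word A) : consWord u (word w) = word (u ++ w) := by
  induction u with
  | nil => rfl
  | cons a u ih =>
    change cons a.1 a.2 (consWord u (word w)) = _
    rw [ih, cons_word, List.cons_append]

theorem consWord_append (u : Word A) (a : Σ n, A.obj n) :
    consWord (u ++ [a]) = consWord u ∘ₗ cons a.1 a.2 :=
  hom_ext fun w => by simp [consWord_word]

/-- The convolution product of two endomorphisms of the bar complex. -/
noncomputable def convolution (φ ψ : BarModule A →ₗ[K] BarModule A) :
    BarModule A →ₗ[K] BarModule A :=
  TensorProduct.lift shuffleMul ∘ₗ TensorProduct.map φ ψ ∘ₗ deconcatMap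

/-- Splits off the cut in front of a; for all other cuts a moves into the argument of φ, so the
prefix already passed accumulates there. -/
theorem convolution_cons_right (φ ψ : BarModule A →ₗ[K] BarModule A) (n : ℕ) (a : A.obj n)
    (x : BarModule A) :
    convolution φ ψ (cons n a x) =
      shuffleMul (φ (word [])) (ψ (cons n a x)) + convolution (φ ∘ₗ cons n a) ψ x := by
  simp only [convolution, LinearMap.comp_apply, deconcatMap_cons, map_add, TensorProduct.map_tmul,
    TensorProduct.lift.tmul]
  congr 2
  rw [← LinearMap.comp_apply, LinearMap.map_comp_rTensor]

/-- A telescoping sum: the left side collects the cuts of u, a, v that come after a. Cutting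
directly after a gives shuffles that begin with a or with the first letter b of v; the latter cancel
the sum over all later cuts. -/
theorem convolution_antipode_consWord (u v : Word A) (a : Σ n, A.obj n) :
    convolution (antipode ∘ₗ consWord (u ++ [a])) LinearMap.id (word v) =
      antipodeSign K ((u ++ [a]).map Sigma.fst) •
        cons a.1 a.2 (shuffleMul (word u.reverse) (word v)) := by
  induction v generalizing u a with
  | nil => simp [convolution, consWord_word, antipode_word]
  | cons b v ih =>
    rw [← cons_word, convolution_cons_right, LinearMap.comp_assoc, ← consWord_append, ih,
      LinearMap.comp_apply, consWord_word, antipode_word, List.append_nil, List.map_append,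
      List.map_append, List.map_cons, List.map_nil, List.map_cons, List.map_nil,
      antipodeSign_append _ b.1, List.reverse_append, List.reverse_singleton, List.singleton_append,
      ← cons_word, map_smul, LinearMap.smul_apply, LinearMap.id_apply, shuffleMul_cons_cons,
      cons_word, cons_word, sgn_pow_word]
    have h : parity (a :: u.reverse) = ((u.map Sigma.fst ++ [a.1]).map (· + 1)).sum := by
      rw [parity_cons, parity_eq_sum]
      simp [List.sum_reverse, add_comm]
    rw [h, map_smul, LinearMap.smul_apply, map_smul, mul_comm (b.1 + 1)]
    simp only [List.map_append, List.map_cons, List.map_nil]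
    module

/-- The projection to the line spanned by the empty word. -/
noncomputable def unitCounit : BarModule A →ₗ[K] BarModule A := counitMap.smulRight (word [])

/-- On a nonempty word the cut in front contributes the word itself, and by the telescoping the
remaining cuts contribute its negative. -/
theorem convolution_antipode_left : convolution antipode LinearMap.id =
    (unitCounit : BarModule A →ₗ[K] BarModule A) := by
  refine hom_ext fun w => ?_
  cases w with
  | nil => simp [convolution, unitCounit]
  | cons a v =>
    have := convolution_antipode_consWord [] v a
    rw [consWord_append] at this
    change convolution (antipode ∘ₗ cons a.1 a.2) LinearMap.id (word v) = _ at this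
    rw [← cons_word, convolution_cons_right, this]
    simp [antipodeSign, unitCounit, -cons_word]

/-- Every cut other than the one at the very end leaves a strictly shorter word on the left. -/
theorem map_deconcatMap_left (φ ψ : BarModule A →ₗ[K] BarModule A) (w : Word A)
    (h : ∀ u : Word A, u.length < w.length → φ (word u) = 0) :
    TensorProduct.map φ ψ (deconcatMap (word w)) = φ (word w) ⊗ₜ[K] ψ (word []) := by
  induction w generalizing φ with
  | nil => simp
  | cons a w ih =>
    have := ih (φ ∘ₗ cons a.1 a.2) (fun u hu => by simpa using h (a :: u) (by simpa using hu))
    rw [← cons_word, deconcatMap_cons, map_add, ← LinearMap.comp_apply (TensorProduct.map φ ψ),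
      LinearMap.map_comp_rTensor, this]
    simp [h [] (by simp)]

theorem map_deconcatMap_right (φ ψ : BarModule A →ₗ[K] BarModule A) (w : Word A)
    (h : ∀ u : Word A, u.length < w.length → ψ (word u) = 0) :
    TensorProduct.map φ ψ (deconcatMap (word w)) = φ (word []) ⊗ₜ[K] ψ (word w) := by
  induction w generalizing φ with
  | nil => simp
  | cons a w ih =>
    have := ih (φ ∘ₗ cons a.1 a.2) (fun u hu => h u (by simp; omega))
    rw [← cons_word, deconcatMap_cons, map_add, ← LinearMap.comp_apply (TensorProduct.map φ ψ),
      LinearMap.map_comp_rTensor, this, h w (by simp)]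
    simp

/-- Convolution with an endomorphism that fixes the empty word is injective. -/
theorem eq_zero_of_convolution_left (φ ψ : BarModule A →ₗ[K] BarModule A)
    (hψ : ψ (word []) = word []) (h : convolution φ ψ = 0) : φ = 0 := by
  refine hom_ext fun w => ?_
  induction hn : w.length using Nat.strong_induction_on generalizing w with
  | _ n ih =>
    -- As φ vanishes on shorter words, the convolution at w reduces to the product of φ(w) and ψ([])
    -- = [].
    have h₁ := map_deconcatMap_left φ ψ w fun u hu => ih _ (hn ▸ hu) u rfl
    have h₂ := LinearMap.congr_fun h (word w)
    simpa [convolution, h₁, hψ] using h₂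

theorem eq_zero_of_convolution_right (φ ψ : BarModule A →ₗ[K] BarModule A)
    (hφ : φ (word []) = word []) (h : convolution φ ψ = 0) : ψ = 0 := by
  refine hom_ext fun w => ?_
  induction hn : w.length using Nat.strong_induction_on generalizing w with
  | _ n ih =>
    have h₁ := map_deconcatMap_right φ ψ w fun u hu => ih _ (hn ▸ hu) u rfl
    have h₂ := LinearMap.congr_fun h (word w)
    simpa [convolution, h₁, hφ] using h₂

theorem convolution_assoc (φ ψ χ : BarModule A →ₗ[K] BarModule A) :
    convolution (convolution φ ψ) χ = convolution φ (convolution ψ χ) := by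
  let μ : BarModule A ⊗[K] BarModule A →ₗ[K] BarModule A := TensorProduct.lift shuffleMul
  let W : BarModule A ⊗[K] (BarModule A ⊗[K] BarModule A) →ₗ[K] BarModule A :=
    μ ∘ₗ TensorProduct.map φ (μ ∘ₗ TensorProduct.map ψ χ)
  have h₁ (t : BarModule A ⊗[K] BarModule A) :
      μ (TensorProduct.map φ (convolution ψ χ) t) = W (deconcatMap.lTensor (BarModule A) t) := by
    induction t with
    | zero => simp
    | add s t hs ht => simp only [map_add, hs, ht]
    | tmul p q => simp [W, μ, convolution]
  have h₂ (t : BarModule A ⊗[K] BarModule A) :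
      μ (TensorProduct.map (convolution φ ψ) χ t) =
        W (TensorProduct.assoc K _ _ _ (deconcatMap.rTensor (BarModule A) t)) := by
    induction t with
    | zero => simp
    | add s t hs ht => simp only [map_add, hs, ht]
    | tmul p q =>
      simp only [convolution, TensorProduct.map_tmul, LinearMap.comp_apply, LinearMap.rTensor_tmul]
      induction deconcatMap p with
      | zero => simp
      | add s t hs ht => simp only [map_add, TensorProduct.add_tmul, hs, ht]
      | tmul r s => simp [W, μ, shuffleMul_assoc]
  refine LinearMap.ext fun x => ?_
  change μ (TensorProduct.map _ _ (deconcatMap x)) = μ (TensorProduct.map _ _ (deconcatMap x))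
  rw [h₁, h₂, deconcatMap_coassoc]

theorem convolution_unitCounit_left (φ : BarModule A →ₗ[K] BarModule A) :
    convolution unitCounit φ = φ := by
  refine LinearMap.ext fun x => ?_
  have h (t : BarModule A ⊗[K] BarModule A) : TensorProduct.lift shuffleMul
      (TensorProduct.map unitCounit φ t) =
        φ (TensorProduct.lid K _ (counitMap.rTensor (BarModule A) t)) := by
    induction t with
    | zero => simp
    | add s t hs ht => simp only [map_add, hs, ht]
    | tmul p q => simp [unitCounit]
  simp [convolution, h, rTensor_counitMap_deconcatMap]

theorem convolution_unitCounit_right (φ : BarModule A →ₗ[K] BarModule A) :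
    convolution φ unitCounit = φ := by
  refine LinearMap.ext fun x => ?_
  have h (t : BarModule A ⊗[K] BarModule A) : TensorProduct.lift shuffleMul
      (TensorProduct.map φ unitCounit t) =
        φ (TensorProduct.rid K _ (counitMap.lTensor (BarModule A) t)) := by
    induction t with
    | zero => simp
    | add s t hs ht => simp only [map_add, hs, ht]
    | tmul p q => simp [unitCounit]
  simp [convolution, h, lTensor_counitMap_deconcatMap]

theorem convolution_sub_right (φ ψ χ : BarModule A →ₗ[K] BarModule A) :
    convolution φ (ψ - χ) = convolution φ ψ - convolution φ χ := by
  have : TensorProduct.map φ (ψ - χ) = TensorProduct.map φ ψ - TensorProduct.map φ χ :=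
    TensorProduct.ext' fun _ _ => by simp [TensorProduct.tmul_sub]
  simp only [convolution, this, LinearMap.sub_comp, LinearMap.comp_sub]

theorem convolution_sub_left (φ ψ χ : BarModule A →ₗ[K] BarModule A) :
    convolution (φ - ψ) χ = convolution φ χ - convolution ψ χ := by
  have : TensorProduct.map (φ - ψ) χ = TensorProduct.map φ χ - TensorProduct.map ψ χ :=
    TensorProduct.ext' fun _ _ => by simp [TensorProduct.sub_tmul]
  simp only [convolution, this, LinearMap.sub_comp, LinearMap.comp_sub]

/-- No second telescoping is needed: S * (id * S) = (S * id) * S = S = S * ηε, and convolution by S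
on the left is injective. -/
theorem convolution_antipode_right : convolution LinearMap.id antipode =
    (unitCounit : BarModule A →ₗ[K] BarModule A) := by
  refine sub_eq_zero.1 (eq_zero_of_convolution_right antipode _ antipode_nil ?_)
  rw [convolution_sub_right, ← convolution_assoc, convolution_antipode_left,
    convolution_unitCounit_left, convolution_unitCounit_right, sub_self]

theorem sgn_antipode (x : BarModule A) : sgn (antipode x) = antipode (sgn x) := by
  refine LinearMap.congr_fun (f := sgn ∘ₗ antipode) (g := antipode ∘ₗ sgn) (hom_ext fun w => ?_) x
  have : parity w.reverse = parity w := by simp [parity, List.sum_reverse]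
  simp [antipode_word, sgn_word, this, smul_comm ((-1 : K) ^ parity w)]

/-- Differentiating S * id = ηε on the output side gives (DS) * id + (sgn S) * D = 0, and
precomposing it with D gives (SD) * id + (sgn S) * D = 0. Hence (SD - DS) * id = 0, and convolution
by the identity is injective. -/
theorem antipode_diff (x : BarModule A) : antipode (diff x) = diff (antipode x) := by
  have h₁ (t : BarModule A ⊗[K] BarModule A) :
      diff (TensorProduct.lift shuffleMul (TensorProduct.map antipode LinearMap.id t)) =
        TensorProduct.lift shuffleMul (TensorProduct.map (diff ∘ₗ antipode) LinearMap.id t) +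
        TensorProduct.lift shuffleMul (TensorProduct.map (sgn ∘ₗ antipode) diff t) := by
    induction t with
    | zero => simp
    | add s t hs ht => simp only [map_add, hs, ht]; abel
    | tmul p q => simp [diff_shuffleMul]
  have h₂ (t : BarModule A ⊗[K] BarModule A) :
      TensorProduct.lift shuffleMul (TensorProduct.map antipode LinearMap.id (tensorDiff t)) =
        TensorProduct.lift shuffleMul (TensorProduct.map (antipode ∘ₗ diff) LinearMap.id t) +
        TensorProduct.lift shuffleMul (TensorProduct.map (sgn ∘ₗ antipode) diff t) := by
    induction t with
    | zero => simp
    | add s t hs ht => simp only [map_add, hs, ht]; abel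
    | tmul p q => simp [tensorDiff, sgn_antipode]
  have h : convolution (antipode ∘ₗ diff - diff ∘ₗ antipode) LinearMap.id =
      (0 : BarModule A →ₗ[K] BarModule A) := by
    refine LinearMap.ext fun x => ?_
    have e₁ := LinearMap.congr_fun (convolution_antipode_left (A := A)) x
    have e₂ := LinearMap.congr_fun (convolution_antipode_left (A := A)) (diff x)
    simp only [convolution, LinearMap.comp_apply, unitCounit, LinearMap.smulRight_apply,
      counitMap_diff, zero_smul, deconcatMap_diff, h₂] at e₁ e₂
    have e₃ := h₁ (deconcatMap x)
    rw [e₁, map_smul, diff_nil, smul_zero] at e₃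
    rw [convolution_sub_left]
    simp only [convolution, LinearMap.comp_apply, LinearMap.sub_apply, LinearMap.zero_apply]
    rw [sub_eq_zero]
    exact add_right_cancel (e₂.trans e₃)
  exact LinearMap.congr_fun (sub_eq_zero.1 (eq_zero_of_convolution_left _ _ rfl h)) x

end BarModule
end AugCDGA

namespace AugCDGA

variable {K : Type v} [Field K]

namespace BarModule

variable {A B : AugCDGA.{v, w} K} {M : Type*} [AddCommGroup M] [Module K M]

/-! ### The grading -/

/-- The elements of total degree `k` of the bar complex. -/
noncomputable def grade (A : AugCDGA.{v, w} K) (k : ℤ) : Submodule K (BarModule A) :=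
  Submodule.span K {x | ∃ w : Word A, totalDegree w = k ∧ word w = x}

theorem word_mem_grade (w : Word A) : word w ∈ grade A (totalDegree w) :=
  Submodule.subset_span ⟨w, rfl, rfl⟩

theorem totalDegree_cons (a : Σ n, A.obj n) (w : Word A) :
    totalDegree (a :: w) = a.1 - 1 + totalDegree w := by
  simp [totalDegree]; ring

theorem totalDegree_nil : totalDegree ([] : Word A) = 0 := by simp [totalDegree]

theorem map_mem_of_mem_grade {f : BarModule A →ₗ[K] M} {N : Submodule K M} {k : ℤ}
    (h : ∀ w, totalDegree w = k → f (word w) ∈ N) {x : BarModule A} (hx : x ∈ grade A k) :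
    f x ∈ N := by
  have : grade A k ≤ N.comap f := Submodule.span_le.2 (by rintro _ ⟨w, hw, rfl⟩; exact h w hw)
  exact this hx

theorem eq_of_mem_grade {f g : BarModule A →ₗ[K] M} {k : ℤ}
    (h : ∀ w, totalDegree w = k → f (word w) = g (word w)) {x : BarModule A}
    (hx : x ∈ grade A k) : f x = g x := by
  have : grade A k ≤ LinearMap.eqLocus f g :=
    Submodule.span_le.2 (by rintro _ ⟨w, hw, rfl⟩; exact h w hw)
  exact this hx

theorem cons_mem_grade {k l : ℤ} (n : ℕ) (a : A.obj n) {x : BarModule A} (hx : x ∈ grade A k)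
    (h : n - 1 + k = l) : cons n a x ∈ grade A l := by
  refine map_mem_of_mem_grade (fun w hw => ?_) hx
  have := word_mem_grade (⟨n, a⟩ :: w)
  rwa [totalDegree_cons, hw, h, ← cons_word] at this

theorem augHom_smul_mem_grade {k l : ℤ} (n : ℕ) (a : A.obj n) {x : BarModule A}
    (hx : x ∈ grade A k) (h : n + k = l) : augHom A n a • x ∈ grade A l := by
  cases n with
  | zero => rw [show l = k by simpa using h.symm]; exact Submodule.smul_mem _ _ hx
  | succ n => simp [augHom]

theorem vert_mem_grade (w : Word A) : vert w ∈ grade A (totalDegree w + 1) := by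
  induction w with
  | nil => simp [vert]
  | cons a w ih =>
    rw [vert, totalDegree_cons]
    refine add_mem ?_ (Submodule.smul_mem _ _ (cons_mem_grade _ _ ih (by ring)))
    convert word_mem_grade (⟨a.1 + 1, A.d rfl a.2⟩ :: w) using 2
    rw [totalDegree_cons]; push_cast; ring

theorem faces_mem_grade (w : Word A) : faces w ∈ grade A (totalDegree w + 1) := by
  induction w with
  | nil => simp [faces]
  | cons a w ih =>
    cases w with
    | nil =>
      rw [faces]
      exact Submodule.smul_mem _ _ (augHom_smul_mem_grade _ _ (word_mem_grade _)
        (by rw [totalDegree_cons]; ring))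
    | cons b w =>
      rw [faces]
      refine Submodule.smul_mem _ _ (add_mem ?_ (cons_mem_grade _ _ ih ?_))
      · convert word_mem_grade (⟨a.1 + b.1, A.mul rfl a.2 b.2⟩ :: w) using 2
        simp only [totalDegree_cons]; push_cast; ring
      · simp only [totalDegree_cons]; ring

theorem horiz_mem_grade (w : Word A) : horiz w ∈ grade A (totalDegree w + 1) := by
  refine add_mem ?_ (faces_mem_grade w)
  cases w with
  | nil => simp [face₀]
  | cons a w =>
    exact augHom_smul_mem_grade _ _ (word_mem_grade _) (by rw [totalDegree_cons]; ring)

theorem diff_mem_grade {k : ℤ} {x : BarModule A} (hx : x ∈ grade A k) :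
    diff x ∈ grade A (k + 1) := by
  refine map_mem_of_mem_grade (fun w hw => ?_) hx
  subst hw
  simpa [diff, vertDiff, horizDiff] using add_mem (vert_mem_grade w) (horiz_mem_grade w)

theorem shuffle_mem_grade (u v : Word A) :
    shuffle u v ∈ grade A (totalDegree u + totalDegree v) := by
  induction u generalizing v with
  | nil => rw [shuffle, totalDegree_nil, zero_add]; exact word_mem_grade v
  | cons a u ih =>
    induction v with
    | nil => rw [shuffle, totalDegree_nil, add_zero]; exact word_mem_grade _
    | cons b v ih' =>
      rw [shuffle]
      refine add_mem (cons_mem_grade _ _ (ih _) ?_)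
        (Submodule.smul_mem _ _ (cons_mem_grade _ _ ih' ?_)) <;>
      · simp only [totalDegree_cons]; ring

theorem shuffleMul_mem_grade {k l : ℤ} {x y : BarModule A} (hx : x ∈ grade A k)
    (hy : y ∈ grade A l) : shuffleMul x y ∈ grade A (k + l) := by
  refine map_mem_of_mem_grade (f := shuffleMul x) (fun v hv => ?_) hy
  refine map_mem_of_mem_grade (f := shuffleMul.flip (word v)) (fun u hu => ?_) hx
  subst hu hv
  simpa [shuffleMul, shuffleRight] using shuffle_mem_grade u v

/-- The letters count |a| + 1 in one exponent and |a| - 1 in the other. This connects the signs in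
`sgn` with the grading. -/
theorem neg_one_pow_parity (w : Word A) : (-1 : K) ^ parity w = (-1 : K) ^ totalDegree w := by
  induction w with
  | nil => simp [parity, totalDegree]
  | cons a w ih =>
    rw [parity_cons, pow_add, ih, totalDegree_cons, zpow_add₀ (by simp), pow_succ,
      zpow_sub₀ (by simp)]
    simp [div_eq_mul_inv]

theorem sgn_of_mem_grade {k : ℤ} {x : BarModule A} (hx : x ∈ grade A k) :
    sgn x = (-1 : K) ^ k • x :=
  eq_of_mem_grade (f := sgn) (g := (-1 : K) ^ k • LinearMap.id)
    (fun w hw => by simp [sgn_word, neg_one_pow_parity, hw]) hx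

theorem sgn_pow_of_mem_grade {k : ℤ} {x : BarModule A} (hx : x ∈ grade A k) (w : Word A) :
    (sgn ^ parity w) x = (-1 : K) ^ (k * totalDegree w) • x := by
  have hw := neg_one_pow_parity w
  rcases (parity w).even_or_odd with hn | hn
  · rw [sgn_pow_even hn, mul_comm, zpow_mul, ← hw, hn.neg_one_pow]
    simp
  · rw [sgn_pow_odd hn, sgn_of_mem_grade hx, mul_comm, zpow_mul, ← hw, hn.neg_one_pow]

theorem shuffleMul_comm {k l : ℤ} {x y : BarModule A} (hx : x ∈ grade A k) (hy : y ∈ grade A l) :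
    shuffleMul x y = (-1 : K) ^ (k * l) • shuffleMul y x := by
  refine eq_of_mem_grade (f := shuffleMul x) (g := (-1 : K) ^ (k * l) • shuffleMul.flip x)
    (fun v hv => ?_) hy
  simp [shuffleMul_word, sgn_pow_of_mem_grade hx, hv]

theorem diff_shuffleMul_of_mem_grade {k : ℤ} {x : BarModule A} (hx : x ∈ grade A k)
    (y : BarModule A) : diff (shuffleMul x y) =
      shuffleMul (diff x) y + (-1 : K) ^ k • shuffleMul x (diff y) := by
  rw [diff_shuffleMul, sgn_of_mem_grade hx, map_smul, LinearMap.smul_apply]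

theorem braiding_of_mem_grade {k l : ℤ} {x y : BarModule A} (hx : x ∈ grade A k)
    (hy : y ∈ grade A l) : braiding (x ⊗ₜ[K] y) = (-1 : K) ^ (k * l) • (y ⊗ₜ[K] x) := by
  refine eq_of_mem_grade (f := braiding ∘ₗ TensorProduct.mk K _ _ x)
    (g := (-1 : K) ^ (k * l) • (TensorProduct.mk K _ _).flip x) (fun v hv => ?_) hy
  simp [braiding_tmul_word, sgn_pow_of_mem_grade hx, hv]

theorem counitMap_of_mem_grade {k : ℤ} (hk : k ≠ 0) {x : BarModule A} (hx : x ∈ grade A k) :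
    counitMap x = 0 := by
  refine eq_of_mem_grade (g := 0) (fun w hw => ?_) hx
  cases w with
  | nil => exact absurd hw.symm (by simpa [totalDegree] using hk)
  | cons a w => simp [counitMap, counitWord]

theorem antipode_mem_grade {k : ℤ} {x : BarModule A} (hx : x ∈ grade A k) :
    antipode x ∈ grade A k := by
  refine map_mem_of_mem_grade (fun w hw => ?_) hx
  rw [antipode_word, ← hw]
  refine Submodule.smul_mem _ _ ?_
  convert word_mem_grade w.reverse using 2
  simp [totalDegree, List.sum_reverse]

/-- The elements of total degree `k` of the tensor square of the bar complex. -/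
noncomputable def tensorGrade (A : AugCDGA.{v, w} K) (k : ℤ) :
    Submodule K (BarModule A ⊗[K] BarModule A) :=
  ⨆ i : ℤ, LinearMap.range (TensorProduct.map (grade A i).subtype (grade A (k - i)).subtype)

theorem tmul_mem_tensorGrade {i j k : ℤ} (h : i + j = k) {x y : BarModule A} (hx : x ∈ grade A i)
    (hy : y ∈ grade A j) : x ⊗ₜ[K] y ∈ tensorGrade A k := by
  obtain rfl : j = k - i := by omega
  exact Submodule.mem_iSup_of_mem i ⟨⟨x, hx⟩ ⊗ₜ ⟨y, hy⟩, by simp⟩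

theorem rTensor_cons_mem_tensorGrade {k l : ℤ} (n : ℕ) (a : A.obj n)
    {t : BarModule A ⊗[K] BarModule A} (ht : t ∈ tensorGrade A k) (h : n - 1 + k = l) :
    (cons n a).rTensor (BarModule A) t ∈ tensorGrade A l := by
  have : tensorGrade A k ≤ (tensorGrade A l).comap ((cons n a).rTensor (BarModule A)) := by
    refine iSup_le fun i => ?_
    rintro _ ⟨s, rfl⟩
    induction s with
    | zero => simp
    | add s t hs ht => rw [map_add]; exact add_mem hs ht
    | tmul x y =>
      exact tmul_mem_tensorGrade (i := n - 1 + i) (j := k - i) (by omega)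
        (cons_mem_grade _ _ x.2 rfl) y.2
  exact this ht

theorem deconcatMap_mem_tensorGrade {k : ℤ} {x : BarModule A} (hx : x ∈ grade A k) :
    deconcatMap x ∈ tensorGrade A k := by
  refine map_mem_of_mem_grade (fun w hw => ?_) hx
  subst hw
  clear hx
  induction w with
  | nil =>
    rw [deconcatMap_nil, totalDegree_nil]
    have := word_mem_grade ([] : Word A)
    rw [totalDegree_nil] at this
    exact tmul_mem_tensorGrade (add_zero 0) this this
  | cons a w ih =>
    rw [← cons_word, deconcatMap_cons, cons_word]
    refine add_mem (tmul_mem_tensorGrade ?_ (word_mem_grade _) (word_mem_grade _))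
      (rTensor_cons_mem_tensorGrade _ _ ih (totalDegree_cons a w).symm)
    rw [totalDegree_nil, zero_add]

theorem totalDegree_append_cons (u v : Word A) (n : ℕ) (x : A.obj n) :
    totalDegree (u ++ ⟨n, x⟩ :: v) = totalDegree u + (n - 1 + totalDegree v) := by
  simp [totalDegree]; ring

/-- The projection to total degree `k`. -/
noncomputable def gradeProj (k : ℤ) : BarModule A →ₗ[K] BarModule A :=
  lift (fun w => if totalDegree w = k then word w else 0)
    { linear := fun u v n => by
        obtain ⟨ℓ, hℓ⟩ := compatible_word.linear u v n
        refine ⟨if totalDegree u + (n - 1 + totalDegree v) = k then ℓ else 0, fun x => ?_⟩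
        rw [totalDegree_append_cons]
        split_ifs <;> simp [hℓ]
      unit := fun u v => by simp [word_unit] }

theorem gradeProj_word (k : ℤ) (w : Word A) :
    gradeProj k (word w) = if totalDegree w = k then word w else 0 := by simp [gradeProj]

theorem gradeProj_of_mem {k : ℤ} {x : BarModule A} (hx : x ∈ grade A k) : gradeProj k x = x :=
  eq_of_mem_grade (g := LinearMap.id) (fun w hw => by simp [gradeProj_word, hw]) hx

theorem gradeProj_of_mem_of_ne {k l : ℤ} (h : k ≠ l) {x : BarModule A} (hx : x ∈ grade A k) :
    gradeProj l x = 0 :=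
  eq_of_mem_grade (g := 0) (fun w hw => by simp [gradeProj_word, hw, h]) hx

theorem gradeProj_mem (k : ℤ) (x : BarModule A) : gradeProj k x ∈ grade A k := by
  have : (grade A k).mkQ ∘ₗ gradeProj k = 0 := hom_ext fun w => by
    rw [LinearMap.comp_apply, gradeProj_word]
    split_ifs with h
    · subst h; simpa using word_mem_grade w
    · simp
  simpa using LinearMap.congr_fun this x

theorem diff_gradeProj (k : ℤ) (x : BarModule A) :
    diff (gradeProj k x) = gradeProj (k + 1) (diff x) := by
  refine LinearMap.congr_fun (f := diff ∘ₗ gradeProj k) (g := gradeProj (k + 1) ∘ₗ diff)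
    (hom_ext fun w => ?_) x
  have hw := diff_mem_grade (word_mem_grade w)
  rw [LinearMap.comp_apply, LinearMap.comp_apply, gradeProj_word]
  split_ifs with h
  · rw [← h, gradeProj_of_mem hw]
  · rw [gradeProj_of_mem_of_ne (by omega) hw, map_zero]

theorem isInternal_grade (A : AugCDGA.{v, w} K) : DirectSum.IsInternal (grade A) := by
  constructor
  · rw [injective_iff_map_eq_zero]
    intro z hz
    -- The projections recover the components of a sum, so the sum determines them.
    have key (k : ℤ) (z : DirectSum ℤ fun k => grade A k) :
        gradeProj k (DirectSum.coeAddMonoidHom (grade A) z) = z k := by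
      induction z using DirectSum.induction_on with
      | zero => simp
      | add x y hx hy => simp [hx, hy]
      | of i x =>
        rw [DirectSum.coeAddMonoidHom_of]
        by_cases h : i = k
        · subst h
          rw [gradeProj_of_mem x.2, DirectSum.of_eq_same]
        · rw [gradeProj_of_mem_of_ne h x.2, DirectSum.of_eq_of_ne _ _ _ (Ne.symm h)]
          rfl
    refine DFinsupp.ext fun k => Subtype.ext ?_
    rw [← key, hz, map_zero]
    rfl
  · intro x
    induction x using induction_word with
    | hw w => exact ⟨DirectSum.of (fun k => grade A k) _ ⟨word w, word_mem_grade w⟩, by simp⟩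
    | h₀ => exact ⟨0, map_zero _⟩
    | ha x y hx hy =>
      obtain ⟨x, rfl⟩ := hx
      obtain ⟨y, rfl⟩ := hy
      exact ⟨x + y, map_add _ _ _⟩
    | hs c x hx =>
      obtain ⟨x, rfl⟩ := hx
      exact ⟨c • x, map_smul (DirectSum.coeLinearMap (grade A)) c x⟩

end BarModule

open BarModule in
/-- The bar complex of an augmented CDGA is a graded-commutative differential graded Hopf
algebra. -/
theorem isDGHopf_bar (A : AugCDGA.{v, w} K) : A.bar.IsDGHopf where
  isInternal := isInternal_grade A
  d_mem _ _ hx := diff_mem_grade hx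
  d_d := diff_diff
  one_mem := by
    have := word_mem_grade ([] : Word A)
    rwa [totalDegree_nil] at this
  mul_mem _ _ _ hx _ hy := shuffleMul_mem_grade hx hy
  one_mul := shuffleMul_nil_left
  mul_one := shuffleMul_nil_right
  mul_assoc := shuffleMul_assoc
  mul_comm _ _ _ hx _ hy := shuffleMul_comm hx hy
  leibniz _ _ hx := diff_shuffleMul_of_mem_grade hx
  counit_eq_zero _ hi _ hx := counitMap_of_mem_grade hi hx
  comul_mem _ _ hx := deconcatMap_mem_tensorGrade hx
  coassoc := deconcatMap_coassoc
  counit_comul := rTensor_counitMap_deconcatMap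
  comul_counit := lTensor_counitMap_deconcatMap
  counit_d := counitMap_diff
  comul_d := ⟨sgn, fun _ _ hx => sgn_of_mem_grade hx, deconcatMap_diff⟩
  comul_one := deconcatMap_nil
  comul_mul := ⟨braiding, fun _ _ _ hx _ hy => braiding_of_mem_grade hx hy,
    deconcatMap_shuffleMul⟩
  counit_one := counitMap_nil
  counit_mul := counitMap_shuffleMul
  antipode := ⟨antipode, fun _ _ hx => antipode_mem_grade hx, antipode_diff,
    LinearMap.congr_fun convolution_antipode_left,
    LinearMap.congr_fun convolution_antipode_right⟩

end AugCDGA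

/-! ### Homotopy inverses of quasi-isomorphisms over a field. -/

/-- A section over the range, extended linearly to the whole space. Applied to the differentials, it
splits a complex into its cohomology and an acyclic part. -/
theorem LinearMap.exists_comp_comp_eq {K V W : Type*} [Field K] [AddCommGroup V] [Module K V]
    [AddCommGroup W] [Module K W] (φ : V →ₗ[K] W) : ∃ σ : W →ₗ[K] V, ∀ x, φ (σ (φ x)) = φ x := by
  obtain ⟨r, hr⟩ := φ.rangeRestrict.exists_rightInverse_of_surjective
    (LinearMap.range_eq_top.2 φ.surjective_rangeRestrict)
  obtain ⟨σ, hσ⟩ := LinearMap.exists_extend r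
  refine ⟨σ, fun x => ?_⟩
  have h₁ : σ (φ x) = r (φ.rangeRestrict x) := LinearMap.congr_fun hσ (φ.rangeRestrict x)
  have h₂ := LinearMap.congr_fun hr (φ.rangeRestrict x)
  rw [h₁]
  exact congrArg Subtype.val h₂

namespace CDGA

variable {K : Type v} [Field K]

/-- The composition of a map of degree `-1` with the differential. -/
def dComp (A : CDGA.{v, w} K) (h : ∀ n, A.obj (n + 1) →ₗ[K] A.obj n) :
    ∀ n, A.obj n →ₗ[K] A.obj n
  | 0 => 0
  | n + 1 => A.d rfl ∘ₗ h n

theorem d_dComp (A : CDGA.{v, w} K) (h : ∀ n, A.obj (n + 1) →ₗ[K] A.obj n) {n m : ℕ}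
    (hn : n + 1 = m) (x : A.obj n) : A.d hn (A.dComp h n x) = 0 := by
  cases n with
  | zero => simp [dComp]
  | succ n => exact A.d_d _ _ _

theorem dComp_mem_coboundaries (A : CDGA.{v, w} K) (h : ∀ n, A.obj (n + 1) →ₗ[K] A.obj n) (n : ℕ)
    (x : A.obj n) : A.dComp h n x ∈ A.coboundaries n := by
  cases n with
  | zero => exact zero_mem _
  | succ n => exact Or.inl ⟨n, rfl, h n x, rfl⟩

/-- A morphism of CDGAs that is a homotopy equivalence of the underlying complexes. -/
structure Hom.HomotopyInverse {A B : CDGA.{v, w} K} (f : Hom A B) where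
  inv : ∀ n, B.obj n →ₗ[K] A.obj n
  inv_d : ∀ n (x : B.obj n), inv (n + 1) (B.d rfl x) = A.d rfl (inv n x)
  left : ∀ n, A.obj (n + 1) →ₗ[K] A.obj n
  left_eq : ∀ n (x : A.obj n),
    inv n (f.toFun n x) = x + A.dComp left n x + left n (A.d rfl x)
  right : ∀ n, B.obj (n + 1) →ₗ[K] B.obj n
  right_eq : ∀ n (x : B.obj n),
    f.toFun n (inv n x) = x + B.dComp right n x + right n (B.d rfl x)

/-- Over a field, a quasi-isomorphism is a homotopy equivalence of complexes. -/
theorem Hom.IsQuasiIso.nonempty_homotopyInverse {A B : CDGA.{v, w} K} {f : Hom A B}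
    (hf : f.IsQuasiIso) : Nonempty f.HomotopyInverse := by
  have hσ (C : CDGA.{v, w} K) : ∃ σ : ∀ n, C.obj (n + 1) →ₗ[K] C.obj n, ∀ n (x : C.obj n),
      C.d rfl (σ n (C.d rfl x)) = C.d (rfl : n + 1 = n + 1) x :=
    ⟨fun n => (C.d rfl).exists_comp_comp_eq.choose,
      fun n => (C.d rfl).exists_comp_comp_eq.choose_spec⟩
  have hs (n : ℕ) : ∃ s : A.Cohomology n →ₗ[K] A.cocycles n,
      ∀ c, Submodule.Quotient.mk (s c) = c := by
    obtain ⟨s, hs⟩ := (((A.coboundaries n).comap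
      (A.cocycles n).subtype).mkQ).exists_rightInverse_of_surjective (Submodule.range_mkQ _)
    exact ⟨s, LinearMap.congr_fun hs⟩
  have hcob (C : CDGA.{v, w} K) (σ : ∀ n, C.obj (n + 1) →ₗ[K] C.obj n)
      (h : ∀ n (x : C.obj n), C.d rfl (σ n (C.d rfl x)) = C.d (rfl : n + 1 = n + 1) x) (n : ℕ)
      (x : C.obj n) (hx : x ∈ C.coboundaries n) : C.dComp σ n x = x := by
    rcases hx with ⟨m, rfl, y, rfl⟩ | hx
    · exact h m y
    · rw [show x = 0 from hx, map_zero]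
  choose s hs using hs
  obtain ⟨σ, hσA⟩ := hσ A
  obtain ⟨τ, hτB⟩ := hσ B
  -- By dσd = d, the map p = 1 - dσ - σd takes values in cocycles and kills coboundaries, and it is
  -- homotopic to the identity; q is its analogue for B.
  let p n : A.obj n →ₗ[K] A.obj n := LinearMap.id - A.dComp σ n - σ n ∘ₗ A.d rfl
  let q n : B.obj n →ₗ[K] B.obj n := LinearMap.id - B.dComp τ n - τ n ∘ₗ B.d rfl
  have hp n (x : A.obj n) : A.d (rfl : n + 1 = n + 1) (p n x) = 0 := by
    simp [p, d_dComp, hσA]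
  have hq n (x : B.obj n) : q n x ∈ B.cocycles n := by
    change B.d (rfl : n + 1 = n + 1) (q n x) = 0
    simp [q, d_dComp, hτB]
  have hpd n (x : A.obj n) : p (n + 1) (A.d rfl x) = 0 := by
    simp [p, dComp, hσA, A.d_d]
  have hqd n (x : B.obj n) : q (n + 1) (B.d rfl x) = 0 := by
    simp [q, dComp, hτB, B.d_d]
  let e n : A.Cohomology n ≃ₗ[K] B.Cohomology n := LinearEquiv.ofBijective _ (hf n)
  -- The composite B → Z(B) → H(B) ≅ H(A) → Z(A). It takes values in cocycles and kills
  -- coboundaries, so it commutes with the differentials trivially.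
  let g n : B.obj n →ₗ[K] A.obj n := (A.cocycles n).subtype ∘ₗ s n ∘ₗ (e n).symm.toLinearMap ∘ₗ
    Submodule.mkQ _ ∘ₗ (q n).codRestrict _ (hq n)
  have hdg n (x : B.obj n) : A.d (rfl : n + 1 = n + 1) (g n x) = 0 := A.d_eq_zero rfl (s n _)
  have hgd n (x : B.obj n) : g (n + 1) (B.d rfl x) = 0 := by
    have : (q (n + 1)).codRestrict _ (hq (n + 1)) (B.d rfl x) = 0 := Subtype.ext (hqd n x)
    simp only [g, LinearMap.comp_apply, this, map_zero]
  have hgdComp h n (x : B.obj n) : g n (B.dComp h n x) = 0 := by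
    cases n with
    | zero => simp [dComp]
    | succ n => exact hgd n _
  have hfg n (x : B.obj n) : f.toFun n (g n x) - q n x ∈ B.coboundaries n := by
    have h₁ : f.cohomologyMap n (Submodule.Quotient.mk
        (s n ((e n).symm (Submodule.Quotient.mk ⟨q n x, hq n x⟩)))) =
          Submodule.Quotient.mk ⟨q n x, hq n x⟩ := by
      rw [hs]
      exact (e n).apply_symm_apply _
    have h₂ := (Submodule.Quotient.eq _).1 h₁
    exact h₂
  have hgf n (x : A.obj n) (hx : A.d (rfl : n + 1 = n + 1) x = 0) :
      g n (f.toFun n x) - x ∈ A.coboundaries n := by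
    have h₁ : (Submodule.Quotient.mk ⟨q n (f.toFun n x), hq n _⟩ : B.Cohomology n) =
        e n (Submodule.Quotient.mk ⟨x, hx⟩) := by
      refine (Submodule.Quotient.eq _).2 ?_
      change q n (f.toFun n x) - f.toFun n x ∈ B.coboundaries n
      have : q n (f.toFun n x) - f.toFun n x = -B.dComp τ n (f.toFun n x) := by
        simp [q, ← f.map_d, hx]
      rw [this]
      exact neg_mem (dComp_mem_coboundaries _ _ _ _)
    have h₂ : (Submodule.Quotient.mk (s n ((e n).symm
        (Submodule.Quotient.mk ⟨q n (f.toFun n x), hq n _⟩))) : A.Cohomology n) =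
          Submodule.Quotient.mk ⟨x, hx⟩ := by
      rw [hs, h₁, (e n).symm_apply_apply]
    have h₃ := (Submodule.Quotient.eq _).1 h₂
    exact h₃
  -- Inserting 1 = p + dσ + σd gives gf - 1 = (gf - 1)p + gfσd - dσ - σd. The first term is a
  -- coboundary, hence equals dσ(gf - 1)p, and the homotopy can be read off; on B the same is done
  -- with fg - q.
  refine ⟨⟨g, fun n x => by rw [hdg, hgd],
    fun n => g n ∘ₗ f.toFun n ∘ₗ σ n + σ n ∘ₗ (g (n + 1) ∘ₗ f.toFun (n + 1) ∘ₗ p (n + 1) -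
      p (n + 1)) - σ n, fun n x => ?_,
    fun n => τ n ∘ₗ (f.toFun (n + 1) ∘ₗ g (n + 1) - q (n + 1)) - τ n, fun n x => ?_⟩⟩
  · have h₁ := hcob A σ hσA n _ (hgf n (p n x) (hp n x))
    have h₂ : A.dComp (fun n => g n ∘ₗ f.toFun n ∘ₗ σ n + σ n ∘ₗ (g (n + 1) ∘ₗ f.toFun (n + 1) ∘ₗ
        p (n + 1) - p (n + 1)) - σ n) n x = g n (f.toFun n (p n x)) - p n x - A.dComp σ n x := by
      rw [← h₁]
      cases n with
      | zero => simp [dComp]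
      | succ n => simp [dComp, hdg]
    have h₃ : g n (f.toFun n (A.dComp σ n x)) = 0 := by
      cases n with
      | zero => simp [dComp]
      | succ n => simp [dComp, f.map_d, hgd]
    rw [h₂]
    simp only [LinearMap.sub_apply, LinearMap.add_apply, LinearMap.comp_apply, hpd, map_zero,
      sub_zero]
    simp only [p, LinearMap.sub_apply, LinearMap.id_apply, LinearMap.comp_apply, map_sub, h₃]
    abel
  · have h₁ := hcob B τ hτB n _ (hfg n x)
    have h₂ : B.dComp (fun n => τ n ∘ₗ (f.toFun (n + 1) ∘ₗ g (n + 1) - q (n + 1)) - τ n) n x =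
        f.toFun n (g n x) - q n x - B.dComp τ n x := by
      rw [← h₁]
      cases n with
      | zero => simp [dComp]
      | succ n => simp [dComp]
    rw [h₂]
    simp only [LinearMap.sub_apply, LinearMap.comp_apply, hqd, hgd, map_zero, sub_zero]
    simp only [q, LinearMap.sub_apply, LinearMap.id_apply, LinearMap.comp_apply]
    abel

/-- Both homotopy terms vanish at the unit. This lets the inverse act letterwise on the normalized
bar complex although it is not multiplicative. -/
theorem Hom.HomotopyInverse.inv_one {A B : CDGA.{v, w} K} {f : Hom A B} (H : f.HomotopyInverse) :
    H.inv 0 B.one = A.one := by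
  have := H.left_eq 0 A.one
  rw [f.map_one, A.d_one, map_zero] at this
  simpa [dComp] using this

end CDGA

/-! ### Letterwise maps and homotopies for the vertical differential. -/

namespace AugCDGA

variable {K : Type v} [Field K]

namespace BarModule

variable {A B C : AugCDGA.{v, w} K} {M : Type*} [AddCommGroup M] [Module K M]

/-- The map of bar complexes given by a graded linear map that preserves the unit. -/
noncomputable def mapLetters (g : ∀ n, A.obj n →ₗ[K] B.obj n) (hg : g 0 A.one = B.one) :
    BarModule A →ₗ[K] BarModule B :=
  lift (fun w => word (w.map fun a => ⟨a.1, g a.1 a.2⟩))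
    { linear := fun u v n => by
        let k : (Σ n, A.obj n) → Σ n, B.obj n := fun a => ⟨a.1, g a.1 a.2⟩
        obtain ⟨ℓ, hℓ⟩ := compatible_word.linear (u.map k) (v.map k) n
        refine ⟨ℓ ∘ₗ g n, fun x => ?_⟩
        change _ = ℓ (g n x)
        simpa [k] using hℓ (g n x)
      unit := fun u v => by
        simp only [List.map_append, List.map_cons]
        rw [hg]
        exact word_unit _ _ }

theorem mapLetters_word (g : ∀ n, A.obj n →ₗ[K] B.obj n) (hg : g 0 A.one = B.one) (w : Word A) :
    mapLetters g hg (word w) = word (w.map fun a => ⟨a.1, g a.1 a.2⟩) := by simp [mapLetters]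

@[simp] theorem mapLetters_nil (g : ∀ n, A.obj n →ₗ[K] B.obj n) (hg : g 0 A.one = B.one) :
    mapLetters g hg (word []) = word [] := by simp [mapLetters_word]

theorem mapLetters_cons (g : ∀ n, A.obj n →ₗ[K] B.obj n) (hg : g 0 A.one = B.one) (n : ℕ)
    (a : A.obj n) (x : BarModule A) :
    mapLetters g hg (cons n a x) = cons n (g n a) (mapLetters g hg x) := by
  refine LinearMap.congr_fun (f := mapLetters g hg ∘ₗ cons n a)
    (g := cons n (g n a) ∘ₗ mapLetters g hg) (hom_ext fun w => ?_) x
  simp [mapLetters_word]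

theorem mapLetters_vertDiff (g : ∀ n, A.obj n →ₗ[K] B.obj n) (hg : g 0 A.one = B.one)
    (hd : ∀ n (x : A.obj n), g (n + 1) (A.d rfl x) = B.d rfl (g n x)) (x : BarModule A) :
    mapLetters g hg (vertDiff x) = vertDiff (mapLetters g hg x) := by
  refine LinearMap.congr_fun (f := mapLetters g hg ∘ₗ vertDiff)
    (g := vertDiff ∘ₗ mapLetters g hg) (hom_ext_cons (by simp) ?_) x
  intro n a _ x hx
  simp only [LinearMap.comp_apply] at hx ⊢
  simp only [mapLetters_cons, vertDiff_cons rfl, map_add, map_smul, hx, hd]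

theorem mapLetters_comp (g : ∀ n, A.obj n →ₗ[K] B.obj n) (hg : g 0 A.one = B.one)
    (g' : ∀ n, B.obj n →ₗ[K] C.obj n) (hg' : g' 0 B.one = C.one) (x : BarModule A) :
    mapLetters g' hg' (mapLetters g hg x) =
      mapLetters (fun n => g' n ∘ₗ g n) (by simp [hg, hg']) x := by
  refine LinearMap.congr_fun (f := mapLetters g' hg' ∘ₗ mapLetters g hg) (hom_ext fun w => ?_) x
  simp [mapLetters_word, Function.comp_def]

/-- Putting the image of a letter under a map of degree `-1` in front of a word. -/
noncomputable def consLower (h : ∀ n, A.obj (n + 1) →ₗ[K] A.obj n) :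
    ∀ n, A.obj n →ₗ[K] BarModule A →ₗ[K] BarModule A
  | 0 => 0
  | n + 1 => cons n ∘ₗ h n

/-- The homotopy on the bar complex, for the vertical differential, given by a homotopy `h` from
the identity to `g`:
`[a_1 | ⋯ | a_p] ↦ ∑ (-1)^{ε(i-1)} [a_1 | ⋯ | a_{i-1} | h a_i | g a_{i+1} | ⋯ | g a_p]`. -/
noncomputable def homotopyWord (g : ∀ n, A.obj n →ₗ[K] A.obj n) (hg : g 0 A.one = A.one)
    (h : ∀ n, A.obj (n + 1) →ₗ[K] A.obj n) : Word A → BarModule A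
  | [] => 0
  | a :: w => consLower h a.1 a.2 (mapLetters g hg (word w)) +
      (-1 : K) ^ (a.1 + 1) • cons a.1 a.2 (homotopyWord g hg h w)

/-- The homotopy descends to the normalized complex: a map of degree -1 kills the letter 1, and g
fixes it. -/
theorem compatible_homotopyWord (g : ∀ n, A.obj n →ₗ[K] A.obj n) (hg : g 0 A.one = A.one)
    (h : ∀ n, A.obj (n + 1) →ₗ[K] A.obj n) : Compatible (homotopyWord g hg h) where
  linear u v n := by
    induction u with
    | nil =>
      refine ⟨(consLower h n).flip (mapLetters g hg (word v)) +
        (-1 : K) ^ (n + 1) • (cons n).flip (homotopyWord g hg h v), fun x => ?_⟩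
      simp [homotopyWord]
    | cons a u ih =>
      obtain ⟨ℓ, hℓ⟩ := ih
      obtain ⟨ℓ', hℓ'⟩ := compatible_word.linear u v n
      refine ⟨consLower h a.1 a.2 ∘ₗ mapLetters g hg ∘ₗ ℓ' +
        (-1 : K) ^ (a.1 + 1) • (cons a.1 a.2 ∘ₗ ℓ), fun x => ?_⟩
      simp [homotopyWord, hℓ, hℓ']
  unit u v := by
    induction u with
    | nil => simp [homotopyWord, cons_one, consLower]
    | cons a u ih => simp [homotopyWord, ih, word_unit]

noncomputable def homotopy (g : ∀ n, A.obj n →ₗ[K] A.obj n) (hg : g 0 A.one = A.one)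
    (h : ∀ n, A.obj (n + 1) →ₗ[K] A.obj n) : BarModule A →ₗ[K] BarModule A :=
  lift (homotopyWord g hg h) (compatible_homotopyWord g hg h)

theorem homotopy_cons (g : ∀ n, A.obj n →ₗ[K] A.obj n) (hg : g 0 A.one = A.one)
    (h : ∀ n, A.obj (n + 1) →ₗ[K] A.obj n) (n : ℕ) (a : A.obj n) (x : BarModule A) :
    homotopy g hg h (cons n a x) = consLower h n a (mapLetters g hg x) +
      (-1 : K) ^ (n + 1) • cons n a (homotopy g hg h x) := by
  refine LinearMap.congr_fun (f := homotopy g hg h ∘ₗ cons n a)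
    (g := consLower h n a ∘ₗ mapLetters g hg + (-1 : K) ^ (n + 1) • cons n a ∘ₗ homotopy g hg h)
    (hom_ext fun w => ?_) x
  simp [homotopy, homotopyWord]

/-- The usual homotopy between the identity and g ⊗ ⋯ ⊗ g, changing one letter at a time: [ga|gx] is
compared with [a|gx] through h, and [a|gx] with [a|x] by induction. Multiplicativity of g is not
required because the vertical differential does not multiply letters. -/
theorem vertDiff_homotopy (g : ∀ n, A.obj n →ₗ[K] A.obj n) (hg : g 0 A.one = A.one)
    (hd : ∀ n (x : A.obj n), g (n + 1) (A.d rfl x) = A.d rfl (g n x))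
    (h : ∀ n, A.obj (n + 1) →ₗ[K] A.obj n)
    (hh : ∀ n (x : A.obj n), g n x = x + A.dComp h n x + h n (A.d rfl x)) (x : BarModule A) :
    mapLetters g hg x = x + vertDiff (homotopy g hg h x) + homotopy g hg h (vertDiff x) := by
  refine LinearMap.congr_fun (f := mapLetters g hg)
    (g := LinearMap.id + vertDiff ∘ₗ homotopy g hg h + homotopy g hg h ∘ₗ vertDiff)
    (hom_ext_cons (by simp [homotopy, homotopyWord]) ?_) x
  intro n a _ x hx
  simp only [LinearMap.comp_apply, LinearMap.add_apply, LinearMap.id_apply] at hx ⊢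
  have key : vertDiff (consLower h n a (mapLetters g hg x)) =
      cons n (A.dComp h n a) (mapLetters g hg x) +
        (-1 : K) ^ n • consLower h n a (vertDiff (mapLetters g hg x)) := by
    cases n with
    | zero => simp [consLower, CDGA.dComp]
    | succ n => simp [consLower, CDGA.dComp, vertDiff_cons rfl]
  have key' (y : BarModule A) : consLower h (n + 1) (A.d rfl a) y = cons n (h n (A.d rfl a)) y :=
    rfl
  have hcons : cons n a (mapLetters g hg x) = cons n a x + cons n a (vertDiff (homotopy g hg h x)) +
      cons n a (homotopy g hg h (vertDiff x)) := by
    conv_lhs => rw [hx]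
    simp only [map_add]
  simp only [mapLetters_cons, hh, homotopy_cons, map_add, key, vertDiff_cons rfl, map_smul, key',
    LinearMap.add_apply, hcons, mapLetters_vertDiff g hg hd]
  rcases n.even_or_odd with hn | hn <;>
  · simp only [pow_succ, hn.neg_one_pow, smul_add, mul_neg, mul_one, neg_smul, one_smul, neg_neg]
    abel

end BarModule
end AugCDGA

/-! ### The word length filtration and the invariance of the bar complex under quasi-isomorphisms.
-/

namespace AugCDGA

variable {K : Type v} [Field K]

namespace BarModule

variable {A B : AugCDGA.{v, w} K} {M : Type*} [AddCommGroup M] [Module K M]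

/-- The projection to words of length `p`. -/
noncomputable def lengthProj (p : ℕ) : BarModule A →ₗ[K] BarModule A :=
  lift (fun w => if w.length = p then word w else 0)
    { linear := fun u v n => by
        obtain ⟨ℓ, hℓ⟩ := compatible_word.linear u v n
        refine ⟨if (u.length + (v.length + 1)) = p then ℓ else 0, fun x => ?_⟩
        simp only [List.length_append, List.length_cons]
        split_ifs <;> simp [hℓ]
      unit := fun u v => by simp [word_unit] }

theorem lengthProj_word (p : ℕ) (w : Word A) :
    lengthProj p (word w) = if w.length = p then word w else 0 := by simp [lengthProj]

theorem lengthProj_succ_cons (p n : ℕ) (a : A.obj n) (x : BarModule A) :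
    lengthProj (p + 1) (cons n a x) = cons n a (lengthProj p x) := by
  refine LinearMap.congr_fun (f := lengthProj (p + 1) ∘ₗ cons n a)
    (g := cons n a ∘ₗ lengthProj p) (hom_ext fun w => ?_) x
  simp only [LinearMap.comp_apply, cons_word, lengthProj_word, List.length_cons,
    Nat.add_right_cancel_iff]
  split_ifs <;> simp

theorem lengthProj_zero_cons (n : ℕ) (a : A.obj n) (x : BarModule A) :
    lengthProj 0 (cons n a x) = 0 := by
  refine LinearMap.congr_fun (f := lengthProj 0 ∘ₗ cons n a) (g := 0) (hom_ext fun w => ?_) x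
  simp [lengthProj_word]

theorem lengthProj_vertDiff (p : ℕ) (x : BarModule A) :
    lengthProj p (vertDiff x) = vertDiff (lengthProj p x) := by
  refine LinearMap.congr_fun (f := lengthProj p ∘ₗ vertDiff)
    (g := vertDiff ∘ₗ lengthProj p) ?_ x
  induction p with
  | zero =>
    refine hom_ext_cons (by simp [lengthProj_word]) fun n a _ x hx => ?_
    simp only [LinearMap.comp_apply, vertDiff_cons rfl, map_add, lengthProj_zero_cons, map_smul,
      map_zero, smul_zero, add_zero]
  | succ p ih =>
    refine hom_ext_cons (by simp [lengthProj_word]) fun n a _ x hx => ?_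
    have := LinearMap.congr_fun ih x
    simp only [LinearMap.comp_apply] at this
    simp only [LinearMap.comp_apply, vertDiff_cons rfl, map_add, lengthProj_succ_cons, map_smul,
      this]

theorem mapLetters_lengthProj (g : ∀ n, A.obj n →ₗ[K] B.obj n) (hg : g 0 A.one = B.one) (p : ℕ)
    (x : BarModule A) : mapLetters g hg (lengthProj p x) = lengthProj p (mapLetters g hg x) := by
  refine LinearMap.congr_fun (f := mapLetters g hg ∘ₗ lengthProj p)
    (g := lengthProj p ∘ₗ mapLetters g hg) (hom_ext fun w => ?_) x
  simp only [LinearMap.comp_apply, lengthProj_word, mapLetters_word, List.length_map]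
  split_ifs <;> simp [mapLetters_word]

theorem lengthProj_lengthProj (p : ℕ) (x : BarModule A) :
    lengthProj p (lengthProj p x) = lengthProj p x := by
  refine LinearMap.congr_fun (f := lengthProj p ∘ₗ lengthProj p) (hom_ext fun w => ?_) x
  simp only [LinearMap.comp_apply, lengthProj_word]
  split_ifs with h
  · simp [lengthProj_word, h]
  · simp

/-- The filtration of the bar complex by word length: words of length less than `p`. -/
noncomputable def filtration (A : AugCDGA.{v, w} K) (p : ℕ) : Submodule K (BarModule A) :=
  Submodule.span K {x | ∃ w : Word A, w.length < p ∧ word w = x}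

theorem word_mem_filtration {w : Word A} {p : ℕ} (h : w.length < p) : word w ∈ filtration A p :=
  Submodule.subset_span ⟨w, h, rfl⟩

theorem map_mem_of_mem_filtration {f : BarModule A →ₗ[K] M} {N : Submodule K M} {p : ℕ}
    (h : ∀ w : Word A, w.length < p → f (word w) ∈ N) {x : BarModule A}
    (hx : x ∈ filtration A p) : f x ∈ N := by
  have : filtration A p ≤ N.comap f := Submodule.span_le.2 (by rintro _ ⟨w, hw, rfl⟩; exact h w hw)
  exact this hx

theorem cons_mem_filtration {p : ℕ} (n : ℕ) (a : A.obj n) {x : BarModule A}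
    (hx : x ∈ filtration A p) : cons n a x ∈ filtration A (p + 1) :=
  map_mem_of_mem_filtration (fun w hw => by
    rw [cons_word]; exact word_mem_filtration (by simpa using hw)) hx

theorem filtration_mono {p q : ℕ} (h : p ≤ q) : filtration A p ≤ filtration A q :=
  Submodule.span_mono (by rintro _ ⟨w, hw, rfl⟩; exact ⟨w, hw.trans_le h, rfl⟩)

theorem exists_mem_filtration (x : BarModule A) : ∃ p, x ∈ filtration A p := by
  induction x using induction_word with
  | hw w => exact ⟨_, word_mem_filtration (Nat.lt_succ_self _)⟩
  | h₀ => exact ⟨0, zero_mem _⟩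
  | ha x y hx hy =>
    obtain ⟨p, hp⟩ := hx
    obtain ⟨q, hq⟩ := hy
    exact ⟨max p q, add_mem (filtration_mono (le_max_left _ _) hp)
      (filtration_mono (le_max_right _ _) hq)⟩
  | hs c x hx =>
    obtain ⟨p, hp⟩ := hx
    exact ⟨p, Submodule.smul_mem _ _ hp⟩

theorem eq_zero_of_mem_filtration_zero {x : BarModule A} (hx : x ∈ filtration A 0) : x = 0 := by
  simpa [filtration] using hx

theorem sub_lengthProj_mem_filtration {p : ℕ} {x : BarModule A} (hx : x ∈ filtration A (p + 1)) :
    x - lengthProj p x ∈ filtration A p := by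
  refine map_mem_of_mem_filtration (f := LinearMap.id - lengthProj p) (fun w hw => ?_) hx
  rw [LinearMap.sub_apply, LinearMap.id_apply, lengthProj_word]
  split_ifs with h
  · simp
  · rw [sub_zero]; exact word_mem_filtration (by omega)

theorem lengthProj_mem_filtration (p : ℕ) (x : BarModule A) :
    lengthProj p x ∈ filtration A (p + 1) := by
  induction x using induction_word with
  | hw w =>
    rw [lengthProj_word]
    split_ifs with h
    · exact word_mem_filtration (by omega)
    · exact zero_mem _
  | h₀ => simp
  | ha x y hx hy => rw [map_add]; exact add_mem hx hy
  | hs c x hx => rw [map_smul]; exact Submodule.smul_mem _ _ hx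

theorem lengthProj_of_mem_filtration {p : ℕ} {x : BarModule A} (hx : x ∈ filtration A p) :
    lengthProj p x = 0 := by
  refine (Submodule.mem_bot K).1 (map_mem_of_mem_filtration (fun w hw => ?_) hx)
  rw [lengthProj_word, if_neg hw.ne]
  exact zero_mem _

theorem faces_mem_filtration (w : Word A) : faces w ∈ filtration A w.length := by
  induction w with
  | nil => simp [faces]
  | cons a w ih =>
    cases w with
    | nil =>
      exact Submodule.smul_mem _ _ (Submodule.smul_mem _ _ (word_mem_filtration (by simp)))
    | cons b w =>
      exact Submodule.smul_mem _ _ (add_mem (word_mem_filtration (by simp))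
        (cons_mem_filtration _ _ ih))

/-- Every face removes one letter, so the vertical differential is the leading part of the total
one. -/
theorem horizDiff_mem_filtration {p : ℕ} {x : BarModule A} (hx : x ∈ filtration A (p + 1)) :
    horizDiff x ∈ filtration A p := by
  refine map_mem_of_mem_filtration (fun w hw => ?_) hx
  simp only [horizDiff, lift_word, horiz]
  refine filtration_mono (Nat.le_of_lt_succ hw) (add_mem ?_ (faces_mem_filtration w))
  cases w with
  | nil => simp [face₀]
  | cons a w => exact Submodule.smul_mem _ _ (word_mem_filtration (by simp))

/-- The map of bar complexes induced by a morphism. -/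
noncomputable def map (f : Hom A B) : BarModule A →ₗ[K] BarModule B := mapLetters f.toFun f.map_one

theorem augHom_map (f : Hom A B) (n : ℕ) (a : A.obj n) :
    augHom B n (f.toFun n a) = augHom A n a := by
  cases n with
  | zero => exact f.aug_map a
  | succ n => rfl

@[simp] theorem map_nil (f : Hom A B) : map f (word []) = word [] := mapLetters_nil _ _

theorem map_cons (f : Hom A B) (n : ℕ) (a : A.obj n) (x : BarModule A) :
    map f (cons n a x) = cons n (f.toFun n a) (map f x) := mapLetters_cons _ _ _ _ _

theorem map_mulHead (f : Hom A B) (n : ℕ) (a : A.obj n) (x : BarModule A) :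
    map f (mulHead n a x) = mulHead n (f.toFun n a) (map f x) := by
  refine LinearMap.congr_fun (f := map f ∘ₗ mulHead n a)
    (g := mulHead n (f.toFun n a) ∘ₗ map f) (hom_ext_cons (by simp) ?_) x
  intro m b hb x _
  have hb' : augHom B m (f.toFun m b) = 0 := by rw [augHom_map, hb]
  simp only [LinearMap.comp_apply, mulHead_cons rfl _ _ hb, map_cons, mulHead_cons rfl _ _ hb',
    f.map_mul]

theorem map_diff (f : Hom A B) (x : BarModule A) : map f (diff x) = diff (map f x) := by
  refine LinearMap.congr_fun (f := map f ∘ₗ diff) (g := diff ∘ₗ map f) (hom_ext_cons (by simp) ?_) x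
  intro n a ha x hx
  have ha' : augHom B n (f.toFun n a) = 0 := by rw [augHom_map, ha]
  simp only [LinearMap.comp_apply] at hx ⊢
  simp only [diff_cons rfl _ ha, _root_.map_add, _root_.map_smul, map_cons, map_mulHead,
    diff_cons rfl _ ha', f.map_d, hx]

theorem map_sgn (f : Hom A B) (x : BarModule A) : map f (sgn x) = sgn (map f x) := by
  refine LinearMap.congr_fun (f := map f ∘ₗ sgn) (g := sgn ∘ₗ map f) (hom_ext_cons (by simp) ?_) x
  intro n a _ x hx
  simp only [LinearMap.comp_apply] at hx ⊢
  simp [sgn_cons, map_cons, hx]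

theorem map_sgn_pow (f : Hom A B) (n : ℕ) (x : BarModule A) :
    map f ((sgn ^ n) x) = (sgn ^ n) (map f x) := by
  rcases n.even_or_odd with hn | hn
  · simp [sgn_pow_even hn]
  · simp [sgn_pow_odd hn, map_sgn]

theorem map_shuffleMul (f : Hom A B) (x y : BarModule A) :
    map f (shuffleMul x y) = shuffleMul (map f x) (map f y) := by
  refine hom_ext₂_cons (f := shuffleMul.compr₂ (map f))
    (g := shuffleMul.compl₁₂ (map f) (map f)) (by simp) (by simp) ?_ x y
  intro n a m b _ _ x y h₁ h₂
  simp only [LinearMap.compr₂_apply, LinearMap.compl₁₂_apply] at h₁ h₂ ⊢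
  rw [shuffleMul_cons_cons, _root_.map_add, map_cons, h₁, map_cons, map_cons _ m, h₂, map_sgn_pow, map_cons,
    shuffleMul_cons_cons]

theorem map_deconcatMap (f : Hom A B) (x : BarModule A) :
    TensorProduct.map (map f) (map f) (deconcatMap x) = deconcatMap (map f x) := by
  refine LinearMap.congr_fun (f := TensorProduct.map (map f) (map f) ∘ₗ deconcatMap)
    (g := deconcatMap ∘ₗ map f) (hom_ext_cons (by simp) ?_) x
  intro n a _ x hx
  simp only [LinearMap.comp_apply] at hx ⊢
  have key (t : BarModule A ⊗[K] BarModule A) :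
      TensorProduct.map (map f) (map f) ((cons n a).rTensor (BarModule A) t) =
        (cons n (f.toFun n a)).rTensor (BarModule B) (TensorProduct.map (map f) (map f) t) := by
    induction t with
    | zero => simp
    | add s t hs ht => simp only [_root_.map_add, hs, ht]
    | tmul p q => simp [map_cons]
  simp [deconcatMap_cons, map_cons, key, hx]

theorem map_mem_grade (f : Hom A B) {k : ℤ} {x : BarModule A} (hx : x ∈ grade A k) :
    map f x ∈ grade B k := by
  refine map_mem_of_mem_grade (fun w hw => ?_) hx
  rw [map, mapLetters_word, ← hw]
  convert word_mem_grade _ using 2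
  simp [totalDegree, Function.comp_def]

theorem map_gradeProj (f : Hom A B) (k : ℤ) (x : BarModule A) :
    map f (gradeProj k x) = gradeProj k (map f x) := by
  refine LinearMap.congr_fun (f := map f ∘ₗ gradeProj k) (g := gradeProj k ∘ₗ map f)
    (hom_ext fun w => ?_) x
  have hw := map_mem_grade f (word_mem_grade w)
  rw [LinearMap.comp_apply, LinearMap.comp_apply, gradeProj_word]
  split_ifs with h
  · rw [← h, gradeProj_of_mem hw]
  · rw [gradeProj_of_mem_of_ne h hw, map_zero]

theorem counitMap_map (f : Hom A B) (x : BarModule A) : counitMap (map f x) = counitMap x := by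
  refine LinearMap.congr_fun (f := counitMap ∘ₗ map f) (hom_ext_cons (by simp) ?_) x
  intro n a _ x _
  simp [map_cons]

/-- The mapping cone of the map induced by a quasi-isomorphism is acyclic for the vertical
differential. -/
theorem exists_vertDiff_eq {f : Hom A B} (H : f.toHom.HomotopyInverse) {x : BarModule A}
    {y : BarModule B} (hx : vertDiff x = 0) (hy : map f x = vertDiff y) :
    ∃ x' y', vertDiff x' = x ∧ y = map f x' + vertDiff y' := by
  let g : BarModule B →ₗ[K] BarModule A := mapLetters H.inv H.inv_one
  have hgv (y : BarModule B) : g (vertDiff y) = vertDiff (g y) :=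
    mapLetters_vertDiff _ _ H.inv_d y
  have hfv (x : BarModule A) : map f (vertDiff x) = vertDiff (map f x) :=
    mapLetters_vertDiff _ _ (fun n => f.map_d rfl) x
  have h₁ (x : BarModule A) : ∃ z, vertDiff x = 0 → g (map f x) = x + vertDiff z := by
    refine ⟨homotopy (fun n => H.inv n ∘ₗ f.toFun n) (by simp [f.map_one, H.inv_one]) H.left x, fun hx => ?_⟩
    have := vertDiff_homotopy (fun n => H.inv n ∘ₗ f.toFun n) (by simp [f.map_one, H.inv_one])
      (fun n x => by simp only [LinearMap.comp_apply, f.map_d, H.inv_d]) H.left H.left_eq x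
    rw [hx, map_zero, add_zero] at this
    rw [← this]
    exact mapLetters_comp _ _ _ _ _
  have h₂ (x : BarModule B) : ∃ z, vertDiff x = 0 → map f (g x) = x + vertDiff z := by
    refine ⟨homotopy (fun n => f.toFun n ∘ₗ H.inv n) (by simp [f.map_one, H.inv_one]) H.right x, fun hx => ?_⟩
    have := vertDiff_homotopy (fun n => f.toFun n ∘ₗ H.inv n) (by simp [f.map_one, H.inv_one])
      (fun n x => by simp only [LinearMap.comp_apply, f.map_d, H.inv_d]) H.right H.right_eq x
    rw [hx, map_zero, add_zero] at this
    rw [← this]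
    exact mapLetters_comp _ _ _ _ _
  -- From g f x = x + vz and f x = vy it follows that v(gy - z) = x. The defect y - f(gy - z) is
  -- closed; adding its image under g to gy - z leaves a defect that is a coboundary.
  obtain ⟨z, hz⟩ := h₁ x
  have hz := hz hx
  obtain ⟨t, ht⟩ := h₂ (y - map f (g y - z))
  have hv : vertDiff (g y - z) = x := by
    rw [map_sub, ← hgv, ← hy, hz]; abel
  have ht := ht (by rw [map_sub, ← hfv, hv, hy, sub_self])
  have hc : vertDiff (g (y - map f (g y - z))) = 0 := by
    rw [← hgv, map_sub, ← hfv, hv, hy, sub_self, map_zero]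
  refine ⟨g y - z + g (y - map f (g y - z)), -t, ?_, ?_⟩
  · rw [_root_.map_add, hv, hc, add_zero]
  · rw [_root_.map_add, ht, map_neg]; abel

/-- The mapping cone of the map induced by a quasi-isomorphism is acyclic. -/
theorem exists_diff_eq {f : Hom A B} (H : f.toHom.HomotopyInverse) {x : BarModule A}
    {y : BarModule B} (hx : diff x = 0) (hy : map f x = diff y) :
    ∃ x' y', diff x' = x ∧ y = map f x' + diff y' := by
  obtain ⟨p, hp⟩ := exists_mem_filtration x
  obtain ⟨q, hq⟩ := exists_mem_filtration y
  replace hp := filtration_mono (le_max_left p q) hp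
  replace hq := filtration_mono (le_max_right p q) hq
  generalize max p q = p at hp hq
  induction p generalizing x y with
  | zero =>
    exact ⟨0, 0, by simp [eq_zero_of_mem_filtration_zero hp],
      by simp [eq_zero_of_mem_filtration_zero hq]⟩
  | succ p ih =>
    have hL {C : AugCDGA.{v, w} K} {z : BarModule C} (hz : z ∈ filtration C (p + 1)) :
        lengthProj p (diff z) = vertDiff (lengthProj p z) := by
      rw [diff, LinearMap.add_apply, _root_.map_add, lengthProj_vertDiff,
        lengthProj_of_mem_filtration (horizDiff_mem_filtration hz), add_zero]
    -- The components of maximal length satisfy the equations for the vertical differential alone.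
    -- The solution is truncated to length p, so that subtracting it leaves only shorter words.
    obtain ⟨x', y', hx', hy'⟩ := exists_vertDiff_eq H (x := lengthProj p x) (y := lengthProj p y)
      (by rw [← hL hp, hx, map_zero]) (by rw [map, mapLetters_lengthProj, ← hL hq, ← hy]; rfl)
    have hX := lengthProj_mem_filtration p x'
    have hY := lengthProj_mem_filtration p y'
    have hvX : vertDiff (lengthProj p x') = lengthProj p x := by
      rw [← lengthProj_vertDiff, hx', lengthProj_lengthProj]
    have hvY : lengthProj p y = map f (lengthProj p x') + vertDiff (lengthProj p y') := by
      rw [← lengthProj_lengthProj, hy', _root_.map_add, lengthProj_vertDiff, map,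
        mapLetters_lengthProj]
    obtain ⟨x'', y'', hx'', hy''⟩ := ih (x := x - diff (lengthProj p x'))
      (y := y - map f (lengthProj p x') - diff (lengthProj p y'))
      (by rw [map_sub, hx, diff_diff, sub_zero])
      (by rw [map_sub, map_sub, map_sub, hy, map_diff, diff_diff, sub_zero])
      (by
        rw [diff, LinearMap.add_apply, hvX, ← sub_sub]
        exact sub_mem (sub_lengthProj_mem_filtration hp) (horizDiff_mem_filtration hX))
      (by
        rw [diff, LinearMap.add_apply, ← sub_sub, sub_sub y, ← hvY]
        exact sub_mem (sub_lengthProj_mem_filtration hq) (horizDiff_mem_filtration hY))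
    refine ⟨lengthProj p x' + x'', lengthProj p y' + y'', ?_, ?_⟩
    · rw [_root_.map_add, hx'']; abel
    · rw [_root_.map_add, _root_.map_add, eq_add_of_sub_eq (eq_add_of_sub_eq hy'')]; abel

theorem diff_gradeProj_eq {k : ℤ} {x : BarModule A} (hx : x ∈ grade A k) {x' : BarModule A}
    (h : diff x' = x) : diff (gradeProj (k - 1) x') = x := by
  rw [diff_gradeProj, h, sub_add_cancel, gradeProj_of_mem hx]

theorem isHom_map (f : Hom A B) : DGHopfData.IsHom A.bar B.bar f.bar where
  map_gr _ _ hx := map_mem_grade f hx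
  map_d := map_diff f
  map_mul := map_shuffleMul f
  map_one := map_nil f
  map_comul := map_deconcatMap f
  map_counit := counitMap_map f

/-- The bar construction preserves quasi-isomorphisms. -/
theorem isQuasiIso_bar {f : Hom A B} (hf : f.toHom.IsQuasiIso) :
    DGHopfData.IsQuasiIso A.bar B.bar f.bar := by
  obtain ⟨H⟩ := hf.nonempty_homotopyInverse
  refine ⟨isHom_map f, fun k => ⟨?_, ?_⟩⟩
  · rw [injective_iff_map_eq_zero]
    intro c hc
    obtain ⟨⟨x, hxk, hx⟩, rfl⟩ := Submodule.Quotient.mk_surjective _ c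
    obtain ⟨y, -, hy⟩ := (Submodule.Quotient.mk_eq_zero _).1 hc
    -- Acyclicity of the cone gives injectivity when y is a primitive of f x, and surjectivity below
    -- when x = 0. The solutions are then projected to the right degree.
    obtain ⟨x', y', hx', -⟩ := exists_diff_eq H (x := x) (y := y) hx hy.symm
    exact (Submodule.Quotient.mk_eq_zero _).2
      ⟨gradeProj (k - 1) x', gradeProj_mem _ _, diff_gradeProj_eq hxk hx'⟩
  · intro c
    obtain ⟨⟨y, hyk, hy⟩, rfl⟩ := Submodule.Quotient.mk_surjective _ c
    obtain ⟨x', y', hx', hy'⟩ := exists_diff_eq H (x := 0) (y := y) (map_zero _)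
      (by rw [map_zero]; exact Eq.symm hy)
    have h₁ : diff (gradeProj k x') = 0 := by rw [diff_gradeProj, hx', map_zero]
    have h₂ : y = map f (gradeProj k x') + diff (gradeProj (k - 1) y') := by
      have := congrArg (gradeProj k) hy'
      rwa [gradeProj_of_mem hyk, _root_.map_add, ← map_gradeProj, ← sub_add_cancel k 1,
        ← diff_gradeProj, sub_add_cancel] at this
    refine ⟨Submodule.Quotient.mk ⟨gradeProj k x', gradeProj_mem _ _, h₁⟩, ?_⟩
    have h₃ (z a b : BarModule B) (h : z = a + diff b) : diff (-b) = a - z := by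
      rw [h, map_neg]; abel
    exact (Submodule.Quotient.eq _).2
      ⟨-gradeProj (k - 1) y', neg_mem (gradeProj_mem _ _), h₃ _ _ _ h₂⟩

end BarModule

theorem barIsHopfZigZag {A B : AugCDGA.{v, w} K} (Z : ZigZag AugCDGA.QuasiIso A B) :
    BarIsHopfZigZag Z := by
  induction Z with
  | nil A => exact isDGHopf_bar A
  | fwd f Z ih => exact ⟨isDGHopf_bar _, BarModule.isQuasiIso_bar f.2, ih⟩
  | bwd f Z ih => exact ⟨isDGHopf_bar _, BarModule.isQuasiIso_bar f.2, ih⟩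

end AugCDGA

namespace CDGA

variable {K : Type v} [Field K]

/-! ### Subalgebras, products and quasi-isomorphisms -/

theorem mem_cocycles {A : CDGA.{v, w} K} {n : ℕ} {x : A.obj n} :
    x ∈ A.cocycles n ↔ A.d (rfl : n + 1 = n + 1) x = 0 := Iff.rfl

theorem mem_coboundaries_zero {A : CDGA.{v, w} K} {x : A.obj 0} :
    x ∈ A.coboundaries 0 ↔ x = 0 := by
  refine ⟨?_, fun h => h ▸ zero_mem _⟩
  rintro (⟨m, h, -⟩ | h)
  · omega
  · exact h

theorem mem_coboundaries_succ {A : CDGA.{v, w} K} {n : ℕ} {x : A.obj (n + 1)} :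
    x ∈ A.coboundaries (n + 1) ↔ ∃ y : A.obj n, A.d rfl y = x := by
  refine ⟨?_, fun ⟨y, hy⟩ => Or.inl ⟨n, rfl, y, hy⟩⟩
  rintro (⟨m, h, y, hy⟩ | h)
  · obtain rfl : m = n := by omega
    exact ⟨y, hy⟩
  · exact ⟨0, by rw [map_zero]; exact Eq.symm h⟩

theorem d_mem_coboundaries (A : CDGA.{v, w} K) {n m : ℕ} (h : n + 1 = m) (x : A.obj n) :
    A.d h x ∈ A.coboundaries m := Or.inl ⟨n, h, x, rfl⟩

theorem Hom.map_mem_coboundaries {A B : CDGA.{v, w} K} (f : Hom A B) {n : ℕ} {x : A.obj n}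
    (hx : x ∈ A.coboundaries n) : f.toFun n x ∈ B.coboundaries n := by
  rcases hx with ⟨m, h, y, rfl⟩ | hx
  · rw [f.map_d]; exact d_mem_coboundaries _ _ _
  · rw [show x = 0 from hx, map_zero]; exact zero_mem _

theorem Hom.isQuasiIso_iff {A B : CDGA.{v, w} K} (f : Hom A B) :
    f.IsQuasiIso ↔ ∀ n,
      (∀ x ∈ A.cocycles n, f.toFun n x ∈ B.coboundaries n → x ∈ A.coboundaries n) ∧
      ∀ y ∈ B.cocycles n, ∃ x ∈ A.cocycles n, f.toFun n x - y ∈ B.coboundaries n := by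
  refine forall_congr' fun n => and_congr ?_ ?_
  · rw [injective_iff_map_eq_zero]
    constructor
    · intro h x hx hfx
      have h₁ := h (Submodule.Quotient.mk ⟨x, hx⟩) ((Submodule.Quotient.mk_eq_zero _).2 hfx)
      have h₂ := (Submodule.Quotient.mk_eq_zero _).1 h₁
      exact h₂
    · intro h c hc
      obtain ⟨⟨x, hx⟩, rfl⟩ := Submodule.Quotient.mk_surjective _ c
      have h₁ := (Submodule.Quotient.mk_eq_zero _).1 hc
      exact (Submodule.Quotient.mk_eq_zero _).2 (h x hx h₁)
  · constructor
    · intro h y hy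
      obtain ⟨c, hc⟩ := h (Submodule.Quotient.mk ⟨y, hy⟩)
      obtain ⟨⟨x, hx⟩, rfl⟩ := Submodule.Quotient.mk_surjective _ c
      have h₁ := (Submodule.Quotient.eq _).1 hc
      exact ⟨x, hx, h₁⟩
    · intro h c
      obtain ⟨⟨y, hy⟩, rfl⟩ := Submodule.Quotient.mk_surjective _ c
      obtain ⟨x, hx, h⟩ := h y hy
      exact ⟨Submodule.Quotient.mk ⟨x, hx⟩, (Submodule.Quotient.eq _).2 h⟩

namespace Hom

variable {A B C : CDGA.{v, w} K}

/-- The composition of morphisms of CDGAs. -/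
def comp (g : Hom B C) (f : Hom A B) : Hom A C where
  toFun n := g.toFun n ∘ₗ f.toFun n
  map_d h a := by simp [f.map_d, g.map_d]
  map_one := by simp [f.map_one, g.map_one]
  map_mul h a b := by simp [f.map_mul, g.map_mul]

theorem map_mem_cocycles (f : Hom A B) {n : ℕ} {x : A.obj n} (hx : x ∈ A.cocycles n) :
    f.toFun n x ∈ B.cocycles n := by
  rw [mem_cocycles, ← f.map_d, mem_cocycles.1 hx, map_zero]

theorem cohomologyMap_comp (g : Hom B C) (f : Hom A B) (n : ℕ) (x : A.Cohomology n) :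
    (g.comp f).cohomologyMap n x = g.cohomologyMap n (f.cohomologyMap n x) := by
  obtain ⟨x, rfl⟩ := Submodule.Quotient.mk_surjective _ x
  rfl

theorem IsQuasiIso.comp {g : Hom B C} {f : Hom A B} (hg : g.IsQuasiIso) (hf : f.IsQuasiIso) :
    (g.comp f).IsQuasiIso := fun n => by
  have : ⇑((g.comp f).cohomologyMap n) = g.cohomologyMap n ∘ f.cohomologyMap n :=
    funext fun x => cohomologyMap_comp g f n x
  rw [this]
  exact (hg n).comp (hf n)

end Hom

/-- A graded subspace of a CDGA closed under the unit, the product and the differential. -/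
structure Subalgebra (A : CDGA.{v, w} K) where
  carrier : ∀ n, Submodule K (A.obj n)
  one_mem : A.one ∈ carrier 0
  mul_mem : ∀ {i j k : ℕ} (h : i + j = k) {a : A.obj i} {b : A.obj j}, a ∈ carrier i →
    b ∈ carrier j → A.mul h a b ∈ carrier k
  d_mem : ∀ {i j : ℕ} (h : i + 1 = j) {a : A.obj i}, a ∈ carrier i → A.d h a ∈ carrier j

namespace Subalgebra

variable {A : CDGA.{v, w} K} (S : Subalgebra A)

/-- A subalgebra as a CDGA. -/
def toCDGA : CDGA.{v, w} K where
  obj n := S.carrier n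
  d h := (A.d h).restrict fun _ => S.d_mem h
  one := ⟨A.one, S.one_mem⟩
  mul h := LinearMap.mk₂ K (fun a b => ⟨A.mul h a b, S.mul_mem h a.2 b.2⟩)
    (fun _ _ _ => Subtype.ext (by simp)) (fun _ _ _ => Subtype.ext (by simp))
    (fun _ _ _ => Subtype.ext (by simp)) (fun _ _ _ => Subtype.ext (by simp))
  d_d h h' a := Subtype.ext (A.d_d h h' a)
  one_mul h a := Subtype.ext (A.one_mul h a)
  mul_one h a := Subtype.ext (A.mul_one h a)
  mul_assoc h₁ h₂ h₃ h₄ a b c := Subtype.ext (A.mul_assoc h₁ h₂ h₃ h₄ a b c)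
  mul_comm h h' a b := Subtype.ext (A.mul_comm h h' a b)
  leibniz h hk hi hj h₁ h₂ a b := Subtype.ext (A.leibniz h hk hi hj h₁ h₂ a b)

/-- The inclusion of a subalgebra. -/
def incl : Hom S.toCDGA A where
  toFun n := (S.carrier n).subtype
  map_d _ _ := rfl
  map_one := rfl
  map_mul _ _ _ := rfl

end Subalgebra

/-- The product of two CDGAs. -/
def prod (A B : CDGA.{v, w} K) : CDGA.{v, w} K where
  obj n := A.obj n × B.obj n
  d h := (A.d h).prodMap (B.d h)
  one := (A.one, B.one)
  mul h := LinearMap.mk₂ K (fun a b => (A.mul h a.1 b.1, B.mul h a.2 b.2))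
    (fun _ _ _ => by simp) (fun _ _ _ => by simp) (fun _ _ _ => by simp) (fun _ _ _ => by simp)
  d_d h h' a := Prod.ext (A.d_d h h' _) (B.d_d h h' _)
  one_mul h a := Prod.ext (A.one_mul h _) (B.one_mul h _)
  mul_one h a := Prod.ext (A.mul_one h _) (B.mul_one h _)
  mul_assoc h₁ h₂ h₃ h₄ a b c :=
    Prod.ext (A.mul_assoc h₁ h₂ h₃ h₄ _ _ _) (B.mul_assoc h₁ h₂ h₃ h₄ _ _ _)
  mul_comm h h' a b := Prod.ext (A.mul_comm h h' _ _) (B.mul_comm h h' _ _)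
  leibniz h hk hi hj h₁ h₂ a b :=
    Prod.ext (A.leibniz h hk hi hj h₁ h₂ _ _) (B.leibniz h hk hi hj h₁ h₂ _ _)

/-- The first projection. -/
def fst (A B : CDGA.{v, w} K) : Hom (prod A B) A where
  toFun _ := LinearMap.fst K _ _
  map_d _ _ := rfl
  map_one := rfl
  map_mul _ _ _ := rfl

/-- The second projection. -/
def snd (A B : CDGA.{v, w} K) : Hom (prod A B) B where
  toFun _ := LinearMap.snd K _ _
  map_d _ _ := rfl
  map_one := rfl
  map_mul _ _ _ := rfl

/-! ### Polynomials in a variable of degree `0` and its differential -/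

/-- The degree `n - 1` part of a CDGA. -/
def Pred (E : CDGA.{v, w} K) : ℕ → Type w
  | 0 => (⊥ : Submodule K (E.obj 0))
  | n + 1 => E.obj n

instance (E : CDGA.{v, w} K) : ∀ n, AddCommGroup (E.Pred n)
  | 0 => inferInstanceAs (AddCommGroup (⊥ : Submodule K (E.obj 0)))
  | n + 1 => inferInstanceAs (AddCommGroup (E.obj n))

instance (E : CDGA.{v, w} K) : ∀ n, Module K (E.Pred n)
  | 0 => inferInstanceAs (Module K (⊥ : Submodule K (E.obj 0)))
  | n + 1 => inferInstanceAs (Module K (E.obj n))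

namespace Pred

variable {E : CDGA.{v, w} K}

/-- The shift. -/
def of : ∀ {i j : ℕ}, i + 1 = j → E.obj i →ₗ[K] E.Pred j
  | _, _, rfl => LinearMap.id

/-- The differential. -/
def d : ∀ {i j : ℕ}, i + 1 = j → E.Pred i →ₗ[K] E.Pred j
  | 0, _, _ => 0
  | i + 1, 0, _ => 0
  | i + 1, j + 1, h => E.d (i := i) (j := j) (by omega)

/-- Multiplication on the left. -/
def smul : ∀ {i j k : ℕ}, i + j = k → E.obj i →ₗ[K] E.Pred j →ₗ[K] E.Pred k
  | _, 0, _, _ => 0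
  | _, _ + 1, 0, _ => 0
  | i, j + 1, k + 1, h => E.mul (i := i) (j := j) (k := k) (by omega)

/-- Multiplication on the right. -/
def mul : ∀ {i j k : ℕ}, i + j = k → E.Pred i →ₗ[K] E.obj j →ₗ[K] E.Pred k
  | 0, _, _, _ => 0
  | _ + 1, _, 0, _ => 0
  | i + 1, j, k + 1, h => E.mul (i := i) (j := j) (k := k) (by omega)

instance : Subsingleton (E.Pred 0) := inferInstanceAs (Subsingleton (⊥ : Submodule K (E.obj 0)))

theorem d_d {i j k : ℕ} (h : i + 1 = j) (h' : j + 1 = k) (a : E.Pred i) :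
    d h' (d h a) = 0 := by
  subst h; subst h'
  cases i with
  | zero => rw [Subsingleton.elim a 0, map_zero, map_zero]
  | succ i => exact E.d_d _ _ _

theorem d_of {i j k l : ℕ} (h : i + 1 = j) (h' : j + 1 = k) (hl : i + 1 = l) (hk : l + 1 = k)
    (a : E.obj i) : d h' (of h a) = of hk (E.d hl a) := by
  subst h; subst h'; subst hl; rfl

theorem one_smul {i : ℕ} (h : 0 + i = i) (a : E.Pred i) : smul h E.one a = a := by
  cases i with
  | zero => exact Subsingleton.elim _ _
  | succ i => exact E.one_mul _ _

theorem mul_one {i : ℕ} (h : i + 0 = i) (a : E.Pred i) : mul h a E.one = a := by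
  cases i with
  | zero => exact Subsingleton.elim _ _
  | succ i => exact E.mul_one _ _

theorem mul_mul {i j k ij jk n : ℕ} (h₁ : i + j = ij) (h₂ : ij + k = n) (h₃ : j + k = jk)
    (h₄ : i + jk = n) (a : E.Pred i) (b : E.obj j) (c : E.obj k) :
    mul h₂ (mul h₁ a b) c = mul h₄ a (E.mul h₃ b c) := by
  cases i with
  | zero => simp [mul, Subsingleton.elim a 0]
  | succ i =>
    obtain ⟨ij, rfl⟩ : ∃ m, ij = m + 1 := ⟨i + j, by omega⟩
    obtain ⟨n, rfl⟩ : ∃ m, n = m + 1 := ⟨ij + k, by omega⟩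
    exact E.mul_assoc _ _ _ _ _ _ _

theorem smul_mul {i j k ij jk n : ℕ} (h₁ : i + j = ij) (h₂ : ij + k = n) (h₃ : j + k = jk)
    (h₄ : i + jk = n) (a : E.obj i) (b : E.Pred j) (c : E.obj k) :
    mul h₂ (smul h₁ a b) c = smul h₄ a (mul h₃ b c) := by
  cases j with
  | zero => simp [Subsingleton.elim b 0]
  | succ j =>
    obtain ⟨ij, rfl⟩ : ∃ m, ij = m + 1 := ⟨i + j, by omega⟩
    obtain ⟨n, rfl⟩ : ∃ m, n = m + 1 := ⟨ij + k, by omega⟩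
    obtain ⟨jk, rfl⟩ : ∃ m, jk = m + 1 := ⟨j + k, by omega⟩
    exact E.mul_assoc _ _ _ _ _ _ _

theorem smul_smul {i j k ij jk n : ℕ} (h₁ : i + j = ij) (h₂ : ij + k = n) (h₃ : j + k = jk)
    (h₄ : i + jk = n) (a : E.obj i) (b : E.obj j) (c : E.Pred k) :
    smul h₂ (E.mul h₁ a b) c = smul h₄ a (smul h₃ b c) := by
  cases k with
  | zero => simp [Subsingleton.elim c 0]
  | succ k =>
    obtain ⟨n, rfl⟩ : ∃ m, n = m + 1 := ⟨ij + k, by omega⟩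
    obtain ⟨jk, rfl⟩ : ∃ m, jk = m + 1 := ⟨j + k, by omega⟩
    exact E.mul_assoc _ _ _ _ _ _ _

/-- The element a has degree i - 1 in E; the exponent uses i + 1, which has the same parity and is
never negative. -/
theorem mul_eq_smul {i j k : ℕ} (h : i + j = k) (h' : j + i = k) (a : E.Pred i) (b : E.obj j) :
    mul h a b = (-1 : K) ^ ((i + 1) * j) • smul h' b a := by
  cases i with
  | zero => simp [Subsingleton.elim a 0]
  | succ i =>
    obtain ⟨k, rfl⟩ : ∃ m, k = m + 1 := ⟨i + j, by omega⟩
    have := E.mul_comm (i := i) (j := j) (k := k) (by omega) (by omega) a b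
    rw [show (i + 1 + 1) * j = i * j + 2 * j by ring, pow_add, pow_mul _ 2, neg_one_sq, one_pow,
      _root_.mul_one]
    exact this

theorem of_mul {i j k l m : ℕ} (h : i + 1 = k) (h' : k + j = l) (hm : i + j = m)
    (hl : m + 1 = l) (a : E.obj i) (b : E.obj j) : mul h' (of h a) b = of hl (E.mul hm a b) := by
  subst h; subst hl; rfl

theorem smul_of {i j k l m : ℕ} (h : j + 1 = k) (h' : i + k = l) (hm : i + j = m)
    (hl : m + 1 = l) (a : E.obj i) (b : E.obj j) : smul h' a (of h b) = of hl (E.mul hm a b) := by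
  subst h; subst hl; rfl

/-- The minus sign is the Leibniz sign (-1)^(i - 1) for the shifted degree of a. -/
theorem d_mul {i j k i' j' k' : ℕ} (h : i + j = k) (hk : k + 1 = k') (hi : i + 1 = i')
    (hj : j + 1 = j') (h₁ : i' + j = k') (h₂ : i + j' = k') (a : E.Pred i) (b : E.obj j) :
    d hk (mul h a b) = mul h₁ (d hi a) b - (-1 : K) ^ i • mul h₂ a (E.d hj b) := by
  cases i with
  | zero => simp [Subsingleton.elim a 0]
  | succ i =>
    obtain ⟨k, rfl⟩ : ∃ m, k = m + 1 := ⟨i + j, by omega⟩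
    obtain ⟨k', rfl⟩ : ∃ m, k' = m + 1 := ⟨k + 1, by omega⟩
    obtain ⟨i', rfl⟩ : ∃ m, i' = m + 1 := ⟨i + 1, by omega⟩
    have := E.leibniz (i := i) (j := j) (k := k) (i' := i') (j' := j') (k' := k') (by omega)
      (by omega) (by omega) hj (by omega) (by omega) a b
    rw [pow_succ, mul_neg_one, neg_smul, sub_neg_eq_add]
    exact this

theorem d_smul {i j k i' j' k' : ℕ} (h : i + j = k) (hk : k + 1 = k') (hi : i + 1 = i')
    (hj : j + 1 = j') (h₁ : i' + j = k') (h₂ : i + j' = k') (a : E.obj i) (b : E.Pred j) :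
    d hk (smul h a b) = smul h₁ (E.d hi a) b + (-1 : K) ^ i • smul h₂ a (d hj b) := by
  cases j with
  | zero => simp [Subsingleton.elim b 0]
  | succ j =>
    obtain ⟨k, rfl⟩ : ∃ m, k = m + 1 := ⟨i + j, by omega⟩
    obtain ⟨k', rfl⟩ : ∃ m, k' = m + 1 := ⟨k + 1, by omega⟩
    obtain ⟨j', rfl⟩ : ∃ m, j' = m + 1 := ⟨j + 1, by omega⟩
    exact E.leibniz (i := i) (j := j) (k := k) (i' := i') (j' := j') (k' := k') (by omega)
      (by omega) hi (by omega) (by omega) (by omega) a b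

end Pred

/-- A derivation of degree `0` of a CDGA. -/
structure Derivation (E : CDGA.{v, w} K) where
  toFun : ∀ n, E.obj n →ₗ[K] E.obj n
  map_d : ∀ {i j : ℕ} (h : i + 1 = j) (a : E.obj i), toFun j (E.d h a) = E.d h (toFun i a)
  map_mul : ∀ {i j k : ℕ} (h : i + j = k) (a : E.obj i) (b : E.obj j),
    toFun k (E.mul h a b) = E.mul h (toFun i a) b + E.mul h a (toFun j b)

/-- The CDGA `E ⊕ dt E` of elements `a + dt b` for a derivation `δ`, which plays the role of the
derivative with respect to `t`; its differential is `a + dt b ↦ da + dt (δ a - db)`. -/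
def adjoin (E : CDGA.{v, w} K) (δ : E.Derivation) : CDGA.{v, w} K where
  obj n := E.obj n × E.Pred n
  d h := LinearMap.prod (E.d h ∘ₗ LinearMap.fst K _ _)
    (Pred.of h ∘ₗ δ.toFun _ ∘ₗ LinearMap.fst K _ _ - Pred.d h ∘ₗ LinearMap.snd K _ _)
  one := (E.one, 0)
  -- The sign comes from moving dt to the front past an element of degree i; the term with dt dt
  -- vanishes.
  mul {i j k} h := LinearMap.mk₂ K (fun a b => (E.mul h a.1 b.1,
      Pred.mul h a.2 b.1 + (-1 : K) ^ i • Pred.smul h a.1 b.2))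
    (fun _ _ _ => Prod.ext (by simp) (by
      simp only [Prod.fst_add, Prod.snd_add, map_add, LinearMap.add_apply, smul_add]; abel))
    (fun c _ _ => Prod.ext (by simp) (by
      simp only [Prod.smul_fst, Prod.smul_snd, map_smul, LinearMap.smul_apply, smul_add,
        smul_comm c]))
    (fun _ _ _ => Prod.ext (by simp) (by
      simp only [Prod.fst_add, Prod.snd_add, map_add, smul_add]; abel))
    (fun c _ _ => Prod.ext (by simp) (by
      simp only [Prod.smul_fst, Prod.smul_snd, map_smul, smul_add, smul_comm c]))
  d_d h h' a := by
    refine Prod.ext (E.d_d h h' _) ?_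
    simp [Pred.d_d, Pred.d_of h h' h h', δ.map_d]
  one_mul h a := by
    refine Prod.ext (E.one_mul h _) ?_
    simp [Pred.one_smul]
  mul_one h a := by
    refine Prod.ext (E.mul_one h _) ?_
    simp [Pred.mul_one]
  mul_assoc {i j k ij jk n} h₁ h₂ h₃ h₄ a b c := by
    refine Prod.ext (E.mul_assoc h₁ h₂ h₃ h₄ _ _ _) ?_
    subst h₁
    simp [Pred.mul_mul rfl h₂ h₃ h₄, Pred.smul_mul rfl h₂ h₃ h₄, Pred.smul_smul rfl h₂ h₃ h₄,
      pow_add, smul_smul, add_assoc]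
  mul_comm {i j k} h h' a b := by
    refine Prod.ext (E.mul_comm h h' _ _) ?_
    simp only [LinearMap.mk₂_apply, Prod.smul_snd, Pred.mul_eq_smul h h', Pred.mul_eq_smul h' h,
      smul_add, _root_.smul_smul]
    rw [add_comm]
    congr 2
    · rw [← pow_add, show i * j + (j + 1) * i = i + 2 * (i * j) by ring, pow_add, pow_mul _ 2]
      simp
    · rw [← pow_add]; ring
  leibniz {i j k i' j' k'} h hk hi hj h₁ h₂ a b := by
    refine Prod.ext (E.leibniz h hk hi hj h₁ h₂ _ _) ?_
    subst hi
    simp [Pred.d_mul h hk rfl hj h₁ h₂, Pred.d_smul h hk rfl hj h₁ h₂,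
      Pred.of_mul rfl h₁ h hk, Pred.smul_of hj h₂ h hk, δ.map_mul, smul_add, smul_sub,
      _root_.smul_smul, pow_succ]
    rcases i.even_or_odd with hi | hi <;>
      simp only [hi.neg_one_pow, one_smul, neg_smul, neg_neg, _root_.mul_one, mul_neg,
        sub_eq_add_neg, neg_add] <;>
      abel

end CDGA

/-! ### Polynomials with coefficients in a vector space -/

namespace FormalPoly

variable {K : Type v} [Field K] {V W U : Type w} [AddCommGroup V] [Module K V] [AddCommGroup W]
  [Module K W] [AddCommGroup U] [Module K U]

/-- The product of polynomials induced by a bilinear map on coefficients. -/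
noncomputable def mul (μ : V →ₗ[K] W →ₗ[K] U) : (ℕ →₀ V) →ₗ[K] (ℕ →₀ W) →ₗ[K] (ℕ →₀ U) :=
  Finsupp.lsum K fun m => LinearMap.flip (Finsupp.lsum K fun n =>
    LinearMap.flip (μ.compr₂ (Finsupp.lsingle (m + n))))

@[simp]
theorem mul_single (μ : V →ₗ[K] W →ₗ[K] U) (m n : ℕ) (a : V) (b : W) :
    mul μ (Finsupp.single m a) (Finsupp.single n b) = Finsupp.single (m + n) (μ a b) := by
  simp [mul]

variable (K V) in
/-- The derivative. -/
noncomputable def deriv : (ℕ →₀ V) →ₗ[K] (ℕ →₀ V) :=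
  Finsupp.lsum K fun m => (m : K) • Finsupp.lsingle (m - 1)

@[simp]
theorem deriv_single (m : ℕ) (a : V) :
    deriv K V (Finsupp.single m a) = Finsupp.single (m - 1) ((m : K) • a) := by
  simp [deriv]

variable (K V) in
/-- The antiderivative without constant term. -/
noncomputable def integral : (ℕ →₀ V) →ₗ[K] (ℕ →₀ V) :=
  Finsupp.lsum K fun m => ((m : K) + 1)⁻¹ • Finsupp.lsingle (m + 1)

@[simp]
theorem integral_single (m : ℕ) (a : V) :
    integral K V (Finsupp.single m a) = Finsupp.single (m + 1) (((m : K) + 1)⁻¹ • a) := by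
  simp [integral]

variable (V) in
/-- The evaluation of polynomials. -/
noncomputable def eval (c : K) : (ℕ →₀ V) →ₗ[K] V :=
  Finsupp.lsum K fun m => c ^ m • LinearMap.id

@[simp]
theorem eval_single (c : K) (m : ℕ) (a : V) : eval V c (Finsupp.single m a) = c ^ m • a := by
  simp [eval]

theorem deriv_integral [CharZero K] (p : ℕ →₀ V) : deriv K V (integral K V p) = p := by
  induction p using Finsupp.induction_linear with
  | zero => simp
  | add a b ha hb => rw [map_add, map_add, ha, hb]
  | single m a =>
    have : (m : K) + 1 ≠ 0 := Nat.cast_add_one_ne_zero m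
    simp [-Finsupp.smul_single, smul_smul, this]

theorem integral_deriv [CharZero K] (p : ℕ →₀ V) :
    integral K V (deriv K V p) = p - Finsupp.single 0 (eval V (0 : K) p) := by
  induction p using Finsupp.induction_linear with
  | zero => simp
  | add a b ha hb => rw [map_add, map_add, ha, hb, map_add, Finsupp.single_add]; abel
  | single m a =>
    rcases m with _ | m
    · simp
    · have : (m : K) + 1 ≠ 0 := Nat.cast_add_one_ne_zero m
      simp [-Finsupp.smul_single, smul_smul, this]

theorem eval_integral (p : ℕ →₀ V) : eval V (0 : K) (integral K V p) = 0 := by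
  induction p using Finsupp.induction_linear with
  | zero => simp
  | add a b ha hb => rw [map_add, map_add, ha, hb, add_zero]
  | single m a => simp

theorem map_integral (φ : V →ₗ[K] W) (p : ℕ →₀ V) :
    Finsupp.mapRange.linearMap φ (integral K V p) =
      integral K W (Finsupp.mapRange.linearMap φ p) := by
  induction p using Finsupp.induction_linear with
  | zero => simp
  | add a b ha hb => simp only [map_add, ha, hb]
  | single m a => simp [-Finsupp.smul_single]

theorem map_deriv (φ : V →ₗ[K] W) (p : ℕ →₀ V) :
    Finsupp.mapRange.linearMap φ (deriv K V p) =
      deriv K W (Finsupp.mapRange.linearMap φ p) := by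
  induction p using Finsupp.induction_linear with
  | zero => simp
  | add a b ha hb => simp only [map_add, ha, hb]
  | single m a => simp [-Finsupp.smul_single]

theorem map_eval (φ : V →ₗ[K] W) (c : K) (p : ℕ →₀ V) :
    eval W c (Finsupp.mapRange.linearMap φ p) = φ (eval V c p) := by
  induction p using Finsupp.induction_linear with
  | zero => simp
  | add a b ha hb => simp only [map_add, ha, hb]
  | single m a => simp

theorem deriv_mul (μ : V →ₗ[K] W →ₗ[K] U) (p : ℕ →₀ V) (q : ℕ →₀ W) :
    deriv K U (mul μ p q) = mul μ (deriv K V p) q + mul μ p (deriv K W q) := by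
  induction p using Finsupp.induction_linear with
  | zero => simp
  | add a a' ha ha' => simp only [map_add, LinearMap.add_apply, ha, ha']; abel
  | single l a =>
    induction q using Finsupp.induction_linear with
    | zero => simp
    | add b b' hb hb' => simp only [map_add, hb, hb']; abel
    | single m b =>
      -- Exponent 0 is separated because of truncated subtraction; its derivative has coefficient 0.
      rcases l with _ | l <;> rcases m with _ | m
      · simp [-Finsupp.smul_single]
      · simp [-Finsupp.smul_single]
      · simp [-Finsupp.smul_single]
      · simp only [deriv_single, mul_single, map_smul, LinearMap.smul_apply, Nat.add_sub_cancel]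
        rw [show l + 1 + (m + 1) - 1 = l + m + 1 by omega, show l + (m + 1) = l + m + 1 by omega,
          show l + 1 + m = l + m + 1 by omega, ← Finsupp.single_add, ← add_smul, Nat.cast_add]

theorem eval_mul (μ : V →ₗ[K] W →ₗ[K] U) (c : K) (p : ℕ →₀ V) (q : ℕ →₀ W) :
    eval U c (mul μ p q) = μ (eval V c p) (eval W c q) := by
  induction p using Finsupp.induction_linear with
  | zero => simp
  | add a a' ha ha' => simp only [map_add, LinearMap.add_apply, ha, ha']
  | single l a =>
    induction q using Finsupp.induction_linear with
    | zero => simp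
    | add b b' hb hb' => simp only [map_add, hb, hb']
    | single m b => simp [smul_smul, pow_add, _root_.mul_comm (c ^ m)]

/-- Integration commutes with maps of coefficients and recovers q from its derivative and q(0) = 0.
With φ the differential, it verifies the primitive in the Poincaré lemma. -/
theorem map_integral_eq [CharZero K] {φ : V →ₗ[K] W} {p : ℕ →₀ V} {q : ℕ →₀ W}
    (h : deriv K W q = Finsupp.mapRange.linearMap φ p) (h₀ : eval W (0 : K) q = 0) :
    Finsupp.mapRange.linearMap φ (integral K V p) = q := by
  rw [map_integral, ← h, integral_deriv, h₀, Finsupp.single_zero, sub_zero]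

theorem eq_zero_of_deriv_eq_zero [CharZero K] {p : ℕ →₀ V} (h : deriv K V p = 0)
    (h₀ : eval V (0 : K) p = 0) : p = 0 := by
  have := integral_deriv (K := K) p
  rwa [h, h₀, map_zero, Finsupp.single_zero, sub_zero, eq_comm] at this

end FormalPoly

/-! ### The path object and its Poincaré lemma. -/

namespace CDGA

variable {K : Type v} [Field K]

/-- Polynomials with coefficients in a CDGA, in a central variable `t` of degree `0` with
`dt = 0`. -/
noncomputable def poly (C : CDGA.{v, w} K) : CDGA.{v, w} K where
  obj n := ℕ →₀ C.obj n
  d h := Finsupp.mapRange.linearMap (C.d h)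
  one := Finsupp.single 0 C.one
  mul h := FormalPoly.mul (C.mul h)
  d_d h h' a := by
    induction a using Finsupp.induction_linear with
    | zero => simp
    | add a b ha hb => simp only [map_add, ha, hb, add_zero]
    | single m a => simp [C.d_d]
  one_mul h a := by
    induction a using Finsupp.induction_linear with
    | zero => simp
    | add a b ha hb => rw [map_add, ha, hb]
    | single m a => simp [C.one_mul]
  mul_one h a := by
    induction a using Finsupp.induction_linear with
    | zero => simp
    | add a b ha hb => rw [map_add, LinearMap.add_apply, ha, hb]
    | single m a => simp [C.mul_one]
  mul_assoc h₁ h₂ h₃ h₄ a b c := by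
    induction a using Finsupp.induction_linear with
    | zero => simp
    | add a a' ha ha' => simp only [map_add, LinearMap.add_apply, ha, ha']
    | single l a =>
      induction b using Finsupp.induction_linear with
      | zero => simp
      | add b b' hb hb' => simp only [map_add, LinearMap.add_apply, hb, hb']
      | single m b =>
        induction c using Finsupp.induction_linear with
        | zero => simp
        | add c c' hc hc' => simp only [map_add, hc, hc']
        | single n c => simp [C.mul_assoc h₁ h₂ h₃ h₄, add_assoc]
  mul_comm h h' a b := by
    induction a using Finsupp.induction_linear with
    | zero => simp
    | add a a' ha ha' => simp only [map_add, LinearMap.add_apply, ha, ha', smul_add]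
    | single l a =>
      induction b using Finsupp.induction_linear with
      | zero => simp
      | add b b' hb hb' => simp only [map_add, LinearMap.add_apply, hb, hb', smul_add]
      | single m b => simp [C.mul_comm h h' a b, add_comm m l]
  leibniz h hk hi hj h₁ h₂ a b := by
    induction a using Finsupp.induction_linear with
    | zero => simp
    | add a a' ha ha' => simp only [map_add, LinearMap.add_apply, ha, ha', smul_add]; abel
    | single l a =>
      induction b using Finsupp.induction_linear with
      | zero => simp
      | add b b' hb hb' => simp only [map_add, hb, hb', smul_add]; abel
      | single m b => simp [C.leibniz h hk hi hj h₁ h₂ a b]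

/-- The derivative with respect to the variable. -/
noncomputable def polyDeriv (C : CDGA.{v, w} K) : (poly C).Derivation where
  toFun n := FormalPoly.deriv K (C.obj n)
  map_d h a := (FormalPoly.map_deriv (C.d h) a).symm
  map_mul h a b := FormalPoly.deriv_mul (C.mul h) a b

/-- The path object `C ⊗ K[t, dt]`. -/
noncomputable def path (C : CDGA.{v, w} K) : CDGA.{v, w} K := (poly C).adjoin C.polyDeriv

/-- The evaluation of the path object at a scalar. -/
noncomputable def pathEval (C : CDGA.{v, w} K) (c : K) : Hom (path C) C where
  toFun n := FormalPoly.eval (C.obj n) c ∘ₗ LinearMap.fst K (ℕ →₀ C.obj n) ((poly C).Pred n)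
  map_d h a := FormalPoly.map_eval (C.d h) c a.1
  map_one := (FormalPoly.eval_single c 0 C.one).trans (by simp)
  map_mul h a b := FormalPoly.eval_mul (C.mul h) c a.1 b.1

/-- The constant paths. -/
noncomputable def pathConst (C : CDGA.{v, w} K) : Hom C (path C) where
  toFun n := LinearMap.inl K (ℕ →₀ C.obj n) ((poly C).Pred n) ∘ₗ Finsupp.lsingle 0
  map_d {i j} h a := by
    refine Prod.ext ?_ ?_
    · change Finsupp.single 0 (C.d h a) = Finsupp.mapRange.linearMap (C.d h) (Finsupp.single 0 a)
      simp
    · have h₁ : C.polyDeriv.toFun i (Finsupp.single 0 a : ℕ →₀ C.obj i) = 0 := by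
        have h₂ : FormalPoly.deriv K (C.obj i) (Finsupp.single 0 a) = 0 := by simp
        exact h₂
      change (0 : (poly C).Pred j) =
        Pred.of h (C.polyDeriv.toFun i (Finsupp.single 0 a : ℕ →₀ C.obj i)) - Pred.d h 0
      rw [h₁, map_zero, map_zero, sub_zero]
  map_one := rfl
  map_mul {i j k} h a b := by
    refine Prod.ext ?_ ?_
    · change Finsupp.single 0 (C.mul h a b) =
        FormalPoly.mul (C.mul h) (Finsupp.single 0 a) (Finsupp.single 0 b)
      simp
    · have h₁ (E : CDGA.{v, w} K) (x : E.obj i) (y : E.obj j) :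
          (0 : E.Pred k) = Pred.mul h 0 y + (-1 : K) ^ i • Pred.smul h x 0 := by simp
      exact h₁ (poly C) _ _

theorem pathEval_pathConst (C : CDGA.{v, w} K) (c : K) {n : ℕ} (x : C.obj n) :
    (pathEval C c).toFun n ((pathConst C).toFun n x) = x :=
  (FormalPoly.eval_single c 0 x).trans (by simp)

/-- The Poincaré lemma: a closed path that starts at zero has a primitive that starts at zero. -/
theorem exists_path_primitive [CharZero K] (C : CDGA.{v, w} K) {n : ℕ}
    (x : (path C).obj (n + 1)) (hx : x ∈ (path C).cocycles (n + 1))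
    (h₀ : (pathEval C 0).toFun (n + 1) x = 0) :
    ∃ y : (path C).obj n, (path C).d rfl y = x ∧ (pathEval C 0).toFun n y = 0 := by
  obtain ⟨a, b⟩ := x
  -- The dt-component of closedness of a + dt b reads a' = db. The primitive is therefore the
  -- integral of b from 0 to t.
  have hb : C.polyDeriv.toFun (n + 1) a = (poly C).d (rfl : n + 1 = n + 1) b :=
    sub_eq_zero.1 (congrArg Prod.snd hx)
  refine ⟨(FormalPoly.integral K (C.obj n) b, 0), Prod.ext ?_ ?_, FormalPoly.eval_integral _⟩
  · exact FormalPoly.map_integral_eq hb h₀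
  · exact (sub_eq_self.2 (map_zero (Pred.d (E := poly C) rfl))).trans (FormalPoly.deriv_integral _)

/-- A closed path of degree 0 has no dt-part and zero derivative, so it is constant. This is the
Poincaré lemma in the degree in which no primitives exist. -/
theorem path_eq_zero [CharZero K] (C : CDGA.{v, w} K) (x : (path C).obj 0)
    (hx : x ∈ (path C).cocycles 0) (h₀ : (pathEval C 0).toFun 0 x = 0) : x = 0 := by
  obtain ⟨a, b⟩ := x
  have hb : C.polyDeriv.toFun 0 a = 0 := by
    have h₁ : Pred.of (E := poly C) (rfl : 0 + 1 = 1) (C.polyDeriv.toFun 0 a) - Pred.d rfl b = 0 :=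
      congrArg Prod.snd hx
    rwa [Subsingleton.elim b 0, map_zero, sub_zero] at h₁
  exact Prod.ext (FormalPoly.eq_zero_of_deriv_eq_zero hb h₀) (Subsingleton.elim _ _)

/-- The path `t x`. -/
noncomputable def linearPath (C : CDGA.{v, w} K) {n : ℕ} (x : C.obj n) : (path C).obj n :=
  ((Finsupp.single 1 x : ℕ →₀ C.obj n), (0 : (poly C).Pred n))

theorem pathEval_linearPath (C : CDGA.{v, w} K) {n : ℕ} (x : C.obj n) (c : K) :
    (pathEval C c).toFun n (linearPath C x) = c • x :=
  (FormalPoly.eval_single c 1 x).trans (by simp)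

/-- A coboundary is the end of a closed path that starts at zero. -/
theorem exists_path_of_mem_coboundaries (C : CDGA.{v, w} K) {n : ℕ} {x : C.obj n}
    (hx : x ∈ C.coboundaries n) : ∃ y ∈ (path C).coboundaries n,
      (pathEval C 0).toFun n y = 0 ∧ (pathEval C 1).toFun n y = x := by
  rcases hx with ⟨m, h, z, rfl⟩ | hx
  · refine ⟨(path C).d h (linearPath C z), d_mem_coboundaries _ _ _, ?_, ?_⟩
    · rw [Hom.map_d, pathEval_linearPath, zero_smul, map_zero]
    · rw [Hom.map_d, pathEval_linearPath, one_smul]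
  · exact ⟨0, zero_mem _, by simp, by rw [map_zero]; exact hx.symm⟩

end CDGA

/-! ### Homotopy pullbacks. -/

namespace CDGA

variable {K : Type v} [Field K]

theorem cocycles_iff {A : CDGA.{v, w} K} {n m : ℕ} (h : n + 1 = m) {x : A.obj n} :
    x ∈ A.cocycles n ↔ A.d h x = 0 := by
  subst h; rfl

theorem coboundaries_le_cocycles (A : CDGA.{v, w} K) (n : ℕ) : A.coboundaries n ≤ A.cocycles n := by
  rintro _ (⟨m, h, y, rfl⟩ | hx)
  · exact A.d_d _ _ _
  · rw [show _ = _ from hx]; exact zero_mem _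

/-- The two ends of a closed path are cohomologous. -/
theorem pathEval_one_sub_zero_mem [CharZero K] (C : CDGA.{v, w} K) {n : ℕ} {x : (path C).obj n}
    (hx : x ∈ (path C).cocycles n) :
    (pathEval C 1).toFun n x - (pathEval C 0).toFun n x ∈ C.coboundaries n := by
  set x₀ := (pathEval C 0).toFun n x with hx₀
  -- Subtracting the constant path at the starting point makes the Poincaré lemma applicable.
  have hc : x - (pathConst C).toFun n x₀ ∈ (path C).cocycles n :=
    sub_mem hx (Hom.map_mem_cocycles _ (Hom.map_mem_cocycles _ hx))
  have h₀ : (pathEval C 0).toFun n (x - (pathConst C).toFun n x₀) = 0 := by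
    rw [map_sub, pathEval_pathConst, ← hx₀, sub_self]
  have h₁ : (pathEval C 1).toFun n (x - (pathConst C).toFun n x₀) =
      (pathEval C 1).toFun n x - x₀ := by rw [map_sub, pathEval_pathConst]
  rw [← h₁]
  cases n with
  | zero => rw [path_eq_zero C _ hc h₀, map_zero]; exact zero_mem _
  | succ n =>
    obtain ⟨y, hy, -⟩ := exists_path_primitive C _ hc h₀
    rw [← hy, Hom.map_d]
    exact d_mem_coboundaries _ _ _

section HomotopyPullback

variable {R S C : CDGA.{v, w} K} (f : Hom R C) (g : Hom S C)

/-- The homotopy pullback of two morphisms of CDGAs, as a subalgebra of a product. -/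
noncomputable def homotopyPullback : Subalgebra (prod R (prod (path C) S)) where
  carrier n :=
    { carrier := {x | f.toFun n x.1 = (pathEval C 0).toFun n x.2.1 ∧
        g.toFun n x.2.2 = (pathEval C 1).toFun n x.2.1}
      zero_mem' := by
        refine ⟨?_, ?_⟩
        · exact (map_zero _).trans (map_zero _).symm
        · exact (map_zero _).trans (map_zero _).symm
      add_mem' := fun {x y} hx hy => by
        refine ⟨?_, ?_⟩
        · change f.toFun n (x.1 + y.1) = (pathEval C 0).toFun n (x.2.1 + y.2.1)
          rw [map_add, map_add, hx.1, hy.1]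
        · change g.toFun n (x.2.2 + y.2.2) = (pathEval C 1).toFun n (x.2.1 + y.2.1)
          rw [map_add, map_add, hx.2, hy.2]
      smul_mem' := fun c x hx => by
        refine ⟨?_, ?_⟩
        · change f.toFun n (c • x.1) = (pathEval C 0).toFun n (c • x.2.1)
          rw [map_smul, map_smul, hx.1]
        · change g.toFun n (c • x.2.2) = (pathEval C 1).toFun n (c • x.2.1)
          rw [map_smul, map_smul, hx.2] }
  one_mem := ⟨f.map_one.trans (pathEval C 0).map_one.symm,
    g.map_one.trans (pathEval C 1).map_one.symm⟩
  mul_mem {i j k} h x y hx hy := by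
    refine ⟨?_, ?_⟩
    · change f.toFun k (R.mul h x.1 y.1) = (pathEval C 0).toFun k ((path C).mul h x.2.1 y.2.1)
      rw [Hom.map_mul, Hom.map_mul, hx.1, hy.1]
    · change g.toFun k (S.mul h x.2.2 y.2.2) = (pathEval C 1).toFun k ((path C).mul h x.2.1 y.2.1)
      rw [Hom.map_mul, Hom.map_mul, hx.2, hy.2]
  d_mem {i j} h x hx := by
    refine ⟨?_, ?_⟩
    · change f.toFun j (R.d h x.1) = (pathEval C 0).toFun j ((path C).d h x.2.1)
      rw [Hom.map_d, Hom.map_d, hx.1]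
    · change g.toFun j (S.d h x.2.2) = (pathEval C 1).toFun j ((path C).d h x.2.1)
      rw [Hom.map_d, Hom.map_d, hx.2]

/-- The first projection of the homotopy pullback. -/
noncomputable def homotopyPullbackFst : Hom (homotopyPullback f g).toCDGA R :=
  (fst _ _).comp (homotopyPullback f g).incl

/-- The projection of the homotopy pullback to the path object. -/
noncomputable def homotopyPullbackPath : Hom (homotopyPullback f g).toCDGA (path C) :=
  ((fst _ _).comp (snd _ _)).comp (homotopyPullback f g).incl

/-- The second projection of the homotopy pullback. -/
noncomputable def homotopyPullbackSnd : Hom (homotopyPullback f g).toCDGA S :=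
  ((snd _ _).comp (snd _ _)).comp (homotopyPullback f g).incl

variable {f g}

/-- An element over r is a path from f r to the image of some s under g. Since g is a
quasi-isomorphism, such s and such paths exist for closed r and are unique up to coboundaries. -/
theorem homotopyPullbackFst_isQuasiIso [CharZero K] (hg : g.IsQuasiIso) :
    (homotopyPullbackFst f g).IsQuasiIso := by
  have hg := g.isQuasiIso_iff.1 hg
  refine (Hom.isQuasiIso_iff _).2 fun n => ⟨?_, fun r hr => ?_⟩
  · rintro ⟨⟨r, ω, s⟩, (hfr : f.toFun n r = (pathEval C 0).toFun n ω),
      (hgs : g.toFun n s = (pathEval C 1).toFun n ω)⟩ hx (hr : r ∈ R.coboundaries n)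
    have hω : ω ∈ (path C).cocycles n := (homotopyPullbackPath f g).map_mem_cocycles hx
    have hs : s ∈ S.cocycles n := (homotopyPullbackSnd f g).map_mem_cocycles hx
    cases n with
    | zero =>
      obtain rfl := mem_coboundaries_zero.1 hr
      rw [map_zero] at hfr
      obtain rfl := path_eq_zero C ω hω hfr.symm
      rw [map_zero] at hgs
      have h₁ := (hg 0).1 s hs (by rw [hgs]; exact zero_mem _)
      obtain rfl := mem_coboundaries_zero.1 h₁
      exact zero_mem _
    | succ m =>
      obtain ⟨r', rfl⟩ := mem_coboundaries_succ.1 hr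
      -- remove the constant path at the boundary of `f r'`
      set c := f.toFun m r' with hc
      have hfr' : (pathEval C 0).toFun (m + 1) ω = C.d rfl c := by rw [← hfr, f.map_d]
      obtain ⟨η, hη, hη₀⟩ := exists_path_primitive C
        (ω - (path C).d rfl ((pathConst C).toFun m c))
        (sub_mem hω (coboundaries_le_cocycles _ _ (d_mem_coboundaries _ _ _)))
        (by rw [map_sub, hfr', Hom.map_d, pathEval_pathConst, sub_self])
      have hω' : ω = (path C).d rfl (η + (pathConst C).toFun m c) := by
        rw [map_add, hη, sub_add_cancel]
      have hs' : g.toFun (m + 1) s = C.d rfl ((pathEval C 1).toFun m η + c) := by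
        rw [hgs, hω', Hom.map_d, map_add, pathEval_pathConst]
      have h₁ := (hg (m + 1)).1 s hs (by rw [hs']; exact d_mem_coboundaries _ _ _)
      obtain ⟨s', rfl⟩ := mem_coboundaries_succ.1 h₁
      -- The primitives of path and endpoint need not fit together at time 1. Their mismatch is
      -- closed, hence cohomologous to g v for a cocycle v; subtracting v from s' and the closed
      -- path κ from the path removes it.
      obtain ⟨v, hv, hv'⟩ := (hg m).2 (g.toFun m s' - ((pathEval C 1).toFun m η + c)) (by
        rw [mem_cocycles, map_sub, ← g.map_d, hs', sub_self])
      obtain ⟨κ, hκ, hκ₀, hκ₁⟩ := exists_path_of_mem_coboundaries C hv'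
      have hκ := coboundaries_le_cocycles _ _ hκ
      refine mem_coboundaries_succ.2
        ⟨⟨(r', η + (pathConst C).toFun m c - κ, s' - v), ?_, ?_⟩, ?_⟩
      · change f.toFun m r' = (pathEval C 0).toFun m (η + (pathConst C).toFun m c - κ)
        rw [map_sub, map_add, hη₀, hκ₀, pathEval_pathConst, zero_add, sub_zero]
      · change g.toFun m (s' - v) = (pathEval C 1).toFun m (η + (pathConst C).toFun m c - κ)
        rw [map_sub, map_sub, map_add, hκ₁, pathEval_pathConst]
        abel
      · refine Subtype.ext (Prod.ext rfl (Prod.ext ?_ ?_))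
        · change (path C).d rfl (η + (pathConst C).toFun m c - κ) = ω
          rw [map_sub, ← hω', mem_cocycles.1 hκ, sub_zero]
        · change S.d rfl (s' - v) = S.d rfl s'
          rw [map_sub, mem_cocycles.1 hv, sub_zero]
  -- As g s and f r are cohomologous, a closed path leads from 0 to g s - f r; adding the constant
  -- path at f r yields a path from f r to g s.
  · obtain ⟨s, hs, hs'⟩ := (hg n).2 (f.toFun n r) (f.map_mem_cocycles hr)
    obtain ⟨κ, hκ, hκ₀, hκ₁⟩ := exists_path_of_mem_coboundaries C hs'
    have hκ := coboundaries_le_cocycles _ _ hκ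
    refine ⟨⟨(r, (pathConst C).toFun n (f.toFun n r) + κ, s), ?_, ?_⟩, ?_, ?_⟩
    · change f.toFun n r = (pathEval C 0).toFun n ((pathConst C).toFun n (f.toFun n r) + κ)
      rw [map_add, pathEval_pathConst, hκ₀, add_zero]
    · change g.toFun n s = (pathEval C 1).toFun n ((pathConst C).toFun n (f.toFun n r) + κ)
      rw [map_add, pathEval_pathConst, hκ₁, add_sub_cancel]
    · refine Subtype.ext (Prod.ext hr (Prod.ext ?_ hs))
      exact add_mem ((pathConst C).map_mem_cocycles (f.map_mem_cocycles hr)) hκ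
    · change r - r ∈ R.coboundaries n
      rw [sub_self]; exact zero_mem _

/-- The two composites to C agree on cohomology because the ends of a closed path are cohomologous;
the claim follows by two-out-of-three. -/
theorem homotopyPullbackSnd_isQuasiIso [CharZero K] (hf : f.IsQuasiIso) (hg : g.IsQuasiIso) :
    (homotopyPullbackSnd f g).IsQuasiIso := by
  have hp := hf.comp (homotopyPullbackFst_isQuasiIso (f := f) hg)
  intro n
  have h : ⇑((g.comp (homotopyPullbackSnd f g)).cohomologyMap n) =
      (f.comp (homotopyPullbackFst f g)).cohomologyMap n := by
    funext x
    obtain ⟨⟨x, hx⟩, rfl⟩ := Submodule.Quotient.mk_surjective _ x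
    refine (Submodule.Quotient.eq _).2 ?_
    change g.toFun n x.1.2.2 - f.toFun n x.1.1 ∈ C.coboundaries n
    rw [show g.toFun n x.1.2.2 = _ from x.2.2, show f.toFun n x.1.1 = _ from x.2.1]
    exact pathEval_one_sub_zero_mem C ((homotopyPullbackPath f g).map_mem_cocycles hx)
  have h₁ : ⇑((g.comp (homotopyPullbackSnd f g)).cohomologyMap n) =
      g.cohomologyMap n ∘ (homotopyPullbackSnd f g).cohomologyMap n :=
    funext fun x => Hom.cohomologyMap_comp _ _ _ _
  refine (Function.Bijective.of_comp_iff' (hg n) _).1 ?_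
  rw [← h₁, h]
  exact hp n

end HomotopyPullback

end CDGA

/-! ### Operations on zig-zags. -/

namespace ZigZag

variable {Ob : Type u} {Arr : Ob → Ob → Type v}

/-- The concatenation of zig-zags. -/
def append : ∀ {A B C : Ob}, ZigZag Arr A B → ZigZag Arr B C → ZigZag Arr A C
  | _, _, _, nil _, W => W
  | _, _, _, fwd f Z, W => fwd f (Z.append W)
  | _, _, _, bwd f Z, W => bwd f (Z.append W)

/-- The reversal of a zig-zag. -/
def reverse : ∀ {A B : Ob}, ZigZag Arr A B → ZigZag Arr B A
  | _, _, nil A => nil A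
  | _, _, fwd f Z => Z.reverse.append (bwd f (nil _))
  | _, _, bwd f Z => Z.reverse.append (fwd f (nil _))

end ZigZag

namespace CDGA

variable {K : Type v} [Field K] {A B C : CDGA.{v, w} K}

/-! ### Morphisms on cohomology -/

/-- The morphism of CDGAs induced on cohomology. -/
def Hom.cohomologyHom (f : Hom A B) : Hom A.cohomology B.cohomology where
  toFun := f.cohomologyMap
  map_d h a := map_zero _
  map_one := congrArg Submodule.Quotient.mk (Subtype.ext f.map_one)
  map_mul h a b := by
    obtain ⟨a, rfl⟩ := Submodule.Quotient.mk_surjective _ a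
    obtain ⟨b, rfl⟩ := Submodule.Quotient.mk_surjective _ b
    exact congrArg Submodule.Quotient.mk (Subtype.ext (f.map_mul h a b))

/-- The inverse of a bijective morphism. -/
noncomputable def Hom.inverse (f : Hom A B) (hf : ∀ n, Function.Bijective (f.toFun n)) :
    Hom B A where
  toFun n := (LinearEquiv.ofBijective (f.toFun n) (hf n)).symm
  map_d {i j} h b := by
    obtain ⟨a, rfl⟩ := (hf i).2 b
    apply (hf j).1
    have h₁ n x : f.toFun n ((LinearEquiv.ofBijective (f.toFun n) (hf n)).symm x) = x :=
      (LinearEquiv.ofBijective (f.toFun n) (hf n)).apply_symm_apply x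
    simp only [LinearEquiv.coe_coe, f.map_d, h₁]
  map_one := by
    apply (hf 0).1
    rw [f.map_one]
    exact (LinearEquiv.ofBijective (f.toFun 0) (hf 0)).apply_symm_apply _
  map_mul {i j k} h a b := by
    apply (hf k).1
    have h₁ n x : f.toFun n ((LinearEquiv.ofBijective (f.toFun n) (hf n)).symm x) = x :=
      (LinearEquiv.ofBijective (f.toFun n) (hf n)).apply_symm_apply x
    simp only [LinearEquiv.coe_coe, f.map_mul, h₁]

theorem Hom.inverse_bijective (f : Hom A B) (hf : ∀ n, Function.Bijective (f.toFun n)) (n : ℕ) :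
    Function.Bijective ((f.inverse hf).toFun n) :=
  (LinearEquiv.ofBijective (f.toFun n) (hf n)).symm.bijective

theorem Hom.inverse_apply (f : Hom A B) (hf : ∀ n, Function.Bijective (f.toFun n)) {n : ℕ}
    (x : A.obj n) : (f.inverse hf).toFun n (f.toFun n x) = x :=
  (LinearEquiv.ofBijective (f.toFun n) (hf n)).symm_apply_apply x

theorem Hom.isQuasiIso_of_bijective (f : Hom A B) (hf : ∀ n, Function.Bijective (f.toFun n)) :
    f.IsQuasiIso := by
  refine f.isQuasiIso_iff.2 fun n => ⟨fun x hx hfx => ?_, fun y hy => ?_⟩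
  · have := (f.inverse hf).map_mem_coboundaries hfx
    rwa [f.inverse_apply] at this
  · refine ⟨(f.inverse hf).toFun n y, (f.inverse hf).map_mem_cocycles hy, ?_⟩
    rw [show f.toFun n ((f.inverse hf).toFun n y) = y from
      (LinearEquiv.ofBijective (f.toFun n) (hf n)).apply_symm_apply y, sub_self]
    exact zero_mem _

/-- The class of a cocycle. -/
def cohomologyClass (A : CDGA.{v, w} K) {n : ℕ} (x : A.obj n) (hx : x ∈ A.cocycles n) :
    A.cohomology.obj n := Submodule.Quotient.mk ⟨x, hx⟩

/-- The identification of a cohomology algebra with its own cohomology. -/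
def cohomologySelf (A : CDGA.{v, w} K) : Hom A.cohomology A.cohomology.cohomology where
  toFun n := Submodule.mkQ _ ∘ₗ LinearMap.codRestrict _ LinearMap.id fun _ => rfl
  map_d h a := by
    refine (map_zero _).trans ?_
    rfl
  map_one := rfl
  map_mul h a b := rfl

theorem cohomologySelf_bijective (A : CDGA.{v, w} K) (n : ℕ) :
    Function.Bijective (A.cohomologySelf.toFun n) := by
  constructor
  · rw [injective_iff_map_eq_zero]
    intro x hx
    have h₁ := (Submodule.Quotient.mk_eq_zero _).1 hx
    rcases h₁ with ⟨m, h, y, hy⟩ | h₁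
    · exact hy.symm
    · exact h₁
  · intro y
    obtain ⟨⟨y, hy⟩, rfl⟩ := Submodule.Quotient.mk_surjective _ y
    exact ⟨y, rfl⟩

/-! ### Points -/

/-- An idempotent of degree zero that singles out a factor `K` of the algebra `H^0`. -/
structure IsPoint (C : CDGA.{v, w} K) (e : C.obj 0) : Prop where
  closed : e ∈ C.cocycles 0
  idem : C.mul rfl e e = e
  ne_zero : e ≠ 0
  exists_smul : ∀ z ∈ C.cocycles 0, ∃ c : K, C.mul rfl e z = c • e

/-- Degree 0 has no coboundaries, so a quasi-isomorphism is honestly bijective on closed elements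
there. This is what lets points move along arrows in both directions. -/
theorem Hom.IsQuasiIso.eq_zero_of_cocycle {f : Hom A B} (hf : f.IsQuasiIso) {x : A.obj 0}
    (hx : x ∈ A.cocycles 0) (h : f.toFun 0 x = 0) : x = 0 :=
  mem_coboundaries_zero.1 ((f.isQuasiIso_iff.1 hf 0).1 x hx (by rw [h]; exact zero_mem _))

theorem Hom.IsQuasiIso.exists_cocycle {f : Hom A B} (hf : f.IsQuasiIso) {y : B.obj 0}
    (hy : y ∈ B.cocycles 0) : ∃ x ∈ A.cocycles 0, f.toFun 0 x = y := by
  obtain ⟨x, hx, h⟩ := (f.isQuasiIso_iff.1 hf 0).2 y hy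
  exact ⟨x, hx, sub_eq_zero.1 (mem_coboundaries_zero.1 h)⟩

theorem IsPoint.map {f : Hom A B} (hf : f.IsQuasiIso) {e : A.obj 0} (he : A.IsPoint e) :
    B.IsPoint (f.toFun 0 e) where
  closed := f.map_mem_cocycles he.closed
  idem := by rw [← f.map_mul, he.idem]
  ne_zero h := he.ne_zero (hf.eq_zero_of_cocycle he.closed h)
  exists_smul z hz := by
    obtain ⟨x, hx, rfl⟩ := hf.exists_cocycle hz
    obtain ⟨c, hc⟩ := he.exists_smul x hx
    exact ⟨c, by rw [← f.map_mul, hc, map_smul]⟩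

theorem IsPoint.of_map {f : Hom A B} (hf : f.IsQuasiIso) {e : A.obj 0} (hc : e ∈ A.cocycles 0)
    (he : B.IsPoint (f.toFun 0 e)) : A.IsPoint e where
  closed := hc
  idem := by
    refine sub_eq_zero.1 (hf.eq_zero_of_cocycle (sub_mem (A.mul_mem_cocycles _ hc hc) hc) ?_)
    rw [map_sub, f.map_mul, he.idem, sub_self]
  ne_zero h := he.ne_zero (by rw [h, map_zero])
  exists_smul z hz := by
    obtain ⟨c, h⟩ := he.exists_smul _ (f.map_mem_cocycles hz)
    refine ⟨c, sub_eq_zero.1 (hf.eq_zero_of_cocycle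
      (sub_mem (A.mul_mem_cocycles _ hc hz) (Submodule.smul_mem _ c hc)) ?_)⟩
    rw [map_sub, f.map_mul, map_smul, h, sub_self]

theorem IsPoint.cohomologyClass {e : A.obj 0} (he : A.IsPoint e) :
    A.cohomology.IsPoint (A.cohomologyClass e he.closed) where
  closed := rfl
  idem := congrArg Submodule.Quotient.mk (Subtype.ext he.idem)
  ne_zero h := by
    have h₁ := (Submodule.Quotient.mk_eq_zero _).1 h
    exact he.ne_zero (mem_coboundaries_zero.1 h₁)
  exists_smul z _ := by
    obtain ⟨z, rfl⟩ := Submodule.Quotient.mk_surjective _ z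
    obtain ⟨c, hc⟩ := he.exists_smul z z.2
    exact ⟨c, congrArg Submodule.Quotient.mk (Subtype.ext hc)⟩

/-! ### Augmentations determined by points, and reductions. -/

/-- The augmentation of a CDGA given by a point `e` with `e x ∈ K e` for all `x` of degree zero. -/
noncomputable def augOfPoint (C : CDGA.{v, w} K) (e : C.obj 0) (he : C.IsPoint e)
    (h : ∀ x, ∃ c : K, C.mul (rfl : 0 + 0 = 0) e x = c • e) : AugCDGA.{v, w} K where
  toCDGA := C
  aug :=
    { toFun := fun x => (h x).choose
      map_add' := fun x y => smul_left_injective K he.ne_zero (by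
        simp only [add_smul]
        rw [← (h x).choose_spec, ← (h y).choose_spec, ← (h (x + y)).choose_spec, map_add])
      map_smul' := fun c x => smul_left_injective K he.ne_zero (by
        simp only [RingHom.id_apply, smul_eq_mul, mul_smul]
        rw [← (h x).choose_spec, ← (h (c • x)).choose_spec, map_smul]) }
  aug_one := smul_left_injective K he.ne_zero (by
    change (h C.one).choose • e = (1 : K) • e
    rw [← (h C.one).choose_spec, C.mul_one, one_smul])
  aug_mul h₀ x y := smul_left_injective K he.ne_zero (by
    change (h (C.mul h₀ x y)).choose • e = ((h x).choose * (h y).choose) • e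
    have h₁ := C.mul_assoc h₀ h₀ h₀ h₀ e x y
    rw [(h x).choose_spec, map_smul, LinearMap.smul_apply, (h y).choose_spec, smul_smul] at h₁
    rw [← (h (C.mul h₀ x y)).choose_spec, ← h₁])

theorem augOfPoint_smul (C : CDGA.{v, w} K) (e : C.obj 0) (he : C.IsPoint e)
    (h : ∀ x, ∃ c : K, C.mul (rfl : 0 + 0 = 0) e x = c • e) (x : C.obj 0) :
    C.mul (rfl : 0 + 0 = 0) e x = (C.augOfPoint e he h).aug x • e := (h x).choose_spec

/-- An augmented CDGA quasi-isomorphic to `C` whose augmentation is given by a point over `e`. -/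
structure Reduction (C : CDGA.{v, w} K) (e : C.obj 0) where
  alg : AugCDGA.{v, w} K
  pt : alg.obj 0
  closed : pt ∈ alg.cocycles 0
  mul_pt : ∀ x, alg.mul (rfl : 0 + 0 = 0) pt x = alg.aug x • pt
  hom : Hom alg.toCDGA C
  quasiIso : hom.IsQuasiIso
  hom_pt : hom.toFun 0 pt = e

/-- Multiplication by a point commutes with products. -/
theorem IsPoint.mul_mul_mul {e : C.obj 0} (he : C.IsPoint e) {i j k : ℕ} (h : i + j = k)
    (x : C.obj i) (y : C.obj j) : C.mul (zero_add k) e (C.mul h x y) =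
      C.mul h (C.mul (zero_add i) e x) (C.mul (zero_add j) e y) := by
  have h₁ : C.mul (add_zero i) (C.mul (zero_add i) e x) e = C.mul (zero_add i) e x := by
    rw [C.mul_comm (add_zero i) (zero_add i), ← C.mul_assoc (add_zero 0) (zero_add i) (zero_add i)
      (zero_add i), he.idem]
    simp
  rw [← C.mul_assoc (add_zero i) h (zero_add j) h, h₁, C.mul_assoc (zero_add i) h h (zero_add k)]

theorem IsPoint.mul_d {e : C.obj 0} (he : C.IsPoint e) {i j : ℕ} (h : i + 1 = j) (x : C.obj i) :
    C.mul (zero_add j) e (C.d h x) = C.d h (C.mul (zero_add i) e x) := by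
  rw [C.leibniz (zero_add i) h rfl h (by omega) (zero_add j), mem_cocycles.1 he.closed]
  simp

theorem IsPoint.mul_mul_self {e : C.obj 0} (he : C.IsPoint e) {i : ℕ} (x : C.obj i) :
    C.mul (zero_add i) e (C.mul (zero_add i) e x) = C.mul (zero_add i) e x := by
  rw [← C.mul_assoc (add_zero 0) (zero_add i) (zero_add i) (zero_add i), he.idem]

/-- The subalgebra of elements `x` with `e x ∈ K e` in degree `0` and `e x ∈ W` in degree `1`. -/
def reductionSubalgebra (C : CDGA.{v, w} K) (e : C.obj 0) (he : C.IsPoint e)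
    (W : Submodule K (C.obj 1)) : Subalgebra C where
  carrier
    | 0 => (K ∙ e).comap (C.mul (zero_add 0) e)
    | 1 => W.comap (C.mul (zero_add 1) e)
    | _ + 2 => ⊤
  one_mem := by
    change C.mul _ e C.one ∈ K ∙ e
    rw [C.mul_one]
    exact Submodule.mem_span_singleton_self e
  mul_mem {i j k} h x y hx hy := by
    rcases k with _ | _ | k
    · obtain ⟨rfl, rfl⟩ : i = 0 ∧ j = 0 := by omega
      obtain ⟨c, hc⟩ := Submodule.mem_span_singleton.1 hx
      change C.mul _ e (C.mul _ x y) ∈ K ∙ e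
      rw [he.mul_mul_mul, ← hc, map_smul, LinearMap.smul_apply, he.mul_mul_self]
      exact Submodule.smul_mem _ c hy
    · change C.mul _ e (C.mul _ x y) ∈ W
      rcases (by omega : i = 0 ∧ j = 1 ∨ i = 1 ∧ j = 0) with ⟨rfl, rfl⟩ | ⟨rfl, rfl⟩
      · obtain ⟨c, hc⟩ := Submodule.mem_span_singleton.1 hx
        rw [he.mul_mul_mul, ← hc, map_smul, LinearMap.smul_apply, he.mul_mul_self]
        exact Submodule.smul_mem _ c hy
      · obtain ⟨c, hc⟩ := Submodule.mem_span_singleton.1 hy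
        rw [he.mul_mul_mul, ← hc, map_smul, C.mul_comm h (zero_add 1), he.mul_mul_self]
        exact Submodule.smul_mem _ c (Submodule.smul_mem _ _ hx)
    · exact trivial
  d_mem {i j} h x hx := by
    rcases j with _ | _ | j
    · omega
    · obtain rfl : i = 0 := by omega
      obtain ⟨c, hc⟩ := Submodule.mem_span_singleton.1 hx
      change C.mul _ e (C.d _ x) ∈ W
      rw [he.mul_d, ← hc, map_smul, (cocycles_iff h).1 he.closed, smul_zero]
      exact zero_mem _
    · exact trivial

/-- With W a complement of d(e C^0), the reduction discards from e C all of degree 0 except K e, and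
from degree 1 the exact part d(e C^0). Closed elements of e C^0 lie in K e, so the discarded part is
acyclic. -/
theorem IsPoint.exists_reduction {e : C.obj 0} (he : C.IsPoint e) : Nonempty (C.Reduction e) := by
  obtain ⟨W, hW⟩ := Submodule.exists_isCompl
    (LinearMap.range (C.d (zero_add 1) ∘ₗ C.mul (zero_add 0) e))
  let S := C.reductionSubalgebra e he W
  -- Every element of degree 1 differs from one in the subalgebra by an exact element d(e z).
  have hdec (y : C.obj 1) : ∃ z : C.obj 0,
      C.mul (zero_add 1) e (y - C.d (zero_add 1) (C.mul (zero_add 0) e z)) ∈ W := by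
    have := hW.sup_eq_top ▸ Submodule.mem_top (x := C.mul (zero_add 1) e y)
    obtain ⟨_, ⟨z, rfl⟩, w, hw, h⟩ := Submodule.mem_sup.1 this
    refine ⟨z, ?_⟩
    rw [map_sub, he.mul_d, he.mul_mul_self, ← h]
    simpa using hw
  have hqi : S.incl.IsQuasiIso := by
    refine S.incl.isQuasiIso_iff.2 fun n => ?_
    match n with
    | 0 =>
      refine ⟨fun x hx h => ?_, fun y hy => ?_⟩
      · have h₁ : x = 0 := Subtype.ext (mem_coboundaries_zero.1 h)
        rw [h₁]
        exact zero_mem _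
      · obtain ⟨c, hc⟩ := he.exists_smul y hy
        refine ⟨⟨y, Submodule.mem_span_singleton.2 ⟨c, hc.symm⟩⟩, Subtype.ext hy, ?_⟩
        change y - y ∈ _
        rw [sub_self]; exact zero_mem _
    | 1 =>
      refine ⟨?_, fun y hy => ?_⟩
      · rintro ⟨x, hxW⟩ hx h
        obtain ⟨y, hy⟩ := mem_coboundaries_succ.1 h
        have hy : C.d (zero_add 1) y = x := hy
        have hxW : C.mul (zero_add 1) e x ∈ W := hxW
        have h₀ : C.d (zero_add 1) (C.mul (zero_add 0) e y) = 0 := by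
          rw [← hy, he.mul_d] at hxW
          exact Submodule.disjoint_def.1 hW.disjoint _ ⟨y, rfl⟩ hxW
        obtain ⟨c, hc⟩ := he.exists_smul _ ((cocycles_iff (zero_add 1)).2 h₀)
        refine mem_coboundaries_succ.2 ⟨⟨y, Submodule.mem_span_singleton.2 ⟨c, ?_⟩⟩,
          Subtype.ext hy⟩
        rw [← hc]
        exact he.mul_mul_self y
      · obtain ⟨z, hz⟩ := hdec y
        refine ⟨⟨_, hz⟩, Subtype.ext ?_, ?_⟩
        · change C.d _ (y - _) = 0
          rw [map_sub, C.d_d, mem_cocycles.1 hy, sub_zero]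
        · change y - C.d (zero_add 1) (C.mul (zero_add 0) e z) - y ∈ C.coboundaries 1
          rw [sub_sub_cancel_left]
          exact neg_mem (d_mem_coboundaries _ _ _)
    -- Degree 2 is still special: the subalgebra is everything there, but primitives in degree 1
    -- must first be corrected by `hdec`.
    | 2 =>
      refine ⟨?_, fun y hy => ⟨⟨y, trivial⟩, Subtype.ext hy, ?_⟩⟩
      · rintro ⟨x, hxW⟩ hx h
        obtain ⟨y, hy⟩ := mem_coboundaries_succ.1 h
        obtain ⟨z, hz⟩ := hdec y
        refine mem_coboundaries_succ.2 ⟨⟨_, hz⟩, Subtype.ext ?_⟩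
        change C.d _ (y - _) = x
        rw [map_sub, C.d_d, sub_zero]
        exact hy
      · change y - y ∈ _
        rw [sub_self]; exact zero_mem _
    | n + 3 =>
      refine ⟨?_, fun y hy => ⟨⟨y, trivial⟩, Subtype.ext hy, ?_⟩⟩
      · rintro ⟨x, hxW⟩ hx h
        obtain ⟨y, hy⟩ := mem_coboundaries_succ.1 h
        exact mem_coboundaries_succ.2 ⟨⟨y, trivial⟩, Subtype.ext hy⟩
      · change y - y ∈ _
        rw [sub_self]; exact zero_mem _
  let pt : S.toCDGA.obj 0 := ⟨e, Submodule.mem_span_singleton.2 ⟨1, by rw [he.idem, one_smul]⟩⟩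
  have hpt : S.toCDGA.IsPoint pt := IsPoint.of_map hqi (Subtype.ext he.closed) he
  have hsm (x : S.toCDGA.obj 0) : ∃ c : K, S.toCDGA.mul (rfl : 0 + 0 = 0) pt x = c • pt := by
    obtain ⟨c, hc⟩ := Submodule.mem_span_singleton.1 x.2
    exact ⟨c, Subtype.ext hc.symm⟩
  exact ⟨⟨S.toCDGA.augOfPoint pt hpt hsm, pt, hpt.closed, S.toCDGA.augOfPoint_smul pt hpt hsm,
    S.incl, hqi, rfl⟩⟩

/-- Morphisms that preserve points which determine the augmentations are augmented. -/
def _root_.AugCDGA.Hom.ofPoint {A B : AugCDGA.{v, w} K} (f : Hom A.toCDGA B.toCDGA) {e : A.obj 0}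
    (hA : ∀ x, A.mul (rfl : 0 + 0 = 0) e x = A.aug x • e) (hB : B.aug (f.toFun 0 e) = 1) :
    AugCDGA.Hom A B where
  toHom := f
  aug_map x := by
    have := congrArg (fun y => B.aug (f.toFun 0 y)) (hA x)
    simpa [f.map_mul, B.aug_mul, hB] using this

theorem Reduction.aug_pt {e : C.obj 0} (he : C.IsPoint e) (R : C.Reduction e) :
    R.alg.aug R.pt = 1 := by
  have h₁ : R.pt ≠ 0 := fun h => he.ne_zero (by rw [← R.hom_pt, h, map_zero])
  have h₂ := R.mul_pt R.pt
  have h₃ : R.alg.IsPoint R.pt := IsPoint.of_map R.quasiIso R.closed (by rw [R.hom_pt]; exact he)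
  rw [h₃.idem] at h₂
  exact smul_left_injective K h₁ (by simpa using h₂.symm)

/-- Two augmented CDGAs are linked if a zig-zag of quasi-isomorphisms joins them. -/
def _root_.AugCDGA.Linked (A B : AugCDGA.{v, w} K) : Prop :=
  Nonempty (ZigZag AugCDGA.QuasiIso A B)

theorem _root_.AugCDGA.Linked.trans {A B C : AugCDGA.{v, w} K} :
    A.Linked B → B.Linked C → A.Linked C := fun ⟨Z⟩ ⟨W⟩ => ⟨Z.append W⟩

theorem _root_.AugCDGA.Linked.symm {A B : AugCDGA.{v, w} K} : A.Linked B → B.Linked A :=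
  fun ⟨Z⟩ => ⟨Z.reverse⟩

theorem _root_.AugCDGA.Linked.of_hom {A B : AugCDGA.{v, w} K} (f : AugCDGA.Hom A B)
    (hf : f.toHom.IsQuasiIso) : A.Linked B := ⟨.fwd ⟨f, hf⟩ (.nil _)⟩

/-- A reduction of an augmented CDGA at a point of augmentation `1`. -/
theorem Reduction.linked_self {A : AugCDGA.{v, w} K} {e : A.obj 0} (he : A.aug e = 1)
    (R : A.toCDGA.Reduction e) : R.alg.Linked A :=
  .of_hom (.ofPoint R.hom R.mul_pt (by rw [R.hom_pt, he])) R.quasiIso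

/-- Any two reductions of a CDGA at the same point are linked. -/
theorem Reduction.linked [CharZero K] {e : C.obj 0} (he : C.IsPoint e) (R S : C.Reduction e) :
    R.alg.Linked S.alg := by
  let P := homotopyPullback R.hom S.hom
  let pt : P.toCDGA.obj 0 := ⟨(R.pt, (pathConst C).toFun 0 e, S.pt),
    by change R.hom.toFun 0 R.pt = (pathEval C 0).toFun 0 _; rw [pathEval_pathConst, R.hom_pt],
    by change S.hom.toFun 0 S.pt = (pathEval C 1).toFun 0 _; rw [pathEval_pathConst, S.hom_pt]⟩
  have h₁ := homotopyPullbackFst_isQuasiIso (f := R.hom) S.quasiIso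
  have h₂ := homotopyPullbackSnd_isQuasiIso R.quasiIso S.quasiIso
  have hR : R.alg.IsPoint R.pt := IsPoint.of_map R.quasiIso R.closed (by rw [R.hom_pt]; exact he)
  have hpt : P.toCDGA.IsPoint pt := IsPoint.of_map h₁ (Subtype.ext (Prod.ext R.closed
    (Prod.ext ((pathConst C).map_mem_cocycles he.closed) S.closed))) hR
  -- The augmentations pulled back to P along its two projections may differ. On a reduction at `pt`
  -- the point determines the augmentation, so both projections become augmented.
  obtain ⟨Q⟩ := hpt.exists_reduction
  refine AugCDGA.Linked.trans (AugCDGA.Linked.symm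
    (.of_hom (.ofPoint ((homotopyPullbackFst R.hom S.hom).comp Q.hom) Q.mul_pt ?_)
      (h₁.comp Q.quasiIso)))
    (.of_hom (.ofPoint ((homotopyPullbackSnd R.hom S.hom).comp Q.hom) Q.mul_pt ?_)
      (h₂.comp Q.quasiIso))
  · change R.alg.aug ((homotopyPullbackFst R.hom S.hom).toFun 0 (Q.hom.toFun 0 Q.pt)) = 1
    rw [Q.hom_pt]
    exact R.aug_pt he
  · change S.alg.aug ((homotopyPullbackSnd R.hom S.hom).toFun 0 (Q.hom.toFun 0 Q.pt)) = 1
    rw [Q.hom_pt]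
    exact S.aug_pt he

/-- The image of a reduction under a quasi-isomorphism. -/
def Reduction.map {e : A.obj 0} (R : A.Reduction e) {f : Hom A B} (hf : f.IsQuasiIso)
    {e' : B.obj 0} (h : f.toFun 0 e = e') : B.Reduction e' where
  __ := R
  hom := f.comp R.hom
  quasiIso := hf.comp R.quasiIso
  hom_pt := by
    change f.toFun 0 (R.hom.toFun 0 R.pt) = e'
    rw [R.hom_pt, h]

/-- A zig-zag of quasi-isomorphisms transports points and links the reductions at them. -/
theorem exists_point_of_zigZag [CharZero K] (Z : ZigZag CDGA.QuasiIso A B) {e : A.obj 0}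
    (he : A.IsPoint e) : ∃ (e' : B.obj 0) (he' : B.IsPoint e')
      (φ : Hom A.cohomology B.cohomology), (∀ n, Function.Bijective (φ.toFun n)) ∧
        φ.toFun 0 (A.cohomologyClass e he.closed) = B.cohomologyClass e' he'.closed ∧
        ∀ (R : A.Reduction e) (S : B.Reduction e'), R.alg.Linked S.alg := by
  induction Z with
  | nil A =>
    exact ⟨e, he, ⟨fun n => LinearMap.id, fun _ _ => rfl, rfl, fun _ _ _ => rfl⟩,
      fun n => Function.bijective_id, rfl, fun R S => R.linked he S⟩
  | @fwd A A' B f Z ih =>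
    obtain ⟨e', he', φ, hφ, hφe, h⟩ := ih (he.map f.2)
    exact ⟨e', he', φ.comp f.1.cohomologyHom, fun n => (hφ n).comp (f.2 n), hφe,
      fun R S => h (R.map f.2 rfl) S⟩
  | @bwd A A' B f Z ih =>
    -- Against the direction of an arrow the point is lifted. A reduction at the lift, pushed
    -- forward along the arrow, is also a reduction at e and connects the two sides.
    obtain ⟨e₁, h₁, rfl⟩ := f.2.exists_cocycle he.closed
    have hp := IsPoint.of_map f.2 h₁ he
    obtain ⟨e', he', φ, hφ, hφe, h⟩ := ih hp
    refine ⟨e', he', φ.comp (f.1.cohomologyHom.inverse f.2),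
      fun n => (hφ n).comp (Hom.inverse_bijective _ _ n), ?_, fun R S => ?_⟩
    · rw [← hφe]
      exact congrArg (φ.toFun 0) (f.1.cohomologyHom.inverse_apply f.2 (A'.cohomologyClass e₁ h₁))
    · obtain ⟨Q⟩ := hp.exists_reduction
      exact (R.linked he (Q.map f.2 rfl)).trans (h Q S)

/-- If a zig-zag of quasi-isomorphisms joins an augmented CDGA to its cohomology, and some point has
augmentation `1`, then there is a zig-zag of augmented quasi-isomorphisms. -/
theorem _root_.AugCDGA.linked_cohomology [CharZero K] (A : AugCDGA.{v, w} K)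
    (Z : ZigZag CDGA.QuasiIso A.toCDGA A.toCDGA.cohomology) {e : A.obj 0}
    (he : A.toCDGA.IsPoint e) (h : A.aug e = 1) : A.Linked A.cohomology := by
  obtain ⟨e', he', φ, hφ, hφe, hlink⟩ := exists_point_of_zigZag Z he
  obtain ⟨R⟩ := he.exists_reduction
  obtain ⟨S⟩ := he'.exists_reduction
  obtain ⟨T⟩ := he.cohomologyClass.exists_reduction
  -- The zig-zag may end at a point e' of H(A) other than the class of e. The isomorphism φ sends
  -- the class of e to that of e', so S and T both become reductions of H(H(A)) at one point.
  have hS : S.alg.Linked T.alg := Reduction.linked he'.cohomologyClass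
    (S.map (Hom.isQuasiIso_of_bijective _ (cohomologySelf_bijective _)) rfl)
    (T.map (Hom.isQuasiIso_of_bijective φ hφ) hφe)
  exact (R.linked_self h).symm.trans ((hlink R S).trans
    (hS.trans (Reduction.linked_self (A := A.cohomology) h T)))

end CDGA

/-! ### Closed polynomial functions on a simplex are constant. -/

namespace PolyForm

open Polynomial

variable {K : Type v} [Field K] {ι : Type} [Fintype ι] [DecidableEq ι]

/-- The barycentric coordinates of the straight line from the vertex `v` to a point. -/
noncomputable def line (K : Type v) [Field K] {ι : Type} [Fintype ι] [DecidableEq ι] (v i : ι) :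
    (PolyForm K ι)[X] :=
  C (t K i) * X + (if i = v then 1 - X else 0)

theorem derivative_line (v i : ι) :
    derivative (line K v i) = C (t K i) - (if i = v then 1 else 0) := by
  by_cases h : i = v <;> simp [line, h, sub_eq_add_neg]

theorem line_commute (v i j : ι) : Commute (line K v i) (C (t K j)) := by
  have h₁ : Commute (C (t K i) : (PolyForm K ι)[X]) (C (t K j)) := by
    rw [Commute, SemiconjBy, ← C_mul, ← C_mul, t_mul_t]
  have h₂ : Commute (X : (PolyForm K ι)[X]) (C (t K j)) := commute_X _
  unfold line
  refine (h₁.mul_left h₂).add_left ?_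
  split_ifs
  · exact (Commute.one_left _).sub_left h₂
  · exact Commute.zero_left _

theorem line_commute_derivative (v i j : ι) :
    Commute (line K v i) (derivative (line K v j)) := by
  rw [derivative_line]
  refine (line_commute v i j).sub_right ?_
  split_ifs
  · exact Commute.one_right _
  · exact Commute.zero_right _

theorem line_commute_line (v i j : ι) : Commute (line K v i) (line K v j) := by
  have h : Commute (line K v i) X := (commute_X _).symm
  nth_rw 2 [line]
  refine ((line_commute v i j).mul_right h).add_right ?_
  split_ifs
  · exact (Commute.one_right _).sub_right h
  · exact Commute.zero_right _

theorem sum_line (v : ι) : ∑ i, line K v i = 1 := by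
  simp only [line, Finset.sum_add_distrib, ← Finset.sum_mul, ← map_sum, sum_t]
  simp

/-- The pullback of polynomial forms along the straight lines from the vertex `v`, without the
terms in the differentials of the base: `a + dt b` is encoded by the matrix `(a, b; 0, a)`. -/
noncomputable def lineMat (v : ι) :
    PolyForm K ι →ₐ[K] Matrix (Fin 2) (Fin 2) (PolyForm K ι)[X] :=
  lift (Sum.elim (fun i => !![line K v i, 0; 0, line K v i])
      (fun i => !![0, derivative (line K v i); 0, 0]))
    (by
      intro i j
      simp [(line_commute_line v i j).eq])
    (by
      intro i j
      simp [(line_commute_derivative v i j).eq])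
    (by simp)
    (by
      ext1 a b
      rw [Matrix.sum_apply]
      fin_cases a <;> fin_cases b <;> simp [sum_line])
    (by
      ext1 a b
      rw [Matrix.sum_apply]
      fin_cases a <;> fin_cases b <;> simp [← map_sum, sum_line])

/-- The part of `lineMat` without differentials. -/
noncomputable def lineMap (v : ι) : PolyForm K ι →ₗ[K] (PolyForm K ι)[X] :=
  (Matrix.entryLinearMap K (PolyForm K ι)[X] (0 : Fin 2) (0 : Fin 2)) ∘ₗ (lineMat v).toLinearMap

/-- For a function p pulled back to the lines from v, the dt-component of dp is the derivative along
the line, and the values at times 1 and 0 are p and p(v). -/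
theorem lineMat_mon (v : ι) (l : List (ι ⊕ ι)) (hl : formDeg l = 0) :
    lineMat v (mon K l) = !![lineMap v (mon K l), 0; 0, lineMap v (mon K l)] ∧
      lineMat v (d (mon K l)) = !![0, derivative (lineMap v (mon K l)); 0, 0] ∧
      (lineMap v (mon K l)).eval 1 = mon K l ∧
      (lineMap v (mon K l)).eval 0 = algebraMap K _ (evalVertex v (mon K l)) := by
  induction l with
  | nil =>
    simp only [mon_nil, map_one, d_one, map_zero, lineMap, LinearMap.comp_apply,
      AlgHom.toLinearMap_apply, Matrix.entryLinearMap_apply, Matrix.one_apply_eq, eval_one,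
      derivative_one, and_self, and_true]
    exact ⟨Matrix.one_fin_two, Matrix.eta_fin_two 0⟩
  | cons s l ih =>
    rcases s with i | i
    · obtain ⟨h₁, h₂, h₃, h₄⟩ := ih (by simpa using hl)
      set g := lineMap v (mon K l)
      have ht : lineMat v (t K i) = !![line K v i, 0; 0, line K v i] := by simp [lineMat]
      have hdt : lineMat v (dt K i) = !![0, derivative (line K v i); 0, 0] := by simp [lineMat]
      have hg : lineMap v (mon K (Sum.inl i :: l)) = line K v i * g := by
        simp [lineMap, ht, h₁]
      rw [hg]
      refine ⟨?_, ?_, ?_, ?_⟩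
      · rw [mon_cons, map_mul, ht, h₁]; simp
      · rw [mon_cons, d_gen_mul, d_t, map_add, map_smul, map_mul, map_mul, ht, hdt, h₁, h₂]
        simp [derivative_mul]
      -- Evaluation is not multiplicative over a noncommutative ring, so the product is first
      -- brought to a form in which only constants on the left and powers of X occur.
      · have : line K v i * g = C (t K i) * (g * X) + (if i = v then g - g * X else 0) := by
          unfold line
          split_ifs <;> simp [add_mul, sub_mul, mul_assoc, (commute_X g).eq]
        rw [this, mon_cons]
        split_ifs <;> simp [h₃]
      · have : line K v i * g = C (t K i) * (g * X) + (if i = v then g - g * X else 0) := by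
          unfold line
          split_ifs <;> simp [add_mul, sub_mul, mul_assoc, (commute_X g).eq]
        rw [this, mon_cons]
        split_ifs with h <;> simp [h₄, evalVertex, h]
    · simp at hl

/-- In characteristic zero, closed polynomial functions are constant. -/
theorem eq_algebraMap_of_d_eq_zero [CharZero K] (v : ι) {p : PolyForm K ι} (hp : p ∈ deg K ι 0)
    (h : d p = 0) : p = algebraMap K _ (evalVertex v p) := by
  have key : lineMat v (d p) 0 1 = derivative (lineMap v p) ∧ (lineMap v p).eval 1 = p ∧
      (lineMap v p).eval 0 = algebraMap K _ (evalVertex v p) := by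
    clear h
    induction hp using Submodule.span_induction with
    | zero => simp
    | add x y _ _ hx hy =>
      obtain ⟨hx₁, hx₂, hx₃⟩ := hx
      obtain ⟨hy₁, hy₂, hy₃⟩ := hy
      simp [hx₁, hx₂, hx₃, hy₁, hy₂, hy₃]
    | smul c x _ hx =>
      obtain ⟨hx₁, hx₂, hx₃⟩ := hx
      refine ⟨by simp [hx₁], by simp [hx₂], ?_⟩
      rw [map_smul, eval_smul, hx₃, map_smul, smul_eq_mul, map_mul, Algebra.smul_def]
    | mem a ha =>
      obtain ⟨l, hl, rfl⟩ := ha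
      obtain ⟨-, h₂, h₃, h₄⟩ := lineMat_mon (K := K) v l hl
      exact ⟨by rw [h₂]; rfl, h₃, h₄⟩
  obtain ⟨h₁, h₂, h₃⟩ := key
  rw [h, map_zero] at h₁
  -- Characteristic zero enters here: a vanishing derivative forces a polynomial to be constant only
  -- over torsion-free coefficients.
  have : IsAddTorsionFree (PolyForm K ι) := .of_isTorsionFree K _
  have h₁ : derivative (lineMap v p) = 0 := h₁.symm
  have h₄ := eq_C_of_derivative_eq_zero h₁
  rw [h₄, eval_C] at h₂ h₃
  rw [← h₃, h₂]

end PolyForm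

/-! ### The point of A_PL given by the basepoint, and the theorem. -/

open CategoryTheory Simplicial in
/-- The idempotent of `A_PL(X; K)` that is `1` on the simplices on which all closed functions take
their value at the basepoint, and `0` on the other simplices. -/
theorem exists_isPoint_aplPointed (K : Type v) [Field K] [CharZero K] (X : Type u)
    [TopologicalSpace X] (x₀ : X) : ∃ e : (aplPointed K X x₀).obj 0,
      (aplPointed K X x₀).toCDGA.IsPoint e ∧ (aplPointed K X x₀).aug e = 1 := by
  classical
  set A := aplPointed K X x₀
  let S := TopCat.toSSet.obj (TopCat.of X)
  let cond (n : SimplexCategory) (σ : S.obj (Opposite.op n)) : Prop :=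
    ∀ z : aplForms K S 0, (z : A.obj 0) ∈ A.cocycles 0 →
      PolyForm.evalVertex (0 : Fin (n.len + 1)) (z.1 n σ) = A.aug z
  have hconst (z : aplForms K S 0) (hz : (z : A.obj 0) ∈ A.cocycles 0) n σ :
      z.1 n σ = algebraMap K _ (PolyForm.evalVertex (0 : Fin (n.len + 1)) (z.1 n σ)) :=
    PolyForm.eq_algebraMap_of_d_eq_zero 0 (z.2.1 n σ)
      (congrFun (congrFun (congrArg Subtype.val hz) n) σ)
  -- Constants are unchanged by pullback and have the same value at all vertices, so the condition
  -- is invariant under faces and degeneracies and its indicator is a form.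
  have hcond (m n : SimplexCategory) (θ : m ⟶ n) (σ : S.obj (Opposite.op n)) :
      cond m (S.map θ.op σ) ↔ cond n σ := by
    refine forall_congr' fun z => imp_congr_right fun hz => ?_
    rw [z.2.2 m n θ σ, hconst z hz n σ, AlgHom.commutes, AlgHom.commutes, AlgHom.commutes]
  let e : aplForms K S 0 := ⟨fun n σ => if cond n σ then 1 else 0, fun n σ => by
      beta_reduce
      split_ifs
      · exact PolyForm.one_mem
      · exact zero_mem _, fun m n θ σ => by
      by_cases h : cond n σ
      · simp [h, (hcond m n θ σ).2 h]
      · simp [h, mt (hcond m n θ σ).1 h]⟩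
  have haug : A.aug e = 1 := by
    -- At the basepoint simplex the condition is the definition of the augmentation.
    have h : cond ⦋0⦌ ((TopCat.toSSetObjEquiv (TopCat.of X) (Opposite.op ⦋0⦌)).symm
        (ContinuousMap.const _ x₀)) := fun z hz => rfl
    change PolyForm.evalVertex (0 : Fin 1) (if cond _ _ then 1 else 0) = 1
    rw [if_pos h, map_one]
  refine ⟨e, ⟨?_, ?_, ?_, fun z hz => ⟨A.aug z, ?_⟩⟩, haug⟩
  · refine Subtype.ext (funext fun n => funext fun σ => ?_)
    change PolyForm.d (if cond n σ then 1 else 0) = 0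
    split_ifs <;> simp
  · refine Subtype.ext (funext fun n => funext fun σ => ?_)
    change (if cond n σ then 1 else 0) * (if cond n σ then 1 else 0) = if cond n σ then 1 else 0
    split_ifs <;> simp
  · intro h
    rw [h, map_zero] at haug
    exact zero_ne_one haug
  · refine Subtype.ext (funext fun n => funext fun σ => ?_)
    change (if cond n σ then 1 else 0) * z.1 n σ = A.aug z • (if cond n σ then 1 else 0)
    split_ifs with h
    · rw [hconst z hz n σ, h z hz, one_mul, Algebra.algebraMap_eq_smul_one]
    · rw [zero_mul, smul_zero]

theorem theoremT (K : Type v) [Field K] [CharZero K] (X : Type u) [TopologicalSpace X] (x₀ : X)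
    (hX : IsFormalSpace K X) :
    Nonempty (ZigZag AugCDGA.QuasiIso (aplPointed K X x₀) (aplPointed K X x₀).cohomology) ∧
      ∀ Z : ZigZag AugCDGA.QuasiIso (aplPointed K X x₀) (aplPointed K X x₀).cohomology,
        AugCDGA.BarIsHopfZigZag Z := by
  refine ⟨?_, fun Z => AugCDGA.barIsHopfZigZag Z⟩
  obtain ⟨Z⟩ := hX
  obtain ⟨e, he, h⟩ := exists_isPoint_aplPointed K X x₀
  exact (aplPointed K X x₀).linked_cohomology Z he h
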